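/- Let $\mathcal C=[-1,1]^d$, let $m\ge 1$ and $f=\frac1m\sum_{j=1}^m f_j$, where each $f_j:\mathcal C\to\mathbb R$ is convex and smooth up to order $2$ with bound $L_j$, i.e. all partial derivatives of $f_j$ of orders $0,1,2$ exist on $\mathcal C$ (one-sided on the boundary) and are bounded by $L_j$ in absolute value. Let $x^*$ be the unique local minimizer of $f$ on $\mathcal C$, $L_{\max}=\max_j L_j$ and $\sigma_f^*=\frac1m\sum_{j=1}^m\|\nabla f_j(x^*)-\nabla f(x^*)\|_2^2$. Let $\Delta$ be the Dirichlet Laplacian on $L^2(\mathcal C;\mathbb C)$ and, for a function $g$, let $\hat g$ be multiplication by $g$. Let $\rho_0$ be a mixed quantum state (a positive trace class operator of trace $1$ on $L^2(\mathcal C;\mathbb C)$) that is smooth up to order $2$, i.e. $\nabla_{j_1}\cdots\nabla_{j_k}\rho_0$ exists and is trace class for $k\le 2$ and all $j_1,\dots,j_k$. Let $\alpha,\beta,\gamma:[0,T]\to\mathbb R$, with $\alpha$ continuous, satisfy the strong ideal scaling condition $$\psi=\alpha-\gamma,\qquad \chi=\alpha+\beta+\gamma,\qquad \dot\beta=\dot\gamma=e^{\alpha}.$$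 These are functions of the effective time $\tau=\tau(t)=\int_0^t u(s)\,ds\in[0,T]$, where the learning rate schedule is $u=e^{-(\alpha+\beta)}$, i.e. $u(t)=e^{-(\alpha(\tau(t))+\beta(\tau(t)))}$, for $t\in[0,S]$. For a learning rate $\eta>0$ let the mixed states $\rho_t$, $t\in[0,S]$, starting at $\rho_0$, solve the Lindblad equation of the Stochastic Quantum Hybrid Dynamics $$\frac{d\rho_t}{dt}=u(t)\,\mathcal L_{GD}[\rho_t]+u(t)^2\eta\,\mathcal L_{NOISE}[\rho_t],$$ $$\mathcal L_{GD}[\sigma]=-i\Big[e^{\psi(\tau)}\big(-\tfrac12\Delta\big)+e^{\chi(\tau)}\hat f,\;\sigma\Big],\qquad \mathcal L_{NOISE}[\sigma]=\frac{e^{2\chi(\tau)}}{2}\Big([\hat f,[\hat f,\sigma]]-\frac1m\sum_{j=1}^m[\hat f_j,[\hat f_j,\sigma]]\Big),$$ where the derivative is taken in trace norm and $\Delta\rho_t$ and $\rho_t\Delta$ are trace class for every $t\in[0,S]$. Then, with $\langle\hat f\rangle_t=\operatorname{tr}(\hat f\rho_t)$, for all $t\in[0,S]$ $$\langle\hat f\rangle_t-f(x^*)\le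 C_1e^{-\beta(\tau(t))}+C_2\,\eta\,\big(\sigma_f^*+dL_{\max}^2\big).$$ Here $C_2>0$ is a universal constant, and $C_1>0$ depends only on $d,m,(f_j),(L_j),x^*,\rho_0,\beta(0),\gamma(0)$ (not on $t$, $S$, $T$, $\eta$, or otherwise on $\alpha,\beta,\gamma$). -/

import Mathlib

open MeasureTheory Filter Topology Set
open scoped ENNReal

noncomputable section

namespace SQHD

/-! ### Trace class operators on a complex Hilbert space -/

section TraceClass

variable {H : Type*} [NormedAddCommGroup H] [InnerProductSpace ℂ H]

/-- The trace norm `‖A‖₁ ∈ [0, ∞]`: the supremum of `∑ᵢ |⟪eᵢ, A gᵢ⟫|` over all finite orthonormal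
systems `e`, `g` of the same length. -/
def traceNorm (A : H →L[ℂ] H) : ℝ≥0∞ :=
  ⨆ (n : ℕ) (e : Fin n → H) (g : Fin n → H) (_ : Orthonormal ℂ e) (_ : Orthonormal ℂ g),
    ∑ i, ‖inner ℂ (e i) (A (g i))‖ₑ

/-- `A` is trace class. -/
def IsTraceClass (A : H →L[ℂ] H) : Prop := traceNorm A < ⊤

/-- The trace of an operator, `∑ᵢ ⟪bᵢ, A bᵢ⟫` over a Hilbert basis `b` (for a trace class operator
the series converges absolutely and the sum does not depend on `b`). -/
def trace [CompleteSpace H] (A : H →L[ℂ] H) : ℂ :=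
  ∑' i, inner ℂ ((exists_hilbertBasis ℂ H).choose_spec.choose i)
    (A ((exists_hilbertBasis ℂ H).choose_spec.choose i))

/-- Mixed quantum states: positive trace class operators of trace one. -/
structure IsState [CompleteSpace H] (ρ : H →L[ℂ] H) : Prop where
  pos : ρ.IsPositive
  traceClass : IsTraceClass ρ
  trace_one : trace ρ = 1

/-- The commutator of two bounded operators. -/
def comm (A B : H →L[ℂ] H) : H →L[ℂ] H := A.comp B - B.comp A

/-- `ρ` has the derivative `D` in trace norm at the point `t` of `[0, S]` (one-sided at the end
points). -/
def HasTraceDerivAt (S : ℝ) (ρ : ℝ → H →L[ℂ] H) (D : H →L[ℂ] H) (t : ℝ) : Prop :=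
  Tendsto (fun s : ℝ => traceNorm (((s - t)⁻¹ : ℂ) • (ρ s - ρ t) - D))
    (𝓝[Icc 0 S \ {t}] t) (𝓝 0)

end TraceClass

/-! ### The cube, and functions on it -/

/-- `ℝ^d` with the Euclidean norm. -/
abbrev E (d : ℕ) : Type := EuclideanSpace ℝ (Fin d)

/-- The cube `[-1, 1]^d`. -/
def cube (d : ℕ) : Set (E d) := {x | ∀ j, x j ∈ Icc (-1 : ℝ) 1}

/-- The `j`-th standard unit vector. -/
def unitVec {d : ℕ} (j : Fin d) : E d := EuclideanSpace.single j (1 : ℝ)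

/-- The `s ∈ ℝ` for which `x + s eⱼ` lies in the cube. -/
def slice {d : ℕ} (j : Fin d) (x : E d) : Set ℝ := {s | x + s • unitVec j ∈ cube d}

/-- The partial derivative `∂g/∂xⱼ` of a function on the cube (one-sided on the boundary). -/
def pd {d : ℕ} (j : Fin d) (g : E d → ℝ) (x : E d) : ℝ :=
  derivWithin (fun s : ℝ => g (x + s • unitVec j)) (slice j x) 0

/-- Existence of the partial derivative `∂g/∂xⱼ` at every point of the cube. -/
def HasPd {d : ℕ} (j : Fin d) (g : E d → ℝ) : Prop :=
  ∀ x ∈ cube d, DifferentiableWithinAt ℝ (fun s : ℝ => g (x + s • unitVec j)) (slice j x) 0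

/-- The iterated partial derivative along a list of directions. -/
def iterPd {d : ℕ} : List (Fin d) → (E d → ℝ) → (E d → ℝ)
  | [], g => g
  | j :: js, g => pd j (iterPd js g)

/-- A function on the cube is smooth up to order `K` with bound `L`: all its partial derivatives of
order `0, …, K` exist on the cube and are bounded there by `L` in absolute value. -/
def SmoothUpTo {d : ℕ} (K : ℕ) (L : ℝ) (g : E d → ℝ) : Prop :=
  (∀ js : List (Fin d), js.length < K → ∀ j, HasPd j (iterPd js g)) ∧
  ∀ js : List (Fin d), js.length ≤ K → ∀ x ∈ cube d, |iterPd js g x| ≤ L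

/-- The average `f = (1/m) ∑ⱼ fⱼ`. -/
def avg {d m : ℕ} (f : Fin m → E d → ℝ) (x : E d) : ℝ := (1 / (m : ℝ)) * ∑ j, f j x

/-- The gradient noise `(1/m) ∑ⱼ ‖∇fⱼ(x) - ∇f(x)‖²` at the point `x`. -/
def gradNoise {d m : ℕ} (f : Fin m → E d → ℝ) (x : E d) : ℝ :=
  (1 / (m : ℝ)) * ∑ j, ∑ k, (pd k (f j) x - pd k (avg f) x) ^ 2

/-! ### The Hilbert space `L²` of the cube and its operators -/

/-- Lebesgue measure on the cube. -/
abbrev cubeMeasure (d : ℕ) : Measure (E d) := volume.restrict (cube d)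

/-- The Hilbert space `L²([-1, 1]^d; ℂ)`. -/
abbrev Hilb (d : ℕ) : Type := Lp ℂ 2 (cubeMeasure d)

open Classical in
/-- The multiplication operator `ĝ`, `(ĝ ψ)(x) = g(x) ψ(x)`, for `g ∈ L^∞` (and `0` otherwise). -/
def mulOp {d : ℕ} (g : E d → ℝ) : Hilb d →L[ℂ] Hilb d :=
  if h : MemLp (fun x => (g x : ℂ)) ⊤ (cubeMeasure d) then
    (ContinuousLinearMap.mul ℂ ℂ).holderL (cubeMeasure d) ⊤ 2 2 (h.toLp _)
  else 0

theorem mulOp_apply_ae {d : ℕ} {g : E d → ℝ}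
    (h : MemLp (fun x => (g x : ℂ)) ⊤ (cubeMeasure d)) (φ : Hilb d) :
    mulOp g φ =ᵐ[cubeMeasure d] fun x => (g x : ℂ) * φ x := by
  rw [mulOp, dif_pos h]
  refine (ContinuousLinearMap.coeFn_holder (r := 2) (ContinuousLinearMap.mul ℂ ℂ)
    (h.toLp _) φ).trans ?_
  filter_upwards [h.coeFn_toLp] with x hx
  simp [hx]

/-- Test functions: smooth functions with compact support in the open cube. -/
structure IsTest {d : ℕ} (η : E d → ℂ) : Prop where
  smooth : ContDiff ℝ ((⊤ : ℕ∞) : WithTop ℕ∞) η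
  compact : HasCompactSupport η
  support : tsupport η ⊆ interior (cube d)

/-- The classical partial derivative of a test function. -/
def testPd {d : ℕ} (j : Fin d) (η : E d → ℂ) (x : E d) : ℂ := fderiv ℝ η x (unitVec j)

/-- `χ = ∂φ/∂xⱼ` in the weak sense in the open cube. -/
def HasWeakPd {d : ℕ} (j : Fin d) (φ χ : Hilb d) : Prop :=
  ∀ η : E d → ℂ, IsTest η →
    ∫ x in cube d, φ x * testPd j η x = -∫ x in cube d, χ x * η x

/-- `A = ∇_{j₁} ⋯ ∇_{jₖ} ρ`, with weak derivatives. -/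
def HasOpDeriv {d : ℕ} : List (Fin d) → (Hilb d →L[ℂ] Hilb d) → (Hilb d →L[ℂ] Hilb d) → Prop
  | [], ρ, A => A = ρ
  | j :: js, ρ, A => ∃ B, HasOpDeriv js ρ B ∧ ∀ φ, HasWeakPd j (B φ) (A φ)

/-- A mixed state is smooth up to order `K` with bound `C`: all the operators
`∇_{j₁} ⋯ ∇_{jₖ} ρ`, `k = 0, …, K`, exist and have trace norm at most `C`. -/
def StateSmoothUpTo {d : ℕ} (K : ℕ) (C : ℝ) (ρ : Hilb d →L[ℂ] Hilb d) : Prop :=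
  ∀ js : List (Fin d), js.length ≤ K →
    ∃ A, HasOpDeriv js ρ A ∧ traceNorm A ≤ ENNReal.ofReal C

/-- `φ` lies in the Sobolev space `H¹₀` of the open cube (the `H¹`-closure of the test functions),
and its weak gradient is `G`. -/
def HasGradH10 {d : ℕ} (φ : Hilb d) (G : Fin d → Hilb d) : Prop :=
  ∃ η : ℕ → E d → ℂ, (∀ n, IsTest (η n)) ∧
    Tendsto (fun n => eLpNorm (fun x => η n x - φ x) 2 (cubeMeasure d)) atTop (𝓝 0) ∧
    ∀ j, Tendsto (fun n => eLpNorm (fun x => testPd j (η n) x - G j x) 2 (cubeMeasure d))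
      atTop (𝓝 0)

/-- `φ` lies in the domain of the Dirichlet Laplacian of the cube and `Δφ = χ`: `φ ∈ H¹₀` and
`∫ ∇φ · ∇η = -∫ χ η` for all test functions `η`. -/
def HasLaplacian {d : ℕ} (φ χ : Hilb d) : Prop :=
  ∃ G : Fin d → Hilb d, HasGradH10 φ G ∧
    ∀ η : E d → ℂ, IsTest η →
      ∑ j, ∫ x in cube d, G j x * testPd j η x = -∫ x in cube d, χ x * η x

/-- `D` is the commutator `[Δ, σ] = Δσ - σΔ`, where `Δσ` is everywhere defined and trace class, and
`σΔ` (defined on the domain of `Δ`) extends to a trace class operator. -/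
def IsLaplacianComm {d : ℕ} (σ D : Hilb d →L[ℂ] Hilb d) : Prop :=
  ∃ A B : Hilb d →L[ℂ] Hilb d, IsTraceClass A ∧ IsTraceClass B ∧
    (∀ φ, HasLaplacian (σ φ) (A φ)) ∧
    (∀ φ χ, HasLaplacian φ χ → B φ = σ χ) ∧
    D = A - B

/-! ### Stochastic Quantum Hybrid Dynamics -/

/-- `L_GD[σ] = -i [H, σ]` with `H = e^ψ (-Δ/2) + e^χ f̂`, where `D = [Δ, σ]`. -/
def genGD {d m : ℕ} (f : Fin m → E d → ℝ) (ψ χ : ℝ) (σ D : Hilb d →L[ℂ] Hilb d) :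
    Hilb d →L[ℂ] Hilb d :=
  (-Complex.I) • (((Real.exp ψ * (-1 / 2) : ℝ) : ℂ) • D +
    ((Real.exp χ : ℝ) : ℂ) • comm (mulOp (avg f)) σ)

/-- `L_NOISE[σ] = (e^{2χ}/2) ([f̂, [f̂, σ]] - (1/m) ∑ⱼ [f̂ⱼ, [f̂ⱼ, σ]])`. -/
def genNoise {d m : ℕ} (f : Fin m → E d → ℝ) (χ : ℝ) (σ : Hilb d →L[ℂ] Hilb d) :
    Hilb d →L[ℂ] Hilb d :=
  ((Real.exp (2 * χ) / 2 : ℝ) : ℂ) •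
    (comm (mulOp (avg f)) (comm (mulOp (avg f)) σ) -
      ((1 / (m : ℝ) : ℝ) : ℂ) • ∑ j, comm (mulOp (f j)) (comm (mulOp (f j)) σ))

/-- The strong ideal scaling condition on `[0, T]` (with `α` continuous). -/
structure StrongIdealScaling (T : ℝ) (α β γ ψ χ : ℝ → ℝ) : Prop where
  cont : ContinuousOn α (Icc 0 T)
  psi : ∀ s ∈ Icc 0 T, ψ s = α s - γ s
  chi : ∀ s ∈ Icc 0 T, χ s = α s + β s + γ s
  beta : ∀ s ∈ Icc 0 T, HasDerivWithinAt β (Real.exp (α s)) (Icc 0 T) s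
  gamma : ∀ s ∈ Icc 0 T, HasDerivWithinAt γ (Real.exp (α s)) (Icc 0 T) s

/-- The learning rate schedule `u = e^{-(α+β)}` and the effective time `τ(t) = ∫₀ᵗ u(s) ds`, for
`t ∈ [0, S]`. The coefficients `α`, `β` are functions of the effective time, which stays in their
domain `[0, T]`. -/
structure IsSchedule (T S : ℝ) (α β u τ : ℝ → ℝ) : Prop where
  rate : ∀ t ∈ Icc 0 S, u t = Real.exp (-(α (τ t) + β (τ t)))
  time : ∀ t ∈ Icc 0 S, τ t = ∫ s in (0 : ℝ)..t, u s
  mem : ∀ t ∈ Icc 0 S, τ t ∈ Icc 0 T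

/-- `ρ` is a trajectory of mixed states on `[0, S]` that starts in `ρ₀` and solves the Lindblad
equation `dρ/dt = u L_GD[ρ] + u² η L_NOISE[ρ]`, the coefficients `ψ`, `χ` being taken at the
effective time `τ(t)`. -/
structure IsSolution {d m : ℕ} (f : Fin m → E d → ℝ) (η S : ℝ) (ψ χ u τ : ℝ → ℝ)
    (ρ₀ : Hilb d →L[ℂ] Hilb d) (ρ : ℝ → Hilb d →L[ℂ] Hilb d) : Prop where
  init : ρ 0 = ρ₀
  state : ∀ t ∈ Icc 0 S, IsState (ρ t)
  eqn : ∀ t ∈ Icc 0 S, ∃ D, IsLaplacianComm (ρ t) D ∧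
    HasTraceDerivAt S ρ
      (((u t : ℝ) : ℂ) • genGD f (ψ (τ t)) (χ (τ t)) (ρ t) D +
        ((u t ^ 2 * η : ℝ) : ℂ) • genNoise f (χ (τ t)) (ρ t)) t

/-- The expectation `⟨ĝ⟩ = tr(ĝ ρ)`. -/
def expect {d : ℕ} (g : E d → ℝ) (ρ : Hilb d →L[ℂ] Hilb d) : ℝ :=
  (trace ((mulOp g).comp ρ)).re

end SQHD

end

open MeasureTheory Filter Topology Set
open scoped ENNReal

noncomputable section

namespace SQHD

/-! ### Trace norm, the trace class ideal, Hilbert–Schmidt operators. -/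

section TraceTheory

variable {H : Type*} [NormedAddCommGroup H] [InnerProductSpace ℂ H]

/-! Write `y = x - x*`, `p = -i∇`, `b = e^{β(τ(t))}` and `θ = e^{β(0)-γ(0)}`. In the time `t` the
schedule gives `db/dt = 1`, so `b = e^{β(0)} + t`, and the Lindblad equation has kinetic coefficient
`θ/b²`, potential coefficient `b/θ` and noise strength `ηb²/θ²` (`IsSchedule.coefficients`). The
Lyapunov function is `½⟨|y + (θ/b)p|²⟩ + b⟨f - f(x*)⟩`, that is, `½⟨|y|²⟩ + θ/(2b) ⟨y·p + p·y⟩ +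
θ²/(2b²) ⟨-Δ⟩ + b⟨f - f(x*)⟩`.

In its derivative the first order terms cancel in pairs. There remain `⟨f - f(x*)⟩ - ⟨y·∇f⟩`, which
is nonpositive by convexity; a boundary term of the virial identity, which has a favourable sign
because the cube is star-shaped about `x*` (`isVirial_coord`); and the noise. Double commutators
with functions annihilate functions of `x` and the first order operator `y·p + p·y`, so the noise
only heats the kinetic term, at a rate of at most `(η/2) d L_max²`. Hence the Lyapunov function
grows at most linearly, and division by `b` gives the theorem with `C₂ = 1/2`.

The momentum is unbounded, so everything is regularized with the resolvent `R = (1 - εΔ)⁻¹`: an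
observable `Z` becomes `RZR`, and `-Δ` becomes `(1 - R)/ε`. The derivative is estimated as a
quadratic form on single vectors (`IsMultiplierFamily.lyapunov_deriv_le`) and carried over to mixed
states by positivity (`IsState.re_trace_mul_le`). Commutators `[R, F]` have size `√ε`, so nearly all
errors are `√ε` times one plus the kinetic energy; the Lyapunov function controls that energy, and a
Grönwall argument closes (`IsDescentSetup.exists_lyapunov_bound`). One error of the noise is not
small, but it has the right sign by Jensen's inequality (`IsMultiplierFamily.resCommSq_le`). Since
`Δρ₀` is trace class, the initial value is bounded uniformly in `ε`, and `ε → 0` concludes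
(`IsDescentSetup.omega_gap_bound`). -/

theorem sum_enorm_inner_le_traceNorm (A : H →L[ℂ] H) {ι : Type*} (s : Finset ι) {e g : ι → H}
    (he : Orthonormal ℂ e) (hg : Orthonormal ℂ g) :
    ∑ i ∈ s, ‖inner ℂ (e i) (A (g i))‖ₑ ≤ traceNorm A := by
  have key := le_iSup_of_le (f := fun n : ℕ => ⨆ (e : Fin n → H) (g : Fin n → H)
    (_ : Orthonormal ℂ e) (_ : Orthonormal ℂ g), ∑ i, ‖inner ℂ (e i) (A (g i))‖ₑ) s.card
    (le_iSup_of_le (fun i => e (s.equivFin.symm i)) (le_iSup_of_le (fun i => g (s.equivFin.symm i))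
      (le_iSup_of_le (he.comp _ (Subtype.val_injective.comp s.equivFin.symm.injective))
        (le_iSup_of_le (hg.comp _ (Subtype.val_injective.comp s.equivFin.symm.injective)) le_rfl))))
  refine le_trans (le_of_eq ?_) key
  rw [← Finset.sum_coe_sort, ← Equiv.sum_comp s.equivFin.symm]

theorem traceNorm_le_of {A : H →L[ℂ] H} {C : ℝ≥0∞}
    (h : ∀ (n : ℕ) (e g : Fin n → H), Orthonormal ℂ e → Orthonormal ℂ g →
      ∑ i, ‖inner ℂ (e i) (A (g i))‖ₑ ≤ C) : traceNorm A ≤ C :=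
  iSup_le fun n => iSup_le fun e => iSup_le fun g => iSup_le fun he => iSup_le fun hg => h n e g he hg

theorem traceNorm_add_le (A B : H →L[ℂ] H) : traceNorm (A + B) ≤ traceNorm A + traceNorm B := by
  refine traceNorm_le_of fun n e g he hg => ?_
  refine le_trans ?_ (add_le_add (sum_enorm_inner_le_traceNorm A Finset.univ he hg)
    (sum_enorm_inner_le_traceNorm B Finset.univ he hg))
  rw [← Finset.sum_add_distrib]
  refine Finset.sum_le_sum fun i _ => ?_
  rw [add_apply, inner_add_right]
  exact enorm_add_le _ _

theorem traceNorm_smul_le (c : ℂ) (A : H →L[ℂ] H) : traceNorm (c • A) ≤ ‖c‖ₑ * traceNorm A := by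
  refine traceNorm_le_of fun n e g he hg => ?_
  refine le_trans ?_ (mul_le_mul_right (sum_enorm_inner_le_traceNorm A Finset.univ he hg) _)
  rw [Finset.mul_sum]
  refine Finset.sum_le_sum fun i _ => ?_
  rw [smul_apply, inner_smul_right, enorm_mul]

theorem traceNorm_zero : traceNorm (0 : H →L[ℂ] H) = 0 := by
  refine le_antisymm (traceNorm_le_of fun n e g he hg => ?_) zero_le
  simp

theorem IsTraceClass.add {A B : H →L[ℂ] H} (hA : IsTraceClass A) (hB : IsTraceClass B) :
    IsTraceClass (A + B) :=
  (traceNorm_add_le A B).trans_lt (ENNReal.add_lt_top.2 ⟨hA, hB⟩)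

theorem IsTraceClass.smul {A : H →L[ℂ] H} (hA : IsTraceClass A) (c : ℂ) : IsTraceClass (c • A) :=
  (traceNorm_smul_le c A).trans_lt (ENNReal.mul_lt_top enorm_lt_top hA)

theorem IsTraceClass.neg {A : H →L[ℂ] H} (hA : IsTraceClass A) : IsTraceClass (-A) := by
  simpa using hA.smul (-1)

theorem IsTraceClass.sub {A B : H →L[ℂ] H} (hA : IsTraceClass A) (hB : IsTraceClass B) :
    IsTraceClass (A - B) := by
  rw [sub_eq_add_neg]; exact hA.add hB.neg

theorem isTraceClass_zero : IsTraceClass (0 : H →L[ℂ] H) := by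
  rw [IsTraceClass, traceNorm_zero]; exact ENNReal.zero_lt_top

theorem IsTraceClass.sum {ι : Type*} (s : Finset ι) {A : ι → H →L[ℂ] H}
    (hA : ∀ i, IsTraceClass (A i)) : IsTraceClass (∑ i ∈ s, A i) := by
  classical
  induction s using Finset.induction_on with
  | empty => simpa using isTraceClass_zero
  | insert a s ha ih => rw [Finset.sum_insert ha]; exact (hA a).add ih

variable [CompleteSpace H]

theorem traceNorm_star_le (A : H →L[ℂ] H) : traceNorm (star A) ≤ traceNorm A := by
  refine traceNorm_le_of fun n e g he hg => ?_
  refine le_trans (le_of_eq ?_) (sum_enorm_inner_le_traceNorm A Finset.univ hg he)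
  refine Finset.sum_congr rfl fun i _ => ?_
  rw [ContinuousLinearMap.star_eq_adjoint, ContinuousLinearMap.adjoint_inner_right,
    ← inner_conj_symm, RCLike.enorm_conj]

theorem IsTraceClass.star {A : H →L[ℂ] H} (hA : IsTraceClass A) : IsTraceClass (star A) :=
  (traceNorm_star_le A).trans_lt hA

theorem orthonormal_unitary {ι : Type*} {e : ι → H} (he : Orthonormal ℂ e)
    (u : unitary (H →L[ℂ] H)) : Orthonormal ℂ (fun i => (u : H →L[ℂ] H) (e i)) := by
  classical
  rw [orthonormal_iff_ite] at he ⊢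
  intro i j
  rw [← he i j, ← ContinuousLinearMap.adjoint_inner_right, ← ContinuousLinearMap.star_eq_adjoint,
    ← mul_apply_eq_comp, Unitary.coe_star_mul_self, one_apply_eq_self]

theorem traceNorm_unitary_mul_le (u : unitary (H →L[ℂ] H)) (A : H →L[ℂ] H) :
    traceNorm ((u : H →L[ℂ] H) * A) ≤ traceNorm A := by
  refine traceNorm_le_of fun n e g he hg => ?_
  refine le_trans (le_of_eq ?_) (sum_enorm_inner_le_traceNorm A Finset.univ
    (orthonormal_unitary he (star u)) hg)
  refine Finset.sum_congr rfl fun i _ => ?_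
  rw [Unitary.coe_star, ContinuousLinearMap.star_eq_adjoint, ContinuousLinearMap.adjoint_inner_left,
    mul_apply_eq_comp]

/-- A bounded operator is a sum of four multiples of unitaries with coefficients at most `‖X‖/2`,
and unitaries preserve orthonormal systems. The factor `2 = 4 · ½` is not sharp, which does no harm
below. -/
theorem traceNorm_mul_le (X A : H →L[ℂ] H) : traceNorm (X * A) ≤ 2 * ‖X‖ₑ * traceNorm A := by
  obtain ⟨u, c, hX, hc⟩ := CStarAlgebra.exists_sum_four_unitary X
  have hc' : ∀ i, ‖c i‖ₑ ≤ ‖X‖ₑ / 2 := by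
    intro i
    have := ENNReal.ofReal_le_ofReal (hc i)
    rwa [ofReal_norm, ENNReal.ofReal_div_of_pos two_pos, ofReal_norm,
      ENNReal.ofReal_ofNat] at this
  have h1 : ∀ i, traceNorm ((c i • (u i : H →L[ℂ] H)) * A) ≤ ‖X‖ₑ / 2 * traceNorm A := by
    intro i
    rw [smul_mul_assoc]
    exact (traceNorm_smul_le _ _).trans (mul_le_mul' (hc' i) (traceNorm_unitary_mul_le _ _))
  conv_lhs => rw [hX]
  rw [Fin.sum_univ_four, add_mul, add_mul, add_mul]
  refine (traceNorm_add_le _ _).trans ((add_le_add ((traceNorm_add_le _ _).trans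
    (add_le_add ((traceNorm_add_le _ _).trans (add_le_add (h1 0) (h1 1))) (h1 2))) (h1 3)).trans ?_)
  have : ‖X‖ₑ / 2 * traceNorm A + ‖X‖ₑ / 2 * traceNorm A = ‖X‖ₑ * traceNorm A := by
    rw [← add_mul, ENNReal.add_halves]
  rw [this, add_assoc, this, ← two_mul, mul_assoc]

theorem IsTraceClass.mul_left {A : H →L[ℂ] H} (hA : IsTraceClass A) (X : H →L[ℂ] H) :
    IsTraceClass (X * A) :=
  (traceNorm_mul_le X A).trans_lt
    (ENNReal.mul_lt_top (ENNReal.mul_lt_top (by simp) enorm_lt_top) hA)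

theorem IsTraceClass.mul_right {A : H →L[ℂ] H} (hA : IsTraceClass A) (X : H →L[ℂ] H) :
    IsTraceClass (A * X) := by
  have := (hA.star.mul_left (Star.star X)).star
  rwa [star_mul, star_star, star_star] at this

variable (H) in
/-- The index set of the Hilbert basis by which `SQHD.trace` is defined. -/
def basisIndex : Set H := (exists_hilbertBasis ℂ H).choose

variable (H) in
/-- The Hilbert basis by which `SQHD.trace` is defined. -/
def traceBasis : HilbertBasis (basisIndex H) ℂ H := (exists_hilbertBasis ℂ H).choose_spec.choose

theorem trace_eq (A : H →L[ℂ] H) :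
    trace A = ∑' i, inner ℂ (traceBasis H i) (A (traceBasis H i)) := rfl

theorem IsTraceClass.summable {A : H →L[ℂ] H} (hA : IsTraceClass A) :
    Summable fun i => ‖inner ℂ (traceBasis H i) (A (traceBasis H i))‖ := by
  refine summable_of_sum_le (c := (traceNorm A).toReal) (fun _ => norm_nonneg _) fun s => ?_
  have := sum_enorm_inner_le_traceNorm A s (traceBasis H).orthonormal (traceBasis H).orthonormal
  have h2 := ENNReal.toReal_mono hA.ne this
  rw [ENNReal.toReal_sum (by simp)] at h2
  simpa using h2

theorem norm_trace_le {A : H →L[ℂ] H} (hA : IsTraceClass A) :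
    ‖trace A‖ ≤ (traceNorm A).toReal := by
  rw [trace_eq]
  refine (norm_tsum_le_tsum_norm hA.summable).trans
    (Summable.tsum_le_of_sum_le hA.summable fun s => ?_)
  have := sum_enorm_inner_le_traceNorm A s (traceBasis H).orthonormal (traceBasis H).orthonormal
  have h2 := ENNReal.toReal_mono hA.ne this
  rw [ENNReal.toReal_sum (by simp)] at h2
  simpa using h2

theorem trace_add {A B : H →L[ℂ] H} (hA : IsTraceClass A) (hB : IsTraceClass B) :
    trace (A + B) = trace A + trace B := by
  simp only [trace_eq, add_apply, inner_add_right]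
  exact hA.summable.of_norm.tsum_add hB.summable.of_norm

theorem trace_smul (c : ℂ) (A : H →L[ℂ] H) : trace (c • A) = c * trace A := by
  simp only [trace_eq, smul_apply, inner_smul_right]
  exact tsum_mul_left

theorem trace_neg (A : H →L[ℂ] H) : trace (-A) = -trace A := by
  simpa using trace_smul (-1) A

theorem trace_sub {A B : H →L[ℂ] H} (hA : IsTraceClass A) (hB : IsTraceClass B) :
    trace (A - B) = trace A - trace B := by
  rw [sub_eq_add_neg, trace_add hA hB.neg, trace_neg, sub_eq_add_neg]

theorem trace_sum {ι : Type*} (s : Finset ι) {A : ι → H →L[ℂ] H}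
    (hA : ∀ i, IsTraceClass (A i)) : trace (∑ i ∈ s, A i) = ∑ i ∈ s, trace (A i) := by
  classical
  induction s using Finset.induction_on with
  | empty => simp [trace_eq]
  | insert a s ha ih =>
    rw [Finset.sum_insert ha, Finset.sum_insert ha, trace_add (hA a) (IsTraceClass.sum s hA), ih]

/-! ### Hilbert–Schmidt operators and cyclicity -/

/-- `A` is Hilbert–Schmidt. -/
def IsHS (A : H →L[ℂ] H) : Prop := Summable fun i => ‖A (traceBasis H i)‖ ^ 2

omit [CompleteSpace H] in
theorem hasSum_norm_inner_sq {ι : Type*} (b : HilbertBasis ι ℂ H) (x : H) :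
    HasSum (fun i => ‖inner ℂ (b i) x‖ ^ 2) (‖x‖ ^ 2) := by
  have h := b.hasSum_inner_mul_inner x x
  have h2 : HasSum (fun i => (((‖inner ℂ (b i) x‖ ^ 2 : ℝ)) : ℂ)) ((‖x‖ ^ 2 : ℝ) : ℂ) := by
    have e : inner ℂ x x = ((‖x‖ ^ 2 : ℝ) : ℂ) := by rw [inner_self_eq_norm_sq_to_K]; norm_cast
    rw [← e]
    refine h.congr_fun fun i => ?_
    rw [← inner_conj_symm x (b i), ← Complex.normSq_eq_conj_mul_self, Complex.normSq_eq_norm_sq]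
  exact_mod_cast h2

theorem IsHS.mul_left {A : H →L[ℂ] H} (hA : IsHS A) (X : H →L[ℂ] H) : IsHS (X * A) := by
  refine Summable.of_nonneg_of_le (fun _ => by positivity) (fun i => ?_) (Summable.mul_left (‖X‖ ^ 2) hA)
  rw [← mul_pow]
  exact pow_le_pow_left₀ (norm_nonneg _) (X.le_opNorm _) 2

theorem IsHS.summable_prod {A : H →L[ℂ] H} (hA : IsHS A) :
    Summable fun p : basisIndex H × basisIndex H =>
      ‖inner ℂ (traceBasis H p.2) (A (traceBasis H p.1))‖ ^ 2 := by
  rw [summable_prod_of_nonneg (fun _ => sq_nonneg _)]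
  refine ⟨fun i => (hasSum_norm_inner_sq (traceBasis H) (A (traceBasis H i))).summable, ?_⟩
  exact Summable.congr hA fun i =>
    ((hasSum_norm_inner_sq (traceBasis H) (A (traceBasis H i))).tsum_eq).symm

theorem IsHS.star {A : H →L[ℂ] H} (hA : IsHS A) : IsHS (star A) := by
  have e : ∀ x y, ‖inner ℂ (traceBasis H x) (A (traceBasis H y))‖ =
      ‖inner ℂ (traceBasis H y) ((Star.star A) (traceBasis H x))‖ := by
    intro x y
    rw [ContinuousLinearMap.star_eq_adjoint, ContinuousLinearMap.adjoint_inner_right,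
      norm_inner_symm]
  have h : Summable fun p : basisIndex H × basisIndex H =>
      ‖inner ℂ (traceBasis H p.2) ((Star.star A) (traceBasis H p.1))‖ ^ 2 :=
    hA.summable_prod.prod_symm.congr fun p => by rw [← e]; rfl
  rw [summable_prod_of_nonneg (fun _ => sq_nonneg _)] at h
  exact h.2.congr fun i =>
    ((hasSum_norm_inner_sq (traceBasis H) (Star.star A (traceBasis H i))).tsum_eq)

theorem IsHS.mul_right {A : H →L[ℂ] H} (hA : IsHS A) (X : H →L[ℂ] H) : IsHS (A * X) := by
  have := (hA.star.mul_left (Star.star X)).star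
  rwa [star_mul, star_star, star_star] at this

theorem tsum_inner_mul_inner_apply {ι : Type*} (b : HilbertBasis ι ℂ H) (U V : H →L[ℂ] H)
    (x : H) : ∑' j, inner ℂ x (U (b j)) * inner ℂ (b j) (V x) = inner ℂ x ((U * V) x) := by
  rw [mul_apply_eq_comp, ← ContinuousLinearMap.adjoint_inner_left, ← b.tsum_inner_mul_inner]
  exact tsum_congr fun j => by rw [ContinuousLinearMap.adjoint_inner_left]

theorem IsHS.summable_inner_mul_inner {A B : H →L[ℂ] H} (hA : IsHS A) (hB : IsHS B) :
    Summable fun p : basisIndex H × basisIndex H =>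
      inner ℂ (traceBasis H p.1) (A (traceBasis H p.2)) *
        inner ℂ (traceBasis H p.2) (B (traceBasis H p.1)) := by
  refine Summable.of_norm_bounded (hA.summable_prod.prod_symm.add hB.summable_prod) fun p => ?_
  rw [norm_mul]
  change _ ≤ ‖inner ℂ (traceBasis H p.1) (A (traceBasis H p.2))‖ ^ 2 +
    ‖inner ℂ (traceBasis H p.2) (B (traceBasis H p.1))‖ ^ 2
  generalize ‖inner ℂ (traceBasis H p.1) (A (traceBasis H p.2))‖ = x
  generalize ‖inner ℂ (traceBasis H p.2) (B (traceBasis H p.1))‖ = y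
  nlinarith [sq_nonneg (x - y), sq_nonneg x, sq_nonneg y]

/-- Both traces are the same double series of products of matrix entries; the Hilbert–Schmidt
property makes it absolutely summable, so the order of summation may be exchanged. -/
theorem IsHS.trace_mul_comm {A B : H →L[ℂ] H} (hA : IsHS A) (hB : IsHS B) :
    trace (A * B) = trace (B * A) := by
  have h1 : ∀ U V : H →L[ℂ] H, trace (U * V) = ∑' i, ∑' j,
      inner ℂ (traceBasis H i) (U (traceBasis H j)) *
        inner ℂ (traceBasis H j) (V (traceBasis H i)) := fun U V =>
    (trace_eq _).trans (tsum_congr fun i => (tsum_inner_mul_inner_apply _ _ _ _).symm)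
  rw [h1, h1]
  refine (hA.summable_inner_mul_inner hB).tsum_comm.symm.trans ?_
  exact tsum_congr fun i => tsum_congr fun j => mul_comm _ _

theorem isHS_sqrt {P : H →L[ℂ] H} (hP : 0 ≤ P)
    (hs : Summable fun i => (inner ℂ (traceBasis H i) (P (traceBasis H i))).re) :
    IsHS (CFC.sqrt P) := by
  refine hs.congr fun i => ?_
  conv_lhs => rw [← CFC.sqrt_mul_sqrt_self P hP]
  have h1 : star (CFC.sqrt P) = CFC.sqrt P := (CFC.sqrt_nonneg P).isSelfAdjoint
  rw [mul_apply_eq_comp]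
  nth_rewrite 1 [← h1]
  rw [ContinuousLinearMap.star_eq_adjoint, ContinuousLinearMap.adjoint_inner_right,
    ← inner_self_eq_norm_sq (𝕜 := ℂ)]
  rfl

/-- Split `P` into two Hilbert–Schmidt factors `√P` and move one of them around. The symmetric form
`√P X √P` is what turns positivity of the form of `X` into positivity of the trace. -/
theorem trace_mul_comm_of_nonneg {P : H →L[ℂ] H} (hP : 0 ≤ P)
    (hs : Summable fun i => (inner ℂ (traceBasis H i) (P (traceBasis H i))).re)
    (X : H →L[ℂ] H) :
    trace (X * P) = trace (P * X) ∧
      trace (X * P) = trace (CFC.sqrt P * X * CFC.sqrt P) := by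
  have hT := isHS_sqrt hP hs
  have e := CFC.sqrt_mul_sqrt_self P hP
  have h1 : trace (X * P) = trace (CFC.sqrt P * X * CFC.sqrt P) := by
    conv_lhs => rw [← e, ← mul_assoc]
    rw [(hT.mul_left X).trace_mul_comm hT, mul_assoc]
  refine ⟨?_, h1⟩
  rw [h1]
  conv_rhs => rw [← e, mul_assoc]
  rw [hT.trace_mul_comm (hT.mul_right X)]

end TraceTheory

/-! ### Cyclicity of the trace, positivity on states, differentiation under the trace. -/

section TraceTheory
variable {H : Type*} [NormedAddCommGroup H] [InnerProductSpace ℂ H] [CompleteSpace H]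

theorem IsHS.summable_mul {U V : H →L[ℂ] H} (hU : IsHS U) (hV : IsHS V) :
    Summable fun i => inner ℂ (traceBasis H i) ((U * V) (traceBasis H i)) :=
  (hU.summable_inner_mul_inner hV).prod.congr fun i =>
    tsum_inner_mul_inner_apply (traceBasis H) U V (traceBasis H i)

/-- The projection onto the positive spectral subspace would give `a⁺` exactly, but it is not a
continuous function of `a`. The ramp `min ((n+1) x⁺) 1` replaces it, and it is wrong only for `0 < x
< 1/(n+1)`. -/
theorem exists_mul_near_posPart {a : H →L[ℂ] H} (ha : IsSelfAdjoint a) (n : ℕ) :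
    ∃ X : H →L[ℂ] H, ‖X‖ ≤ 1 ∧ ‖X * a - a⁺‖ ≤ 1 / ((n : ℝ) + 1) := by
  have hn : (0 : ℝ) < (n : ℝ) + 1 := by positivity
  refine ⟨cfc (fun x : ℝ => min (((n : ℝ) + 1) * max x 0) 1) a, ?_, ?_⟩
  · refine norm_cfc_le zero_le_one fun x _ => ?_
    rw [Real.norm_of_nonneg (le_min (by positivity) zero_le_one)]
    exact min_le_right _ _
  · have e1 : cfc (fun x : ℝ => min (((n : ℝ) + 1) * max x 0) 1) a * a =
        cfc (fun x : ℝ => min (((n : ℝ) + 1) * max x 0) 1 * x) a := by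
      rw [cfc_mul _ _ a, cfc_id' ℝ a]
    have e2 : a⁺ = cfc (fun x : ℝ => max x 0) a := by
      rw [CFC.posPart_def, cfcₙ_eq_cfc]
      rfl
    rw [e1, e2, ← cfc_sub _ _ a]
    refine norm_cfc_le (by positivity) fun x _ => ?_
    rw [Real.norm_eq_abs, le_div_iff₀ hn, ← abs_of_pos hn, ← abs_mul, abs_of_pos hn, abs_le]
    rcases le_total x 0 with h | h
    · rw [max_eq_right h]; simp
    · rw [max_eq_left h]
      rcases le_total (((n : ℝ) + 1) * x) 1 with h2 | h2
      · rw [min_eq_left h2]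
        constructor <;> nlinarith [mul_nonneg hn.le h]
      · rw [min_eq_right h2]
        constructor <;> simp

/-- The diagonal sums of `X a` are at most `2 * traceNorm a` for all contractions `X`; letting `X a
→ a⁺` bounds the trace of `a⁺`. This makes the square roots of `a⁺` and `a⁻` Hilbert–Schmidt. -/
theorem IsTraceClass.summable_posPart {a : H →L[ℂ] H} (h : IsTraceClass a)
    (ha : IsSelfAdjoint a) :
    Summable fun i => (inner ℂ (traceBasis H i) (a⁺ (traceBasis H i))).re := by
  have hpos : ∀ x, 0 ≤ (inner ℂ x (a⁺ x)).re := fun x =>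
    ((ContinuousLinearMap.nonneg_iff_isPositive _).1 (CFC.posPart_nonneg a)).re_inner_nonneg_right x
  refine summable_of_sum_le (c := (2 * traceNorm a).toReal) (fun _ => hpos _) fun s => ?_
  choose X hX1 hX2 using exists_mul_near_posPart ha
  have hlim : Tendsto (fun n => X n * a) atTop (𝓝 a⁺) := by
    rw [tendsto_iff_norm_sub_tendsto_zero]
    exact squeeze_zero (fun _ => norm_nonneg _) hX2 tendsto_one_div_add_atTop_nhds_zero_nat
  have hlim2 : Tendsto (fun n => ∑ i ∈ s, (inner ℂ (traceBasis H i)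
      ((X n * a) (traceBasis H i))).re) atTop
      (𝓝 (∑ i ∈ s, (inner ℂ (traceBasis H i) (a⁺ (traceBasis H i))).re)) := by
    refine tendsto_finsetSum _ fun i _ => ?_
    have hc : Continuous fun Z : H →L[ℂ] H =>
        (inner ℂ (traceBasis H i) (Z (traceBasis H i))).re := by fun_prop
    exact (hc.tendsto _).comp hlim
  refine le_of_tendsto' hlim2 fun n => ?_
  have h1 := sum_enorm_inner_le_traceNorm (X n * a) s (traceBasis H).orthonormal
    (traceBasis H).orthonormal
  have h2 : traceNorm (X n * a) ≤ 2 * traceNorm a := by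
    refine (traceNorm_mul_le _ _).trans (mul_le_mul' ?_ le_rfl)
    have : ‖X n‖ₑ ≤ 1 := by
      rw [← ofReal_norm]; exact ENNReal.ofReal_le_one.2 (hX1 n)
    calc 2 * ‖X n‖ₑ ≤ 2 * 1 := mul_le_mul' le_rfl this
      _ = 2 := mul_one _
  have h3 := ENNReal.toReal_mono (ENNReal.mul_lt_top (by simp) h).ne (h1.trans h2)
  rw [ENNReal.toReal_sum (by simp)] at h3
  refine (Finset.sum_le_sum fun i _ => ?_).trans h3
  rw [toReal_enorm]
  exact Complex.re_le_norm _

theorem IsTraceClass.trace_mul_comm_of_isSelfAdjoint {a : H →L[ℂ] H} (h : IsTraceClass a)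
    (ha : IsSelfAdjoint a) (X : H →L[ℂ] H) : trace (X * a) = trace (a * X) := by
  have hs := h.summable_posPart ha
  have hs' : Summable fun i => (inner ℂ (traceBasis H i) (a⁻ (traceBasis H i))).re := by
    have := h.neg.summable_posPart ha.neg
    rwa [CFC.posPart_neg] at this
  have e : a = a⁺ - a⁻ := (CFC.posPart_sub_negPart a ha).symm
  have hP := (CFC.posPart_nonneg a)
  have hN := (CFC.negPart_nonneg a)
  have tP : ∀ P : H →L[ℂ] H, 0 ≤ P →
      Summable (fun i => (inner ℂ (traceBasis H i) (P (traceBasis H i))).re) → ∀ X : H →L[ℂ] H,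
      Summable (fun i => inner ℂ (traceBasis H i) ((X * P) (traceBasis H i))) ∧
      Summable (fun i => inner ℂ (traceBasis H i) ((P * X) (traceBasis H i))) := by
    intro P hP hs X
    have hT := isHS_sqrt hP hs
    have e := CFC.sqrt_mul_sqrt_self P hP
    constructor
    · have := (hT.mul_left X).summable_mul hT
      rwa [mul_assoc, e] at this
    · have := hT.summable_mul (hT.mul_right X)
      rwa [← mul_assoc, e] at this
  have e1 : trace (X * a) = trace (X * a⁺) - trace (X * a⁻) := by
    conv_lhs => rw [e]
    rw [mul_sub, trace_eq, trace_eq, trace_eq, ← (tP _ hP hs X).1.tsum_sub (tP _ hN hs' X).1]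
    simp only [sub_apply, inner_sub_right]
  have e2 : trace (a * X) = trace (a⁺ * X) - trace (a⁻ * X) := by
    conv_lhs => rw [e]
    rw [sub_mul, trace_eq, trace_eq, trace_eq, ← (tP _ hP hs X).2.tsum_sub (tP _ hN hs' X).2]
    simp only [sub_apply, inner_sub_right]
  rw [e1, e2, (trace_mul_comm_of_nonneg hP hs X).1, (trace_mul_comm_of_nonneg hN hs' X).1]

/-- The Cartesian decomposition into two self-adjoint trace class operators reduces to the previous
case. -/
theorem IsTraceClass.trace_mul_comm {A : H →L[ℂ] H} (h : IsTraceClass A) (X : H →L[ℂ] H) :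
    trace (X * A) = trace (A * X) := by
  set B := A + Star.star A with hB
  set C := Complex.I • (A - Star.star A) with hC
  have tB : IsTraceClass B := h.add h.star
  have tC : IsTraceClass C := (h.sub h.star).smul _
  have sB : IsSelfAdjoint B := by
    rw [IsSelfAdjoint, hB, star_add, star_star, add_comm]
  have sC : IsSelfAdjoint C := by
    rw [IsSelfAdjoint, hC, star_smul, star_sub, star_star]
    simp only [RCLike.star_def, Complex.conj_I]
    module
  have e : A = (1 / 2 : ℂ) • B + (-Complex.I / 2) • C := by
    rw [hB, hC, smul_smul]
    have : -Complex.I / 2 * Complex.I = 1 / 2 := by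
      rw [div_mul_eq_mul_div, neg_mul, Complex.I_mul_I]; norm_num
    rw [this]
    module
  have cB := tB.trace_mul_comm_of_isSelfAdjoint sB X
  have cC := tC.trace_mul_comm_of_isSelfAdjoint sC X
  rw [e, mul_add, add_mul, mul_smul_comm, mul_smul_comm, smul_mul_assoc, smul_mul_assoc,
    trace_add ((tB.mul_left X).smul _) ((tC.mul_left X).smul _),
    trace_add ((tB.mul_right X).smul _) ((tC.mul_right X).smul _), trace_smul, trace_smul,
    trace_smul, trace_smul, cB, cC]

theorem IsState.re_trace_mul_nonneg {ρ : H →L[ℂ] H} (hρ : IsState ρ) {X : H →L[ℂ] H}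
    (hX : ∀ φ, 0 ≤ (inner ℂ φ (X φ)).re) : 0 ≤ (trace (X * ρ)).re := by
  have hP : 0 ≤ ρ := (ContinuousLinearMap.nonneg_iff_isPositive _).2 hρ.pos
  have hs : Summable fun i => (inner ℂ (traceBasis H i) (ρ (traceBasis H i))).re := by
    refine Summable.of_norm_bounded hρ.traceClass.summable fun i => ?_
    exact Complex.abs_re_le_norm _
  rw [(trace_mul_comm_of_nonneg hP hs X).2, trace_eq, Complex.re_tsum]
  · refine tsum_nonneg fun i => ?_
    have h1 : star (CFC.sqrt ρ) = CFC.sqrt ρ := (CFC.sqrt_nonneg ρ).isSelfAdjoint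
    have h2 := hX (CFC.sqrt ρ (traceBasis H i))
    nth_rewrite 1 [← h1] at h2
    rwa [ContinuousLinearMap.star_eq_adjoint, ContinuousLinearMap.adjoint_inner_left] at h2
  · exact ((isHS_sqrt hP hs).mul_right X).summable_mul (isHS_sqrt hP hs)

/-- The bridge from vectors to mixed states: operator inequalities are proved for the form of a
single vector and then hold for expectations. -/
theorem IsState.re_trace_mul_le {ρ : H →L[ℂ] H} (hρ : IsState ρ) {X Z : H →L[ℂ] H}
    (hX : ∀ φ, (inner ℂ φ (X φ)).re ≤ (inner ℂ φ (Z φ)).re) :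
    (trace (X * ρ)).re ≤ (trace (Z * ρ)).re := by
  have := hρ.re_trace_mul_nonneg (X := Z - X) fun φ => by
    rw [sub_apply, inner_sub_right, Complex.sub_re]; linarith [hX φ]
  rw [sub_mul, trace_sub (hρ.traceClass.mul_left _) (hρ.traceClass.mul_left _), Complex.sub_re]
    at this
  linarith

-- Some difference quotient lies at finite trace norm distance from `D`. The condition `0 < S` makes
-- `t` an accumulation point of the interval, so that such a quotient exists.
omit [CompleteSpace H] in
theorem HasTraceDerivAt.isTraceClass {S t : ℝ} {ρ : ℝ → H →L[ℂ] H} {D : H →L[ℂ] H}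
    (hd : HasTraceDerivAt S ρ D t) (hρ : ∀ s ∈ Icc 0 S, IsTraceClass (ρ s)) (hS : 0 < S)
    (ht : t ∈ Icc 0 S) : IsTraceClass D := by
  have hne : (𝓝[Icc 0 S \ {t}] t).NeBot := by
    have : (𝓝[Icc 0 S] t ⊓ 𝓟 {t}ᶜ).NeBot := by
      have := (uniqueDiffOn_Icc hS t ht).accPt
      rw [accPt_principal_iff_nhdsWithin] at this
      rwa [nhdsWithin, inf_assoc, inf_principal, ← sdiff_eq, ← nhdsWithin]
    rwa [nhdsWithin, inf_assoc, inf_principal, ← sdiff_eq, ← nhdsWithin] at this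
  have h1 : ∀ᶠ s : ℝ in 𝓝[Icc 0 S \ {t}] t,
      traceNorm (((s - t)⁻¹ : ℂ) • (ρ s - ρ t) - D) < ⊤ :=
    hd.eventually_lt_const ENNReal.zero_lt_top
  obtain ⟨s, hs, hs2⟩ := (h1.and self_mem_nhdsWithin).exists
  have h2 : IsTraceClass (((s - t)⁻¹ : ℂ) • (ρ s - ρ t)) :=
    ((hρ s hs2.1).sub (hρ t ht)).smul _
  have := h2.sub (B := _) hs
  rwa [sub_sub_cancel] at this

/-- A bounded observable may be differentiated under the trace. -/
theorem HasTraceDerivAt.hasDerivWithinAt_trace {S t : ℝ} {ρ : ℝ → H →L[ℂ] H} {D : H →L[ℂ] H}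
    (hd : HasTraceDerivAt S ρ D t) (hρ : ∀ s ∈ Icc 0 S, IsTraceClass (ρ s)) (hS : 0 < S)
    (ht : t ∈ Icc 0 S) (X : H →L[ℂ] H) :
    HasDerivWithinAt (fun s => (trace (X * ρ s)).re) (trace (X * D)).re (Icc 0 S) t := by
  have hD := hd.isTraceClass hρ hS ht
  rw [hasDerivWithinAt_iff_tendsto_slope, tendsto_iff_norm_sub_tendsto_zero]
  have hlim : Tendsto (fun s : ℝ => (2 * ‖X‖ₑ *
      traceNorm (((s - t)⁻¹ : ℂ) • (ρ s - ρ t) - D)).toReal) (𝓝[Icc 0 S \ {t}] t) (𝓝 0) := by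
    have h := ENNReal.Tendsto.const_mul (a := 2 * ‖X‖ₑ) hd
      (Or.inr (ENNReal.mul_lt_top (by simp) enorm_lt_top).ne)
    rw [mul_zero] at h
    exact (ENNReal.tendsto_toReal ENNReal.zero_ne_top).comp h
  refine squeeze_zero' (Eventually.of_forall fun _ => norm_nonneg _) ?_ hlim
  filter_upwards [self_mem_nhdsWithin] with s hs
  have t1 : IsTraceClass (((s - t)⁻¹ : ℂ) • (ρ s - ρ t) - D) :=
    (((hρ s hs.1).sub (hρ t ht)).smul _).sub hD
  have e : slope (fun s => (trace (X * ρ s)).re) t s - (trace (X * D)).re =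
      (trace (X * (((s - t)⁻¹ : ℂ) • (ρ s - ρ t) - D))).re := by
    rw [mul_sub, mul_smul_comm, mul_sub,
      trace_sub ((((hρ s hs.1).mul_left X).sub ((hρ t ht).mul_left X)).smul _) (hD.mul_left X),
      trace_smul, trace_sub ((hρ s hs.1).mul_left X) ((hρ t ht).mul_left X), slope_def_field,
      Complex.sub_re, ← Complex.ofReal_sub, ← Complex.ofReal_inv, Complex.re_ofReal_mul,
      Complex.sub_re, div_eq_inv_mul]
  rw [e, Real.norm_eq_abs]
  refine (Complex.abs_re_le_norm _).trans ((norm_trace_le (t1.mul_left X)).trans ?_)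
  exact ENNReal.toReal_mono (ENNReal.mul_lt_top (ENNReal.mul_lt_top (by simp) enorm_lt_top) t1).ne
    (traceNorm_mul_le _ _)

end TraceTheory

/-! ### Multipliers, resolvents and commutators in an abstract Sobolev setting -/

section DirichletForm

open scoped InnerProductSpace

variable {H : Type*} [NormedAddCommGroup H] [InnerProductSpace ℂ H] {d : ℕ}

/-- A commutative algebra of symmetric bounded operators. -/
structure IsSymmAlgebra (S : Set (H →L[ℂ] H)) : Prop where
  symm : ∀ A ∈ S, ∀ x y, ⟪A x, y⟫_ℂ = ⟪x, A y⟫_ℂ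
  comm : ∀ A ∈ S, ∀ B ∈ S, ∀ x, A (B x) = B (A x)
  add : ∀ A ∈ S, ∀ B ∈ S, A + B ∈ S
  mul : ∀ A ∈ S, ∀ B ∈ S, A * B ∈ S
  zero : 0 ∈ S

/-- The pairs `(v, W)` in the graph of a gradient form a linear space. -/
structure IsLinearGraph (P : H → (Fin d → H) → Prop) : Prop where
  add : ∀ v W v' W', P v W → P v' W' → P (v + v') (fun k => W k + W' k)
  smul : ∀ (c : ℂ) v W, P v W → P (c • v) (fun k => c • W k)

/-- `F ∈ S` acts on the graph of the gradient as multiplication by a function with partial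
derivatives `F'`. -/
structure IsMultiplier (S : Set (H →L[ℂ] H)) (P : H → (Fin d → H) → Prop) (F : H →L[ℂ] H)
    (F' : Fin d → H →L[ℂ] H) : Prop where
  mem : F ∈ S
  mem' : ∀ k, F' k ∈ S
  map : ∀ v W, P v W → P (F v) (fun k => F (W k) + F' k v)

/-- `R` is the resolvent `(1 + ε K)⁻¹` of the operator `K` of the Dirichlet form `∑ ‖Wₖ‖²`, and `N`
is the gradient of `R`. -/
structure IsResolvent (P : H → (Fin d → H) → Prop) (ε : ℝ) (R : H →L[ℂ] H)
    (N : Fin d → H →L[ℂ] H) : Prop where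
  pos : 0 < ε
  mem : ∀ φ, P (R φ) (fun k => N k φ)
  weak : ∀ φ v W, P v W → ⟪v, φ⟫_ℂ = ⟪v, R φ⟫_ℂ + (ε : ℂ) * ∑ k, ⟪W k, N k φ⟫_ℂ

/-- The Yosida approximation `(1 - R) / ε` of `K`. -/
def yosida (ε : ℝ) (R : H →L[ℂ] H) : H →L[ℂ] H := ((ε⁻¹ : ℝ) : ℂ) • (1 - R)

/-- The Dirichlet form `∑ₖ ‖∂ₖ R φ‖²`. -/
def gradSq (N : Fin d → H →L[ℂ] H) (φ : H) : ℝ := ∑ k, ‖N k φ‖ ^ 2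

/-- The regularized kinetic energy `⟪φ, (1 - R) / ε φ⟫`. -/
def kin (ε : ℝ) (R : H →L[ℂ] H) (φ : H) : ℝ := (⟪φ, yosida ε R φ⟫_ℂ).re

/-- The generator of dilations `2 y · ∇ + d`. -/
def rad (Y : Fin d → H →L[ℂ] H) (g : H) (G : Fin d → H) : H :=
  (2 : ℂ) • ∑ k, Y k (G k) + (d : ℂ) • g

/-- The quadratic form of `[[O, F], F] / 2`. -/
def dcomm (O F : H →L[ℂ] H) (φ : H) : ℝ := (⟪O φ, F (F φ)⟫_ℂ).re - (⟪F φ, O (F φ)⟫_ℂ).re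

theorem IsSymmAlgebra.im_inner {S : Set (H →L[ℂ] H)} (hS : IsSymmAlgebra S) {A B : H →L[ℂ] H}
    (hA : A ∈ S) (hB : B ∈ S) (x : H) : (⟪A x, B x⟫_ℂ).im = 0 := by
  have h : ⟪A x, B x⟫_ℂ = ⟪B x, A x⟫_ℂ := by
    rw [hS.symm A hA, hS.comm A hA B hB, ← hS.symm B hB]
  have h2 : (⟪A x, B x⟫_ℂ).im = -(⟪B x, A x⟫_ℂ).im := by
    rw [← inner_conj_symm, Complex.conj_im]
  rw [← h] at h2
  linarith

theorem IsSymmAlgebra.sum {S : Set (H →L[ℂ] H)} (hS : IsSymmAlgebra S) {ι : Type*}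
    (s : Finset ι) {A : ι → H →L[ℂ] H} (hA : ∀ i, A i ∈ S) : ∑ i ∈ s, A i ∈ S := by
  classical
  induction s using Finset.induction_on with
  | empty => simpa using hS.zero
  | insert a s ha ih => rw [Finset.sum_insert ha]; exact hS.add _ (hA a) _ ih

theorem im_inner_comm (x y : H) : (⟪x, y⟫_ℂ).im = -(⟪y, x⟫_ℂ).im := by
  rw [← inner_conj_symm, Complex.conj_im]

theorem re_inner_comm (x y : H) : (⟪x, y⟫_ℂ).re = (⟪y, x⟫_ℂ).re := by
  rw [← inner_conj_symm, Complex.conj_re]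

theorem abs_im_inner_le (x y : H) : |(⟪x, y⟫_ℂ).im| ≤ ‖x‖ * ‖y‖ :=
  (Complex.abs_im_le_norm _).trans (norm_inner_le_norm x y)

theorem abs_re_inner_le (x y : H) : |(⟪x, y⟫_ℂ).re| ≤ ‖x‖ * ‖y‖ :=
  (Complex.abs_re_le_norm _).trans (norm_inner_le_norm x y)

theorem inner_self_eq_ofReal (x : H) : ⟪x, x⟫_ℂ = ((‖x‖ ^ 2 : ℝ) : ℂ) := by
  rw [inner_self_eq_norm_sq_to_K]; norm_cast

section Resolvent

variable {P : H → (Fin d → H) → Prop} {ε : ℝ} {R : H →L[ℂ] H} {N : Fin d → H →L[ℂ] H}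

theorem yosida_apply (φ : H) : yosida ε R φ = ((ε⁻¹ : ℝ) : ℂ) • (φ - R φ) := rfl

theorem IsResolvent.eq_add (hR : IsResolvent P ε R N) (φ : H) :
    φ = R φ + (ε : ℂ) • yosida ε R φ := by
  rw [yosida_apply, smul_smul, ← Complex.ofReal_mul, mul_inv_cancel₀ hR.pos.ne', Complex.ofReal_one,
    one_smul]
  abel

theorem IsResolvent.inner_yosida (hR : IsResolvent P ε R N) (φ v : H) (W : Fin d → H)
    (h : P v W) : ⟪v, yosida ε R φ⟫_ℂ = ∑ k, ⟪W k, N k φ⟫_ℂ := by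
  rw [yosida_apply, inner_smul_right, inner_sub_right, hR.weak φ v W h, add_sub_cancel_left,
    ← mul_assoc, ← Complex.ofReal_mul, inv_mul_cancel₀ hR.pos.ne', Complex.ofReal_one, one_mul]

theorem sum_inner_self (N : Fin d → H →L[ℂ] H) (φ : H) :
    ∑ k, ⟪N k φ, N k φ⟫_ℂ = ((gradSq N φ : ℝ) : ℂ) := by
  simp only [inner_self_eq_ofReal, gradSq, Complex.ofReal_sum]

theorem IsResolvent.inner_self_yosida (hR : IsResolvent P ε R N) (φ : H) :
    ⟪R φ, yosida ε R φ⟫_ℂ = ((gradSq N φ : ℝ) : ℂ) := by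
  rw [hR.inner_yosida φ _ _ (hR.mem φ), sum_inner_self]

theorem IsResolvent.symm (hR : IsResolvent P ε R N) (φ ψ : H) : ⟪R φ, ψ⟫_ℂ = ⟪φ, R ψ⟫_ℂ := by
  have h1 := hR.weak ψ _ _ (hR.mem φ)
  have h2 := hR.weak φ _ _ (hR.mem ψ)
  rw [h1, ← inner_conj_symm φ, h2, map_add, map_mul, map_sum, inner_conj_symm, Complex.conj_ofReal]
  simp only [inner_conj_symm]

theorem IsResolvent.inner_eq_kin (hR : IsResolvent P ε R N) (φ : H) :
    ⟪φ, yosida ε R φ⟫_ℂ = ((gradSq N φ + ε * ‖yosida ε R φ‖ ^ 2 : ℝ) : ℂ) := by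
  nth_rewrite 1 [hR.eq_add φ]
  rw [inner_add_left, inner_smul_left, hR.inner_self_yosida, inner_self_eq_ofReal,
    Complex.conj_ofReal]
  push_cast
  rfl

/-- With `φ = Rφ + ε κ`, `κ = yosida ε R φ`, the pairing `⟪Rφ, κ⟫` is the squared norm of `∇Rφ`. So
the regularized kinetic energy dominates the true one of `Rφ`, with excess `ε‖κ‖²`. -/
theorem IsResolvent.kin_eq (hR : IsResolvent P ε R N) (φ : H) :
    kin ε R φ = gradSq N φ + ε * ‖yosida ε R φ‖ ^ 2 := by
  rw [kin, hR.inner_eq_kin, Complex.ofReal_re]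

theorem IsResolvent.norm_sq_eq (hR : IsResolvent P ε R N) (φ : H) :
    ‖φ‖ ^ 2 = ‖R φ‖ ^ 2 + 2 * ε * gradSq N φ + ε ^ 2 * ‖yosida ε R φ‖ ^ 2 := by
  nth_rewrite 1 [hR.eq_add φ]
  rw [norm_add_sq (𝕜 := ℂ), inner_smul_right, hR.inner_self_yosida, ← Complex.ofReal_mul, norm_smul,
    mul_pow, Complex.norm_real, Real.norm_eq_abs, sq_abs]
  simp only [RCLike.re_to_complex, Complex.ofReal_re]
  ring

theorem gradSq_nonneg (N : Fin d → H →L[ℂ] H) (φ : H) : 0 ≤ gradSq N φ :=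
  Finset.sum_nonneg fun _ _ => sq_nonneg _

theorem IsResolvent.norm_le (hR : IsResolvent P ε R N) (φ : H) : ‖R φ‖ ≤ ‖φ‖ := by
  have h := hR.norm_sq_eq φ
  have h1 := mul_nonneg hR.pos.le (gradSq_nonneg N φ)
  refine abs_le_of_sq_le_sq' ?_ (norm_nonneg _) |>.2
  nlinarith [sq_nonneg (ε * ‖yosida ε R φ‖)]

theorem IsResolvent.gradSq_le (hR : IsResolvent P ε R N) (φ : H) :
    2 * (ε * gradSq N φ) ≤ ‖φ‖ ^ 2 := by
  have h := hR.norm_sq_eq φ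
  nlinarith [sq_nonneg (ε * ‖yosida ε R φ‖), sq_nonneg ‖R φ‖]

theorem IsResolvent.gradSq_le_kin (hR : IsResolvent P ε R N) (φ : H) :
    gradSq N φ ≤ kin ε R φ := by
  rw [hR.kin_eq]
  have := mul_nonneg hR.pos.le (sq_nonneg ‖yosida ε R φ‖)
  linarith

theorem IsResolvent.kin_nonneg (hR : IsResolvent P ε R N) (φ : H) : 0 ≤ kin ε R φ :=
  (gradSq_nonneg N φ).trans (hR.gradSq_le_kin φ)

theorem IsResolvent.norm_sub_sq_le (hR : IsResolvent P ε R N) (φ : H) :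
    ‖φ - R φ‖ ^ 2 ≤ ε * kin ε R φ := by
  have h : φ - R φ = (ε : ℂ) • yosida ε R φ := by
    nth_rewrite 1 [hR.eq_add φ]; abel
  rw [h, hR.kin_eq, norm_smul, mul_pow, Complex.norm_real, Real.norm_eq_abs, sq_abs]
  nlinarith [mul_nonneg hR.pos.le (gradSq_nonneg N φ)]

/-! ### The commutator of the resolvent with a multiplier -/

/-- The commutator `[R, F] φ`. -/
def resComm (R F : H →L[ℂ] H) (φ : H) : H := R (F φ) - F (R φ)

/-- The gradient of the commutator `[R, F] φ`. -/
def gradResComm (R F : H →L[ℂ] H) (N F' : Fin d → H →L[ℂ] H) (φ : H) (k : Fin d) : H :=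
  N k (F φ) - (F (N k φ) + F' k (R φ))

variable {S : Set (H →L[ℂ] H)} {F : H →L[ℂ] H} {F' : Fin d → H →L[ℂ] H}

theorem IsResolvent.resComm_mem (hR : IsResolvent P ε R N) (hP : IsLinearGraph P)
    (hF : IsMultiplier S P F F') (φ : H) : P (resComm R F φ) (gradResComm R F N F' φ) := by
  have := hP.add _ _ _ _ (hR.mem (F φ)) (hP.smul (-1) _ _ (hF.map _ _ (hR.mem φ)))
  simp only [neg_smul, one_smul, ← sub_eq_add_neg] at this
  exact this

/-- Formally `(1 + εK)[R, F] = -ε[K, F]R`, and `-[K, F]u = F'·∇u + ∇·(F'u)`. In weak form this needs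
only first derivatives of `F`. -/
theorem IsResolvent.resComm_weak (hR : IsResolvent P ε R N) (hS : IsSymmAlgebra S)
    (hF : IsMultiplier S P F F') (φ v : H) (W : Fin d → H) (h : P v W) :
    ⟪v, resComm R F φ⟫_ℂ + (ε : ℂ) * ∑ k, ⟪W k, gradResComm R F N F' φ k⟫_ℂ =
      (ε : ℂ) * ∑ k, (⟪v, F' k (N k φ)⟫_ℂ - ⟪W k, F' k (R φ)⟫_ℂ) := by
  have h1 := hR.weak (F φ) v W h
  have h2 := hR.weak φ _ _ (hF.map v W h)
  have sF := hS.symm F hF.mem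
  rw [sF, h1, sF] at h2
  have h3 : ∑ k, ⟪F (W k) + F' k v, N k φ⟫_ℂ =
      ∑ k, ⟪W k, F (N k φ)⟫_ℂ + ∑ k, ⟪v, F' k (N k φ)⟫_ℂ := by
    rw [← Finset.sum_add_distrib]
    exact Finset.sum_congr rfl fun k _ => by
      rw [inner_add_left, sF, hS.symm _ (hF.mem' k)]
  rw [h3] at h2
  simp only [resComm, gradResComm, inner_sub_right, inner_add_right, Finset.sum_sub_distrib,
    Finset.sum_add_distrib]
  linear_combination h2

/-- `‖[R, F] φ‖² + ε ‖∇ [R, F] φ‖²`. -/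
def resCommSq (ε : ℝ) (R F : H →L[ℂ] H) (N F' : Fin d → H →L[ℂ] H) (φ : H) : ℝ :=
  ‖resComm R F φ‖ ^ 2 + ε * ∑ k, ‖gradResComm R F N F' φ k‖ ^ 2

theorem ofReal_resCommSq (φ : H) :
    ((resCommSq ε R F N F' φ : ℝ) : ℂ) = ⟪resComm R F φ, resComm R F φ⟫_ℂ +
      (ε : ℂ) * ∑ k, ⟪gradResComm R F N F' φ k, gradResComm R F N F' φ k⟫_ℂ := by
  simp only [inner_self_eq_ofReal, resCommSq]
  push_cast
  rfl

/-- The equation of `[R, F]φ` is tested with `[R, F]φ` itself, and Young's inequality absorbs the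
unknown; `2ε‖∇Rφ‖² ≤ ‖φ‖²` controls the rest. Thus `[R, F]` has size `√ε`, but its gradient is only
bounded. -/
theorem IsResolvent.resCommSq_le (hR : IsResolvent P ε R N) (hP : IsLinearGraph P)
    (hS : IsSymmAlgebra S) (hF : IsMultiplier S P F F') {M : ℝ} (hM : 0 ≤ M)
    (hb : ∀ k x, ‖F' k x‖ ≤ M * ‖x‖) (φ : H) :
    resCommSq ε R F N F' φ ≤ 2 * d * M ^ 2 * ε * ‖φ‖ ^ 2 := by
  have h := hR.resComm_weak hS hF φ _ _ (hR.resComm_mem hP hF φ)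
  rw [← ofReal_resCommSq] at h
  have h' := congrArg Complex.re h
  rw [Complex.ofReal_re, Complex.re_ofReal_mul, Complex.re_sum] at h'
  simp only [Complex.sub_re] at h'
  have hε := hR.pos
  have hq := hR.gradSq_le φ
  have hg := hR.norm_le φ
  have hb1 : ∀ k, (⟪resComm R F φ, F' k (N k φ)⟫_ℂ).re ≤ ‖resComm R F φ‖ * (M * ‖N k φ‖) :=
    fun k => (le_abs_self _).trans ((abs_re_inner_le _ _).trans
      (mul_le_mul_of_nonneg_left (hb k _) (norm_nonneg _)))
  have hb2 : ∀ k, -(⟪gradResComm R F N F' φ k, F' k (R φ)⟫_ℂ).re ≤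
      ‖gradResComm R F N F' φ k‖ * (M * ‖φ‖) :=
    fun k => (neg_le_abs _).trans ((abs_re_inner_le _ _).trans
      (mul_le_mul_of_nonneg_left ((hb k _).trans (mul_le_mul_of_nonneg_left hg hM))
        (norm_nonneg _)))
  rcases Nat.eq_zero_or_pos d with hd | hd
  · subst hd
    simp at h'
    simp [h']
  have hd' : (0 : ℝ) < d := by exact_mod_cast hd
  -- The weight `1/(2d)` is chosen so that the `d` copies of the squared commutator add up to one
  -- half of it, which is absorbed on the left.
  have hterm : ∀ k, ε * ((⟪resComm R F φ, F' k (N k φ)⟫_ℂ).re -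
      (⟪gradResComm R F N F' φ k, F' k (R φ)⟫_ℂ).re) ≤
      ‖resComm R F φ‖ ^ 2 / (2 * d) + d * M ^ 2 * ε / 2 * (ε * ‖N k φ‖ ^ 2) +
        ε * ‖gradResComm R F N F' φ k‖ ^ 2 / 2 + ε * M ^ 2 * ‖φ‖ ^ 2 / 2 := by
    intro k
    have e1 : ε * (‖resComm R F φ‖ * (M * ‖N k φ‖)) ≤
        ‖resComm R F φ‖ ^ 2 / (2 * d) + d * M ^ 2 * ε / 2 * (ε * ‖N k φ‖ ^ 2) := by
      have : 0 ≤ (‖resComm R F φ‖ - d * ε * M * ‖N k φ‖) ^ 2 / (2 * d) := by positivity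
      have e : (‖resComm R F φ‖ - d * ε * M * ‖N k φ‖) ^ 2 / (2 * d) =
        ‖resComm R F φ‖ ^ 2 / (2 * d) + d * M ^ 2 * ε / 2 * (ε * ‖N k φ‖ ^ 2) -
          ε * (‖resComm R F φ‖ * (M * ‖N k φ‖)) := by
        field_simp
        ring
      linarith
    have e2 : ε * (‖gradResComm R F N F' φ k‖ * (M * ‖φ‖)) ≤
        ε * ‖gradResComm R F N F' φ k‖ ^ 2 / 2 + ε * M ^ 2 * ‖φ‖ ^ 2 / 2 := by
      nlinarith [mul_nonneg hε.le (sq_nonneg (‖gradResComm R F N F' φ k‖ - M * ‖φ‖))]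
    have e3 := mul_le_mul_of_nonneg_left (hb1 k) hε.le
    have e4 := mul_le_mul_of_nonneg_left (hb2 k) hε.le
    linarith
  have hsum := Finset.sum_le_sum fun k (_ : k ∈ Finset.univ) => hterm k
  rw [← Finset.mul_sum, ← h'] at hsum
  simp only [Finset.sum_add_distrib, ← Finset.mul_sum, ← Finset.sum_div, Finset.sum_const,
    Finset.card_univ, Fintype.card_fin, nsmul_eq_mul] at hsum
  have e5 : (d : ℝ) * ‖resComm R F φ‖ ^ 2 / (2 * d) = ‖resComm R F φ‖ ^ 2 / 2 := by
    field_simp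
  rw [e5] at hsum
  have e6 : d * M ^ 2 * ε / 2 * (ε * ∑ k, ‖N k φ‖ ^ 2) ≤ d * M ^ 2 * ε / 2 * (‖φ‖ ^ 2 / 2) := by
    apply mul_le_mul_of_nonneg_left _ (by positivity)
    have : ∑ k, ‖N k φ‖ ^ 2 = gradSq N φ := rfl
    rw [this]; linarith
  have e7 : resCommSq ε R F N F' φ = ‖resComm R F φ‖ ^ 2 +
    ε * ∑ k, ‖gradResComm R F N F' φ k‖ ^ 2 := rfl
  have e8 : 0 ≤ d * M ^ 2 * ε * ‖φ‖ ^ 2 := by positivity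
  nlinarith

/-- The double commutator with the resolvent. -/
theorem IsResolvent.dcomm_resolvent (hR : IsResolvent P ε R N) (hP : IsLinearGraph P)
    (hS : IsSymmAlgebra S) (hF : IsMultiplier S P F F') (φ : H) :
    dcomm R F φ = ε * ∑ k, ‖F' k (R φ)‖ ^ 2 - resCommSq ε R F N F' φ := by
  have sF := hS.symm F hF.mem
  have h1 : dcomm R F φ = -(⟪F φ, resComm R F φ⟫_ℂ).re := by
    rw [dcomm, ← sF, resComm, inner_sub_right, Complex.sub_re, re_inner_comm (F (R φ))]
    ring
  have h2 := hR.weak (F φ) _ _ (hR.resComm_mem hP hF φ)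
  have h3 := hR.resComm_weak hS hF φ _ _ (hR.mem (F φ))
  have h4 := hR.resComm_weak hS hF φ _ _ (hR.resComm_mem hP hF φ)
  have h5 := hR.resComm_weak hS hF φ _ _ (hF.map _ _ (hR.mem φ))
  have h6 : ⟪F φ, resComm R F φ⟫_ℂ =
      (ε : ℂ) * ∑ k, (⟪R (F φ), F' k (N k φ)⟫_ℂ - ⟪N k (F φ), F' k (R φ)⟫_ℂ) := by
    rw [← h3, ← inner_conj_symm, h2, map_add, map_mul, map_sum, inner_conj_symm,
      Complex.conj_ofReal]
    simp only [inner_conj_symm]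
  rw [← ofReal_resCommSq] at h4
  -- Since `R F φ = [R, F]φ + F R φ`, the commutator contributes its own energy `resCommSq`, and of
  -- the multiplier part only `-‖F' R φ‖²` survives in the real part.
  have h7 : ⟪F φ, resComm R F φ⟫_ℂ = ((resCommSq ε R F N F' φ : ℝ) : ℂ) +
      (ε : ℂ) * ∑ k, (⟪F (R φ), F' k (N k φ)⟫_ℂ - ⟪F (N k φ) + F' k (R φ), F' k (R φ)⟫_ℂ) := by
    rw [h6, h4, ← mul_add, ← Finset.sum_add_distrib]
    congr 1
    refine Finset.sum_congr rfl fun k _ => ?_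
    simp only [resComm, gradResComm, inner_sub_left]
    ring
  have h8 : ∀ k, (⟪F (R φ), F' k (N k φ)⟫_ℂ - ⟪F (N k φ) + F' k (R φ), F' k (R φ)⟫_ℂ).re =
      -‖F' k (R φ)‖ ^ 2 := by
    intro k
    rw [inner_add_left, Complex.sub_re, Complex.add_re, inner_self_eq_ofReal, Complex.ofReal_re,
      re_inner_comm (F (R φ)), hS.symm _ (hF.mem' k), ← hS.comm _ hF.mem _ (hF.mem' k), ← sF]
    ring
  rw [h1, h7, Complex.add_re, Complex.ofReal_re, Complex.re_ofReal_mul, Complex.re_sum]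
  simp only [h8, Finset.sum_neg_distrib]
  ring

end Resolvent

end DirichletForm
-- Regularization errors of bounded observables and of the generator of dilations.
section Dilations

open scoped InnerProductSpace

variable {H : Type*} [NormedAddCommGroup H] [InnerProductSpace ℂ H] {d : ℕ}

/-- The generator of dilations is antisymmetric on the graph of the gradient, and its commutator
with the Laplacian has the sign of a star-shaped domain. -/
structure IsVirial (P : H → (Fin d → H) → Prop) (Y : Fin d → H →L[ℂ] H) : Prop where
  antisymm : ∀ v W g G, P v W → P g G → ⟪v, rad Y g G⟫_ℂ = -⟪rad Y v W, g⟫_ℂ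
  virial : ∀ g G κ, P g G → (∀ v W, P v W → ⟪v, κ⟫_ℂ = ∑ k, ⟪W k, G k⟫_ℂ) →
    (⟪rad Y g G, κ⟫_ℂ).re ≤ 2 * ∑ k, ‖G k‖ ^ 2

/-- The operator `-i (2 y · ∇ + d) R`. -/
def radOp (Y : Fin d → H →L[ℂ] H) (R : H →L[ℂ] H) (N : Fin d → H →L[ℂ] H) : H →L[ℂ] H :=
  (-Complex.I) • ((2 : ℂ) • ∑ k, Y k * N k + (d : ℂ) • R)

theorem radOp_apply (Y : Fin d → H →L[ℂ] H) (R : H →L[ℂ] H) (N : Fin d → H →L[ℂ] H) (φ : H) :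
    radOp Y R N φ = (-Complex.I) • rad Y (R φ) (fun k => N k φ) := by
  simp only [radOp, rad, smul_apply, add_apply, sum_apply, mul_apply_eq_comp]

variable {P : H → (Fin d → H) → Prop} {ε : ℝ} {R : H →L[ℂ] H} {N : Fin d → H →L[ℂ] H}
  {S : Set (H →L[ℂ] H)} {F : H →L[ℂ] H} {F' : Fin d → H →L[ℂ] H}

theorem IsResolvent.norm_resComm_le (hR : IsResolvent P ε R N) (hP : IsLinearGraph P)
    (hS : IsSymmAlgebra S) (hF : IsMultiplier S P F F') {M : ℝ} (hM : 0 ≤ M)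
    (hb : ∀ k x, ‖F' k x‖ ≤ M * ‖x‖) (φ : H) :
    ‖resComm R F φ‖ ≤ 2 * d * M * √ε * ‖φ‖ := by
  have h := hR.resCommSq_le hP hS hF hM hb φ
  refine (abs_le_of_sq_le_sq' ?_ (by positivity)).2
  have h1 : ‖resComm R F φ‖ ^ 2 ≤ resCommSq ε R F N F' φ :=
    le_add_of_nonneg_right (mul_nonneg hR.pos.le (Finset.sum_nonneg fun _ _ => sq_nonneg _))
  have h2 : (2 * d * M * √ε * ‖φ‖) ^ 2 = 4 * (d : ℝ) ^ 2 * M ^ 2 * ε * ‖φ‖ ^ 2 := by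
    rw [mul_pow, mul_pow, Real.sq_sqrt hR.pos.le]; ring
  have h3 : (d : ℝ) ≤ d ^ 2 := by exact_mod_cast Nat.le_self_pow two_ne_zero d
  have h4 : 0 ≤ M ^ 2 * ε * ‖φ‖ ^ 2 := by have := hR.pos; positivity
  rw [h2]
  nlinarith

theorem IsResolvent.norm_gradResComm_le (hR : IsResolvent P ε R N) (hP : IsLinearGraph P)
    (hS : IsSymmAlgebra S) (hF : IsMultiplier S P F F') {M : ℝ} (hM : 0 ≤ M)
    (hb : ∀ k x, ‖F' k x‖ ≤ M * ‖x‖) (φ : H) (k : Fin d) :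
    ‖gradResComm R F N F' φ k‖ ≤ 2 * d * M * ‖φ‖ := by
  have h := hR.resCommSq_le hP hS hF hM hb φ
  have hε := hR.pos
  refine (abs_le_of_sq_le_sq' ?_ (by positivity)).2
  have h0 : ‖gradResComm R F N F' φ k‖ ^ 2 ≤ ∑ k, ‖gradResComm R F N F' φ k‖ ^ 2 :=
    Finset.single_le_sum (f := fun k => ‖gradResComm R F N F' φ k‖ ^ 2)
      (fun _ _ => sq_nonneg _) (Finset.mem_univ k)
  have h1 : ε * ∑ k, ‖gradResComm R F N F' φ k‖ ^ 2 ≤ resCommSq ε R F N F' φ :=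
    le_add_of_nonneg_left (sq_nonneg _)
  have h1' : ∑ k, ‖gradResComm R F N F' φ k‖ ^ 2 ≤ 2 * d * M ^ 2 * ‖φ‖ ^ 2 := by
    refine le_of_mul_le_mul_left ?_ hε
    linarith
  have h3 : (d : ℝ) ≤ d ^ 2 := by exact_mod_cast Nat.le_self_pow two_ne_zero d
  have h4 : 0 ≤ M ^ 2 * ‖φ‖ ^ 2 := by positivity
  nlinarith

theorem resolvent_mul (R F : H →L[ℂ] H) (φ : H) : R (F φ) = F (R φ) + resComm R F φ := by
  rw [resComm]; abel

theorem resolvent_mul_mul (R F : H →L[ℂ] H) (φ : H) :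
    R (F (F φ)) = F (F (R φ)) + (resComm R F (F φ) + F (resComm R F φ)) := by
  simp only [resComm, map_sub]; abel

/-- The error terms of a bounded observable. -/
theorem IsResolvent.abs_im_mul_le (hR : IsResolvent P ε R N) (hP : IsLinearGraph P)
    (hS : IsSymmAlgebra S) (hF : IsMultiplier S P F F') {M : ℝ} (hM : 0 ≤ M)
    (hb : ∀ k x, ‖F' k x‖ ≤ M * ‖x‖) {Z : H →L[ℂ] H} (hZ : Z ∈ S) (hZb : ∀ x, ‖Z x‖ ≤ M * ‖x‖)
    (φ : H) : |(⟪Z (R φ), R (F φ)⟫_ℂ).im| ≤ 2 * d * M ^ 2 * √ε * ‖φ‖ ^ 2 := by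
  rw [resolvent_mul R F φ, inner_add_right, Complex.add_im, hS.im_inner hZ hF.mem, zero_add]
  refine (abs_im_inner_le _ _).trans ?_
  calc ‖Z (R φ)‖ * ‖resComm R F φ‖ ≤ (M * ‖φ‖) * (2 * d * M * √ε * ‖φ‖) :=
        mul_le_mul ((hZb _).trans (mul_le_mul_of_nonneg_left (hR.norm_le φ) hM))
          (hR.norm_resComm_le hP hS hF hM hb φ) (norm_nonneg _) (by positivity)
    _ = _ := by ring

theorem IsResolvent.dcomm_eq (hR : IsResolvent P ε R N) (M F : H →L[ℂ] H) (φ : H) :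
    dcomm (R * M) F φ = (⟪M φ, R (F (F φ))⟫_ℂ).re - (⟪R (F φ), M (F φ)⟫_ℂ).re := by
  rw [dcomm, mul_apply_eq_comp, mul_apply_eq_comp, hR.symm, ← hR.symm (F φ)]

theorem IsResolvent.norm_remainder_le (hR : IsResolvent P ε R N) (hP : IsLinearGraph P)
    (hS : IsSymmAlgebra S) (hF : IsMultiplier S P F F') {M : ℝ} (hM : 0 ≤ M)
    (hFb : ∀ x, ‖F x‖ ≤ M * ‖x‖) (hb : ∀ k x, ‖F' k x‖ ≤ M * ‖x‖) (φ : H) :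
    ‖resComm R F (F φ) + F (resComm R F φ)‖ ≤ 4 * d * M ^ 2 * √ε * ‖φ‖ := by
  refine (norm_add_le _ _).trans ?_
  have h1 := hR.norm_resComm_le hP hS hF hM hb (F φ)
  have h2 := hR.norm_resComm_le hP hS hF hM hb φ
  have h3 : 2 * d * M * √ε * ‖F φ‖ ≤ 2 * d * M * √ε * (M * ‖φ‖) :=
    mul_le_mul_of_nonneg_left (hFb φ) (by positivity)
  have h4 : ‖F (resComm R F φ)‖ ≤ M * (2 * d * M * √ε * ‖φ‖) :=
    (hFb _).trans (mul_le_mul_of_nonneg_left h2 hM)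
  linarith

/-- `Z` and `F` commute, so the double commutator would vanish if `R` commuted with `F` too. Every
surviving term therefore contains a factor `[R, F]` of size `√ε`. -/
theorem IsResolvent.abs_dcomm_mul_le (hR : IsResolvent P ε R N) (hP : IsLinearGraph P)
    (hS : IsSymmAlgebra S) (hF : IsMultiplier S P F F') {M : ℝ} (hM : 0 ≤ M)
    (hFb : ∀ x, ‖F x‖ ≤ M * ‖x‖) (hb : ∀ k x, ‖F' k x‖ ≤ M * ‖x‖) {Z : H →L[ℂ] H} (hZ : Z ∈ S)
    (hZb : ∀ x, ‖Z x‖ ≤ M * ‖x‖) (φ : H) :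
    |dcomm (R * (Z * R)) F φ| ≤ 8 * d * M ^ 3 * √ε * ‖φ‖ ^ 2 := by
  have hg := hR.norm_le φ
  have he := hR.norm_resComm_le hP hS hF hM hb φ
  have he2 := hR.norm_remainder_le hP hS hF hM hFb hb φ
  have e0 : (⟪Z (R φ), F (F (R φ))⟫_ℂ).re = (⟪F (R φ), Z (F (R φ))⟫_ℂ).re := by
    rw [← hS.symm F hF.mem, hS.comm F hF.mem Z hZ, re_inner_comm]
  have e : dcomm (R * (Z * R)) F φ =
      (⟪Z (R φ), resComm R F (F φ) + F (resComm R F φ)⟫_ℂ).re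
        - (⟪Z (F (R φ)), resComm R F φ⟫_ℂ).re - (⟪resComm R F φ, Z (R (F φ))⟫_ℂ).re := by
    have e1 : ⟪R (F φ), Z (R (F φ))⟫_ℂ = ⟪F (R φ), Z (F (R φ))⟫_ℂ +
        ⟪Z (F (R φ)), resComm R F φ⟫_ℂ + ⟪resComm R F φ, Z (R (F φ))⟫_ℂ := by
      conv_lhs => rw [resolvent_mul R F φ, inner_add_left, map_add, inner_add_right]
      rw [← hS.symm Z hZ (F (R φ)) (resComm R F φ), ← map_add, ← resolvent_mul R F φ]
    rw [hR.dcomm_eq, mul_apply_eq_comp, mul_apply_eq_comp, e1, resolvent_mul_mul, inner_add_right]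
    simp only [Complex.add_re]
    linarith
  rw [e]
  have b1 : ‖Z (R φ)‖ ≤ M * ‖φ‖ := (hZb _).trans (mul_le_mul_of_nonneg_left hg hM)
  have b2 : ‖Z (F (R φ))‖ ≤ M * (M * ‖φ‖) := (hZb _).trans
    (mul_le_mul_of_nonneg_left ((hFb _).trans (mul_le_mul_of_nonneg_left hg hM)) hM)
  have b3 : ‖Z (R (F φ))‖ ≤ M * (M * ‖φ‖) := (hZb _).trans
    (mul_le_mul_of_nonneg_left ((hR.norm_le _).trans (hFb _)) hM)
  have c1 := (abs_re_inner_le (Z (R φ)) (resComm R F (F φ) + F (resComm R F φ))).trans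
    (mul_le_mul b1 he2 (norm_nonneg _) (by positivity))
  have c2 := (abs_re_inner_le (Z (F (R φ))) (resComm R F φ)).trans
    (mul_le_mul b2 he (norm_nonneg _) (by positivity))
  have c3 := (abs_re_inner_le (resComm R F φ) (Z (R (F φ)))).trans
    (mul_le_mul he b3 (norm_nonneg _) (by positivity))
  rw [abs_le] at c1 c2 c3 ⊢
  constructor <;> nlinarith

/-! ### The error terms of the generator of dilations -/

variable {Y : Fin d → H →L[ℂ] H}

theorem norm_rad_le {M : ℝ} (hYb : ∀ k x, ‖Y k x‖ ≤ M * ‖x‖) (g : H) (G : Fin d → H) :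
    ‖rad Y g G‖ ≤ 2 * M * ∑ k, ‖G k‖ + d * ‖g‖ := by
  refine (norm_add_le _ _).trans (add_le_add ?_ ?_)
  · rw [norm_smul, mul_assoc, Finset.mul_sum]
    refine mul_le_mul (by simp) ((norm_sum_le _ _).trans (Finset.sum_le_sum fun k _ => hYb k _))
      (norm_nonneg _) (by norm_num)
  · rw [norm_smul]; simp

theorem norm_mul_sum_norm_le (N : Fin d → H →L[ℂ] H) (φ : H) :
    ‖φ‖ * ∑ k, ‖N k φ‖ ≤ d * ‖φ‖ ^ 2 + gradSq N φ := by
  rw [Finset.mul_sum, gradSq]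
  have : ∀ k, ‖φ‖ * ‖N k φ‖ ≤ ‖φ‖ ^ 2 + ‖N k φ‖ ^ 2 := fun k => by
    nlinarith [sq_nonneg (‖φ‖ - ‖N k φ‖), sq_nonneg ‖φ‖, sq_nonneg ‖N k φ‖]
  refine (Finset.sum_le_sum fun k _ => this k).trans (le_of_eq ?_)
  rw [Finset.sum_add_distrib]; simp

/-- This is the commutator `[2y·∇ + d, F] = 2 y·∇F`, a multiplier again. -/
theorem rad_map (hS : IsSymmAlgebra S) (hF : IsMultiplier S P F F') (hY : ∀ k, Y k ∈ S) (g : H)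
    (G : Fin d → H) :
    rad Y (F g) (fun k => F (G k) + F' k g) =
      F (rad Y g G) + (2 : ℂ) • (∑ k, Y k * F' k : H →L[ℂ] H) g := by
  simp only [rad, map_add, map_smul, map_sum, sum_apply, mul_apply_eq_comp, Finset.sum_add_distrib,
    smul_add]
  rw [Finset.sum_congr rfl fun k _ => hS.comm (Y k) (hY k) F hF.mem (G k)]
  abel

theorem re_inner_neg_I_smul (x y : H) : (⟪x, (-Complex.I) • y⟫_ℂ).re = (⟪x, y⟫_ℂ).im := by
  rw [inner_smul_right]; simp

theorem re_neg_I_smul_inner (x y : H) : (⟪(-Complex.I) • x, y⟫_ℂ).re = -(⟪x, y⟫_ℂ).im := by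
  rw [inner_smul_left]; simp

theorem im_neg_I_smul_inner (x y : H) : (⟪(-Complex.I) • x, y⟫_ℂ).im = (⟪x, y⟫_ℂ).re := by
  rw [inner_smul_left]; simp

theorem sum_mul_mem (hS : IsSymmAlgebra S) (hF : IsMultiplier S P F F') (hY : ∀ k, Y k ∈ S) :
    (∑ k, Y k * F' k : H →L[ℂ] H) ∈ S :=
  hS.sum _ fun k => hS.mul _ (hY k) _ (hF.mem' k)

/-- Antisymmetry makes the real part one half of the commutator of `rad` with `F`. This produces the
term `⟨y·∇f⟩` to which convexity is applied. -/
theorem IsVirial.re_inner_rad (hV : IsVirial P Y) (hS : IsSymmAlgebra S)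
    (hF : IsMultiplier S P F F') (hY : ∀ k, Y k ∈ S) (g : H) (G : Fin d → H) (hg : P g G) :
    (⟪rad Y g G, F g⟫_ℂ).re = -(⟪g, (∑ k, Y k * F' k : H →L[ℂ] H) g⟫_ℂ).re := by
  have h := hV.antisymm _ _ _ _ hg (hF.map _ _ hg)
  rw [rad_map hS hF hY, inner_add_right, inner_smul_right, ← hS.symm F hF.mem] at h
  have h' := congrArg Complex.re h
  rw [Complex.add_re, Complex.neg_re, re_inner_comm (F g)] at h'
  have : ((2 : ℂ) * ⟪g, (∑ k, Y k * F' k : H →L[ℂ] H) g⟫_ℂ).re =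
      2 * (⟪g, (∑ k, Y k * F' k : H →L[ℂ] H) g⟫_ℂ).re := by simp
  linarith

theorem norm_sum_mul_le {M : ℝ} (hM : 0 ≤ M) (hYb : ∀ k x, ‖Y k x‖ ≤ M * ‖x‖)
    (hb : ∀ k x, ‖F' k x‖ ≤ M * ‖x‖) (g : H) :
    ‖(∑ k, Y k * F' k : H →L[ℂ] H) g‖ ≤ d * M ^ 2 * ‖g‖ := by
  rw [sum_apply]
  refine (norm_sum_le _ _).trans ((Finset.sum_le_sum (g := fun _ => M ^ 2 * ‖g‖)
    fun k _ => ?_).trans (le_of_eq (by simp; ring)))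
  rw [mul_apply_eq_comp, sq, mul_assoc]
  exact (hYb _ _).trans (mul_le_mul_of_nonneg_left (hb _ _) hM)

theorem IsResolvent.norm_mul_rad_le (hR : IsResolvent P ε R N) {M : ℝ} (hM : 0 ≤ M)
    (hYb : ∀ k x, ‖Y k x‖ ≤ M * ‖x‖) (φ : H) :
    ‖φ‖ * ‖rad Y (R φ) (fun k => N k φ)‖ ≤ (2 * M * (d + 1) + d) * (‖φ‖ ^ 2 + kin ε R φ) := by
  have h1 := mul_le_mul_of_nonneg_left (norm_rad_le hYb (R φ) (fun k => N k φ)) (norm_nonneg φ)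
  have h2 := norm_mul_sum_norm_le N φ
  have h3 := hR.gradSq_le_kin φ
  have h4 : ‖φ‖ * (d * ‖R φ‖) ≤ ‖φ‖ * (d * ‖φ‖) := by gcongr; exact hR.norm_le φ
  have h5 : 2 * M * (‖φ‖ * ∑ k, ‖N k φ‖) ≤ 2 * M * (d * ‖φ‖ ^ 2 + gradSq N φ) := by gcongr
  have h6 : 2 * M * (d * ‖φ‖ ^ 2 + gradSq N φ) ≤ 2 * M * (d * ‖φ‖ ^ 2 + kin ε R φ) := by gcongr
  have h7 := hR.kin_nonneg φ
  have h8 : 0 ≤ M * ‖φ‖ ^ 2 := by positivity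
  have h9 : 0 ≤ M * d * kin ε R φ := by positivity
  have h10 : 0 ≤ d * kin ε R φ := by positivity
  nlinarith

/-- The gradient of `R F φ` is `F ∇Rφ + F' Rφ + ∇[R, F]φ`; a bound of order one for the last term
suffices here. -/
theorem IsResolvent.norm_mul_rad_mul_le (hR : IsResolvent P ε R N) (hP : IsLinearGraph P)
    (hS : IsSymmAlgebra S) (hF : IsMultiplier S P F F') {M : ℝ} (hM : 0 ≤ M)
    (hFb : ∀ x, ‖F x‖ ≤ M * ‖x‖) (hb : ∀ k x, ‖F' k x‖ ≤ M * ‖x‖)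
    (hYb : ∀ k x, ‖Y k x‖ ≤ M * ‖x‖) (φ : H) :
    ‖φ‖ * ‖rad Y (R (F φ)) (fun k => N k (F φ))‖ ≤
      (2 * M ^ 2 * (3 * d + 2 * d ^ 2 + 1) + d * M) * (‖φ‖ ^ 2 + kin ε R φ) := by
  have h1 := mul_le_mul_of_nonneg_left (norm_rad_le hYb (R (F φ)) (fun k => N k (F φ)))
    (norm_nonneg φ)
  have h2 : ∀ k, ‖N k (F φ)‖ ≤ M * ‖N k φ‖ + (M + 2 * d * M) * ‖φ‖ := by
    intro k
    have e : N k (F φ) = (F (N k φ) + F' k (R φ)) + gradResComm R F N F' φ k := by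
      rw [gradResComm]; abel
    rw [e]
    have h3 := hR.norm_gradResComm_le hP hS hF hM hb φ k
    have h4 : ‖F' k (R φ)‖ ≤ M * ‖φ‖ :=
      (hb _ _).trans (mul_le_mul_of_nonneg_left (hR.norm_le φ) hM)
    have h5 := norm_add_le (F (N k φ) + F' k (R φ)) (gradResComm R F N F' φ k)
    have h6 := norm_add_le (F (N k φ)) (F' k (R φ))
    have h7 := hFb (N k φ)
    linarith
  have h3 : ∑ k, ‖N k (F φ)‖ ≤ M * ∑ k, ‖N k φ‖ + d * ((M + 2 * d * M) * ‖φ‖) := by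
    refine (Finset.sum_le_sum fun k _ => h2 k).trans (le_of_eq ?_)
    rw [Finset.sum_add_distrib, ← Finset.mul_sum]; simp
  have h4 : ‖R (F φ)‖ ≤ M * ‖φ‖ := (hR.norm_le _).trans (hFb _)
  have h5 := norm_mul_sum_norm_le N φ
  have h6 := hR.gradSq_le_kin φ
  have h7 := hR.kin_nonneg φ
  have h8 : ‖φ‖ * (2 * M * ∑ k, ‖N k (F φ)‖ + d * ‖R (F φ)‖) ≤
      ‖φ‖ * (2 * M * (M * ∑ k, ‖N k φ‖ + d * ((M + 2 * d * M) * ‖φ‖)) + d * (M * ‖φ‖)) := by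
    gcongr
  have h9 : 2 * M ^ 2 * (‖φ‖ * ∑ k, ‖N k φ‖) ≤ 2 * M ^ 2 * (d * ‖φ‖ ^ 2 + kin ε R φ) := by
    apply mul_le_mul_of_nonneg_left _ (by positivity); linarith
  have p1 : 0 ≤ M ^ 2 * d * kin ε R φ := by positivity
  have p2 : 0 ≤ M ^ 2 * d ^ 2 * kin ε R φ := by positivity
  have p3 : 0 ≤ d * M * kin ε R φ := by positivity
  have p4 : 0 ≤ M ^ 2 * ‖φ‖ ^ 2 := by positivity
  have p5 : 0 ≤ M ^ 2 * d * ‖φ‖ ^ 2 := by positivity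
  calc _ ≤ _ := h1
    _ ≤ _ := h8
    _ = 2 * M ^ 2 * (‖φ‖ * ∑ k, ‖N k φ‖) + 2 * M ^ 2 * (d + 2 * d ^ 2) * ‖φ‖ ^ 2 +
        d * M * ‖φ‖ ^ 2 := by ring
    _ ≤ _ := by nlinarith

/-- The commutator of a first order operator with a function is a function, so the second commutator
vanishes up to factors `[R, F]`. These factors meet one gradient, which is why the kinetic energy
enters the bound. -/
theorem IsResolvent.abs_dcomm_rad_le (hR : IsResolvent P ε R N) (hP : IsLinearGraph P)
    (hS : IsSymmAlgebra S) (hV : IsVirial P Y) (hY : ∀ k, Y k ∈ S)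
    (hF : IsMultiplier S P F F') {M : ℝ} (hM : 0 ≤ M)
    (hFb : ∀ x, ‖F x‖ ≤ M * ‖x‖) (hb : ∀ k x, ‖F' k x‖ ≤ M * ‖x‖)
    (hYb : ∀ k x, ‖Y k x‖ ≤ M * ‖x‖) (φ : H) :
    |dcomm (R * radOp Y R N) F φ| ≤
      2 * d * M * (3 * M * (2 * M * (d + 1) + d) + 2 * d * M ^ 2 +
        (2 * M ^ 2 * (3 * d + 2 * d ^ 2 + 1) + d * M)) * √ε * (‖φ‖ ^ 2 + kin ε R φ) := by
  set r := rad Y (R φ) (fun k => N k φ) with hr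
  set r' := rad Y (R (F φ)) (fun k => N k (F φ)) with hr'
  set u := (∑ k, Y k * F' k : H →L[ℂ] H) (R φ) with hu
  set e := resComm R F φ with he
  set e2 := resComm R F (F φ) + F (resComm R F φ) with he2
  have a1 : ⟪F (R φ), r'⟫_ℂ = -⟪F r + (2 : ℂ) • u, R (F φ)⟫_ℂ := by
    rw [hr, hu, ← rad_map hS hF hY]
    exact hV.antisymm _ _ _ _ (hF.map _ _ (hR.mem φ)) (hR.mem (F φ))
  -- The vanishing of the second commutator appears as the reality of the form of two commuting
  -- symmetric multipliers.
  have a2 : (⟪(2 : ℂ) • u, F (R φ)⟫_ℂ).im = 0 := by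
    have h2 : (⟪(2 : ℂ) • u, F (R φ)⟫_ℂ).im = 2 * (⟪u, F (R φ)⟫_ℂ).im := by
      rw [inner_smul_left]; simp
    rw [h2, hu, hS.im_inner (sum_mul_mem hS hF hY) hF.mem, mul_zero]
  have a3 : dcomm (R * radOp Y R N) F φ =
      -(⟪r, e2⟫_ℂ).im + (⟪F r + (2 : ℂ) • u, e⟫_ℂ).im - (⟪e, r'⟫_ℂ).im := by
    rw [hR.dcomm_eq, radOp_apply, radOp_apply, re_neg_I_smul_inner, re_inner_neg_I_smul,
      resolvent_mul_mul, ← hr, ← hr', ← he2, inner_add_right]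
    have h1 : ⟪R (F φ), r'⟫_ℂ = -⟪F r + (2 : ℂ) • u, R (F φ)⟫_ℂ + ⟪e, r'⟫_ℂ := by
      rw [← a1]
      conv_lhs => rw [resolvent_mul R F φ]
      rw [inner_add_left]
    have h2 : ⟪F r + (2 : ℂ) • u, R (F φ)⟫_ℂ = ⟪r, F (F (R φ))⟫_ℂ + ⟪(2 : ℂ) • u, F (R φ)⟫_ℂ +
        ⟪F r + (2 : ℂ) • u, e⟫_ℂ := by
      rw [resolvent_mul R F φ, inner_add_right, inner_add_left (F r), hS.symm F hF.mem r]
    rw [h1, h2]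
    simp only [Complex.add_im, Complex.neg_im, a2]
    ring
  have b1 := hR.norm_mul_rad_le hM hYb φ
  have b2 := hR.norm_mul_rad_mul_le hP hS hF hM hFb hb hYb φ
  have b3 := hR.norm_resComm_le hP hS hF hM hb φ
  have b4 := hR.norm_remainder_le hP hS hF hM hFb hb φ
  have b5 : ‖u‖ ≤ d * M ^ 2 * ‖φ‖ := (norm_sum_mul_le hM hYb hb _).trans
    (mul_le_mul_of_nonneg_left (hR.norm_le φ) (by positivity))
  have b6 := hR.kin_nonneg φ
  rw [← hr] at b1
  rw [← hr'] at b2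
  rw [← he] at b3
  rw [← he2] at b4
  have c1 : |(⟪r, e2⟫_ℂ).im| ≤ 4 * d * M ^ 2 * √ε * (‖φ‖ * ‖r‖) := by
    refine (abs_im_inner_le _ _).trans ((mul_le_mul_of_nonneg_left b4 (norm_nonneg _)).trans
      (le_of_eq (by ring)))
  have c2 : |(⟪F r + (2 : ℂ) • u, e⟫_ℂ).im| ≤
      2 * d * M * √ε * (M * (‖φ‖ * ‖r‖) + 2 * d * M ^ 2 * ‖φ‖ ^ 2) := by
    have h1 : ‖F r + (2 : ℂ) • u‖ ≤ M * ‖r‖ + 2 * (d * M ^ 2 * ‖φ‖) := by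
      refine (norm_add_le _ _).trans (add_le_add (hFb r) ?_)
      rw [norm_smul]
      refine mul_le_mul (by simp) b5 (norm_nonneg _) (by norm_num)
    refine (abs_im_inner_le _ _).trans ((mul_le_mul h1 b3 (norm_nonneg _) (by positivity)).trans
      (le_of_eq (by ring)))
  have c3 : |(⟪e, r'⟫_ℂ).im| ≤ 2 * d * M * √ε * (‖φ‖ * ‖r'‖) := by
    refine (abs_im_inner_le _ _).trans ((mul_le_mul_of_nonneg_right b3 (norm_nonneg _)).trans
      (le_of_eq (by ring)))
  rw [a3]
  have c4 : ∀ x y z : ℝ, |-x + y - z| ≤ |x| + |y| + |z| := fun x y z => by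
    refine (abs_sub _ _).trans (add_le_add ((abs_add_le _ _).trans ?_) le_rfl)
    rw [abs_neg]
  refine (c4 _ _ _).trans ((add_le_add (add_le_add c1 c2) c3).trans ?_)
  set w := ‖φ‖ ^ 2 + kin ε R φ with hw
  have d0 : ‖φ‖ ^ 2 ≤ w := by linarith
  have d1 : 4 * d * M ^ 2 * √ε * (‖φ‖ * ‖r‖) ≤
      4 * d * M ^ 2 * √ε * ((2 * M * (d + 1) + d) * w) := by gcongr
  have d2 : 2 * d * M * √ε * (M * (‖φ‖ * ‖r‖) + 2 * d * M ^ 2 * ‖φ‖ ^ 2) ≤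
      2 * d * M * √ε * (M * ((2 * M * (d + 1) + d) * w) + 2 * d * M ^ 2 * w) := by gcongr
  have d3 : 2 * d * M * √ε * (‖φ‖ * ‖r'‖) ≤
      2 * d * M * √ε * ((2 * M ^ 2 * (3 * d + 2 * d ^ 2 + 1) + d * M) * w) := by gcongr
  refine (add_le_add (add_le_add d1 d2) d3).trans (le_of_eq (by ring))

end Dilations

/-! ### The derivative of the Lyapunov function as an inequality of quadratic forms. -/

section PureStateEvolution

open scoped InnerProductSpace

variable {H : Type*} [NormedAddCommGroup H] [InnerProductSpace ℂ H] {d m : ℕ}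

/-- The quadratic form of the Heisenberg generator, with kinetic coefficient `p`, potential
coefficient `r` and noise strength `n`, at the observable `O = R M`. -/
def genForm (p r n : ℝ) (κ F : H →L[ℂ] H) (Fs : Fin m → H →L[ℂ] H) (M O : H →L[ℂ] H) (φ : H) : ℝ :=
  p * (⟪M φ, κ φ⟫_ℂ).im + 2 * r * (⟪O φ, F φ⟫_ℂ).im +
    n * (dcomm O F φ - (1 / (m : ℝ)) * ∑ j, dcomm O (Fs j) φ)

variable {P : H → (Fin d → H) → Prop} {ε : ℝ} {R : H →L[ℂ] H} {N : Fin d → H →L[ℂ] H}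
  {S : Set (H →L[ℂ] H)} {F : H →L[ℂ] H} {F' : Fin d → H →L[ℂ] H} {Fs : Fin m → H →L[ℂ] H}
  {Fs' : Fin m → Fin d → H →L[ℂ] H} {Y : Fin d → H →L[ℂ] H}

/-- A family of multipliers with average `F`, uniformly bounded by `M`. -/
structure IsMultiplierFamily (S : Set (H →L[ℂ] H)) (P : H → (Fin d → H) → Prop) (M : ℝ)
    (F : H →L[ℂ] H) (F' : Fin d → H →L[ℂ] H) (Fs : Fin m → H →L[ℂ] H)
    (Fs' : Fin m → Fin d → H →L[ℂ] H) : Prop where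
  pos : 0 < m
  nonneg : 0 ≤ M
  mult : IsMultiplier S P F F'
  mults : ∀ j, IsMultiplier S P (Fs j) (Fs' j)
  avg : ∀ x, F x = ((1 / (m : ℝ) : ℝ) : ℂ) • ∑ j, Fs j x
  avg' : ∀ k x, F' k x = ((1 / (m : ℝ) : ℝ) : ℂ) • ∑ j, Fs' j k x
  bound : ∀ x, ‖F x‖ ≤ M * ‖x‖
  bound' : ∀ k x, ‖F' k x‖ ≤ M * ‖x‖
  bounds : ∀ j x, ‖Fs j x‖ ≤ M * ‖x‖
  bounds' : ∀ j k x, ‖Fs' j k x‖ ≤ M * ‖x‖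

theorem abs_sub_avg_le (hm : 0 < m) {x B : ℝ} {y : Fin m → ℝ} (hx : |x| ≤ B)
    (hy : ∀ j, |y j| ≤ B) : |x - (1 / (m : ℝ)) * ∑ j, y j| ≤ 2 * B := by
  have hm' : (0 : ℝ) < m := by exact_mod_cast hm
  have h1 : |(1 / (m : ℝ)) * ∑ j, y j| ≤ B := by
    rw [abs_mul, abs_of_pos (by positivity : (0 : ℝ) < 1 / m), div_mul_eq_mul_div, one_mul,
      div_le_iff₀ hm']
    refine (Finset.abs_sum_le_sum_abs _ _).trans ((Finset.sum_le_sum fun j _ => hy j).trans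
      (le_of_eq (by simp; ring)))
  refine (abs_sub _ _).trans (by linarith)

theorem norm_avg_sq_le (hm : 0 < m) (x : Fin m → H) :
    ‖((1 / (m : ℝ) : ℝ) : ℂ) • ∑ j, x j‖ ^ 2 ≤ (1 / (m : ℝ)) * ∑ j, ‖x j‖ ^ 2 := by
  have hm' : (0 : ℝ) < m := by exact_mod_cast hm
  have h1 : ‖∑ j, x j‖ ^ 2 ≤ m * ∑ j, ‖x j‖ ^ 2 := by
    have h2 := sq_sum_le_card_mul_sum_sq (s := Finset.univ) (f := fun j => ‖x j‖)
    rw [Finset.card_univ, Fintype.card_fin] at h2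
    exact (pow_le_pow_left₀ (norm_nonneg _) (norm_sum_le _ _) 2).trans h2
  rw [norm_smul, mul_pow, Complex.norm_real, Real.norm_eq_abs, sq_abs]
  calc (1 / (m : ℝ)) ^ 2 * ‖∑ j, x j‖ ^ 2 ≤ (1 / (m : ℝ)) ^ 2 * (m * ∑ j, ‖x j‖ ^ 2) := by gcongr
    _ = _ := by field_simp

/-- Jensen's inequality: `resCommSq` is the square of a norm of an expression linear in the
multiplier. Divided by `ε`, it enters the noise on the kinetic term with order one, so its sign has
to be used. -/
theorem IsMultiplierFamily.resCommSq_le {M : ℝ} (hF : IsMultiplierFamily S P M F F' Fs Fs')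
    (hε : 0 ≤ ε) (R : H →L[ℂ] H) (N : Fin d → H →L[ℂ] H) (φ : H) :
    resCommSq ε R F N F' φ ≤ (1 / (m : ℝ)) * ∑ j, resCommSq ε R (Fs j) N (Fs' j) φ := by
  have e1 : resComm R F φ = ((1 / (m : ℝ) : ℝ) : ℂ) • ∑ j, resComm R (Fs j) φ := by
    simp only [resComm, hF.avg, map_smul, map_sum, Finset.sum_sub_distrib, smul_sub]
  have e2 : ∀ k, gradResComm R F N F' φ k =
      ((1 / (m : ℝ) : ℝ) : ℂ) • ∑ j, gradResComm R (Fs j) N (Fs' j) φ k := by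
    intro k
    simp only [gradResComm, hF.avg, hF.avg', map_smul, map_sum, Finset.sum_sub_distrib,
      Finset.sum_add_distrib, smul_sub, smul_add]
  have h1 := norm_avg_sq_le hF.pos fun j => resComm R (Fs j) φ
  rw [← e1] at h1
  have h2 : ∑ k, ‖gradResComm R F N F' φ k‖ ^ 2 ≤
      ∑ k, (1 / (m : ℝ)) * ∑ j, ‖gradResComm R (Fs j) N (Fs' j) φ k‖ ^ 2 :=
    Finset.sum_le_sum fun k _ => by
      rw [e2]; exact norm_avg_sq_le hF.pos fun j => gradResComm R (Fs j) N (Fs' j) φ k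
  have h3 := mul_le_mul_of_nonneg_left h2 hε
  refine (add_le_add h1 h3).trans (le_of_eq ?_)
  simp only [resCommSq, Finset.sum_add_distrib, ← Finset.mul_sum]
  rw [Finset.sum_comm]
  ring

/-- The observable `R Z R` of a multiplier `Z`. -/
theorem IsMultiplierFamily.abs_genForm_mul_sub_le {M : ℝ}
    (hF : IsMultiplierFamily S P M F F' Fs Fs') (hR : IsResolvent P ε R N)
    (hP : IsLinearGraph P) (hS : IsSymmAlgebra S) {Z : H →L[ℂ] H} {Z' : Fin d → H →L[ℂ] H}
    (hZ : IsMultiplier S P Z Z') (hZb : ∀ x, ‖Z x‖ ≤ M * ‖x‖) {p r n : ℝ} (hr : 0 ≤ r)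
    (hn : 0 ≤ n) (φ : H) :
    |genForm p r n (yosida ε R) F Fs (Z * R) (R * (Z * R)) φ -
      p * ∑ k, (⟪Z' k (R φ), N k φ⟫_ℂ).im| ≤
      (r + n) * (4 * d * M ^ 2 + 16 * d * M ^ 3) * √ε * (‖φ‖ ^ 2 + kin ε R φ) := by
  have hM := hF.nonneg
  have h1 := hR.abs_im_mul_le hP hS hF.mult hM hF.bound' hZ.mem hZb φ
  have h2 := abs_sub_avg_le hF.pos
    (hR.abs_dcomm_mul_le hP hS hF.mult hM hF.bound hF.bound' hZ.mem hZb φ)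
    (fun j => hR.abs_dcomm_mul_le hP hS (hF.mults j) hM (hF.bounds j) (hF.bounds' j) hZ.mem hZb φ)
  have h3 : (⟪(Z * R) φ, yosida ε R φ⟫_ℂ).im = ∑ k, (⟪Z' k (R φ), N k φ⟫_ℂ).im := by
    rw [mul_apply_eq_comp, hR.inner_yosida _ _ _ (hZ.map _ _ (hR.mem φ)), Complex.im_sum]
    refine Finset.sum_congr rfl fun k _ => ?_
    rw [inner_add_left, Complex.add_im]
    have : (⟪Z (N k φ), N k φ⟫_ℂ).im = 0 := by
      have e : ⟪Z (N k φ), N k φ⟫_ℂ = ⟪N k φ, Z (N k φ)⟫_ℂ := hS.symm Z hZ.mem _ _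
      have := im_inner_comm (Z (N k φ)) (N k φ)
      rw [← e] at this
      linarith
    rw [this, zero_add]
  have h4 : (⟪(R * (Z * R)) φ, F φ⟫_ℂ).im = (⟪Z (R φ), R (F φ)⟫_ℂ).im := by
    rw [mul_apply_eq_comp, mul_apply_eq_comp, hR.symm]
  rw [genForm, h3, h4, add_assoc, add_sub_cancel_left]
  have hk := hR.kin_nonneg φ
  have hw : ‖φ‖ ^ 2 ≤ ‖φ‖ ^ 2 + kin ε R φ := by linarith
  have g1 : |2 * r * (⟪Z (R φ), R (F φ)⟫_ℂ).im| ≤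
      2 * r * (2 * d * M ^ 2 * √ε * (‖φ‖ ^ 2 + kin ε R φ)) := by
    rw [abs_mul, abs_of_nonneg (by positivity : 0 ≤ 2 * r)]
    exact mul_le_mul_of_nonneg_left (h1.trans (mul_le_mul_of_nonneg_left hw (by positivity)))
      (by positivity)
  have g2 : |n * (dcomm (R * (Z * R)) F φ - (1 / (m : ℝ)) * ∑ j, dcomm (R * (Z * R)) (Fs j) φ)| ≤
      n * (2 * (8 * d * M ^ 3 * √ε * (‖φ‖ ^ 2 + kin ε R φ))) := by
    rw [abs_mul, abs_of_nonneg hn]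
    exact mul_le_mul_of_nonneg_left (h2.trans (mul_le_mul_of_nonneg_left
      (mul_le_mul_of_nonneg_left hw (by positivity)) (by norm_num))) hn
  refine (abs_add_le _ _).trans ((add_le_add g1 g2).trans ?_)
  have q1 : 0 ≤ n * (d * M ^ 2 * √ε * (‖φ‖ ^ 2 + kin ε R φ)) := by positivity
  have q2 : 0 ≤ r * (d * M ^ 3 * √ε * (‖φ‖ ^ 2 + kin ε R φ)) := by positivity
  nlinarith

/-- The bound for the error terms of the generator of dilations. -/
def radBound (d : ℕ) (M : ℝ) : ℝ :=
  4 * d * M * (2 * M * (d + 1) + d) + 4 * d * M * (3 * M * (2 * M * (d + 1) + d) + 2 * d * M ^ 2 +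
        (2 * M ^ 2 * (3 * d + 2 * d ^ 2 + 1) + d * M))

/-- The kinetic part is the virial inequality, the potential part gives `-2r⟨y·∇f⟩`, and the noise
contributes only an error of order `√ε`. -/
theorem IsMultiplierFamily.genForm_rad_le {M : ℝ}
    (hF : IsMultiplierFamily S P M F F' Fs Fs') (hR : IsResolvent P ε R N)
    (hP : IsLinearGraph P) (hS : IsSymmAlgebra S) (hV : IsVirial P Y) (hY : ∀ k, Y k ∈ S)
    (hYb : ∀ k x, ‖Y k x‖ ≤ M * ‖x‖) {p r n : ℝ} (hp : 0 ≤ p) (hr : 0 ≤ r) (hn : 0 ≤ n) (φ : H) :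
    genForm p r n (yosida ε R) F Fs (radOp Y R N) (R * radOp Y R N) φ ≤
      2 * p * gradSq N φ - 2 * r * (⟪R φ, (∑ k, Y k * F' k : H →L[ℂ] H) (R φ)⟫_ℂ).re +
        (r + n) * radBound d M * √ε * (‖φ‖ ^ 2 + kin ε R φ) := by
  have hM := hF.nonneg
  have h2 := abs_sub_avg_le hF.pos
    (hR.abs_dcomm_rad_le hP hS hV hY hF.mult hM hF.bound hF.bound' hYb φ)
    (fun j => hR.abs_dcomm_rad_le hP hS hV hY (hF.mults j) hM (hF.bounds j) (hF.bounds' j) hYb φ)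
  have h3 : (⟪radOp Y R N φ, yosida ε R φ⟫_ℂ).im ≤ 2 * gradSq N φ := by
    rw [radOp_apply, im_neg_I_smul_inner]
    exact hV.virial _ _ _ (hR.mem φ) (hR.inner_yosida φ)
  have h4 : (⟪(R * radOp Y R N) φ, F φ⟫_ℂ).im =
      -(⟪R φ, (∑ k, Y k * F' k : H →L[ℂ] H) (R φ)⟫_ℂ).re +
        (⟪rad Y (R φ) (fun k => N k φ), resComm R F φ⟫_ℂ).re := by
    rw [mul_apply_eq_comp, hR.symm, radOp_apply, im_neg_I_smul_inner, resolvent_mul R F φ,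
      inner_add_right, Complex.add_re, hV.re_inner_rad hS hF.mult hY _ _ (hR.mem φ)]
  have h5 : |(⟪rad Y (R φ) (fun k => N k φ), resComm R F φ⟫_ℂ).re| ≤
      2 * d * M * √ε * ((2 * M * (d + 1) + d) * (‖φ‖ ^ 2 + kin ε R φ)) := by
    have b := hR.norm_mul_rad_le hM hYb φ
    refine (abs_re_inner_le _ _).trans ((mul_le_mul_of_nonneg_left
      (hR.norm_resComm_le hP hS hF.mult hM hF.bound' φ) (norm_nonneg _)).trans ?_)
    calc _ = 2 * d * M * √ε * (‖φ‖ * ‖rad Y (R φ) (fun k => N k φ)‖) := by ring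
      _ ≤ _ := mul_le_mul_of_nonneg_left b (by positivity)
  rw [genForm, h4]
  have hk := hR.kin_nonneg φ
  have g0 := mul_le_mul_of_nonneg_left h3 hp
  have g1 := mul_le_mul_of_nonneg_left ((le_abs_self _).trans h5) (by positivity : 0 ≤ 2 * r)
  have g2 := mul_le_mul_of_nonneg_left ((le_abs_self _).trans h2) hn
  have q1 : 0 ≤ n * (4 * d * M * (2 * M * (d + 1) + d) * √ε * (‖φ‖ ^ 2 + kin ε R φ)) := by
    positivity
  have q2 : 0 ≤ r * (4 * d * M * (3 * M * (2 * M * (d + 1) + d) + 2 * d * M ^ 2 +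
        (2 * M ^ 2 * (3 * d + 2 * d ^ 2 + 1) + d * M)) * √ε * (‖φ‖ ^ 2 + kin ε R φ)) := by
    positivity
  rw [radBound]
  linarith

/-- The kinetic energy `(1 - R)/ε` evolves like `-R/ε`, whence the prefactor. The noise heats it by
the variance of the gradients, and by the double commutator identity the remaining difference of
`resCommSq` terms is a Jensen gap that lowers the energy. -/
theorem IsMultiplierFamily.neg_genForm_resolvent_le {M : ℝ}
    (hF : IsMultiplierFamily S P M F F' Fs Fs') (hR : IsResolvent P ε R N)
    (hP : IsLinearGraph P) (hS : IsSymmAlgebra S) {p r n : ℝ} (hn : 0 ≤ n) (φ : H) :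
    -(1 / ε) * genForm p r n (yosida ε R) F Fs 1 R φ ≤
      -2 * r * ∑ k, (⟪F' k (R φ), N k φ⟫_ℂ).im +
        n * ((1 / (m : ℝ)) * ∑ j, ∑ k, ‖Fs' j k (R φ)‖ ^ 2) := by
  have hε := hR.pos
  have h1 : (⟪(1 : H →L[ℂ] H) φ, yosida ε R φ⟫_ℂ).im = 0 := by
    rw [one_apply_eq_self, hR.inner_eq_kin, Complex.ofReal_im]
  have h2 : (⟪R φ, F φ⟫_ℂ).im = ε * ∑ k, (⟪F' k (R φ), N k φ⟫_ℂ).im := by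
    rw [← hS.symm F hF.mult.mem]
    nth_rewrite 2 [hR.eq_add φ]
    rw [inner_add_right, inner_smul_right, Complex.add_im, Complex.im_ofReal_mul,
      hR.inner_yosida _ _ _ (hF.mult.map _ _ (hR.mem φ)), Complex.im_sum]
    have e : ∀ x, (⟪F x, x⟫_ℂ).im = 0 := fun x => by
      have e := hS.symm F hF.mult.mem x x
      have := im_inner_comm (F x) x
      rw [← e] at this
      linarith
    rw [e, zero_add]
    congr 1
    exact Finset.sum_congr rfl fun k _ => by rw [inner_add_left, Complex.add_im, e, zero_add]
  have h3 := hR.dcomm_resolvent hP hS hF.mult φ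
  have h4 : (1 / (m : ℝ)) * ∑ j, dcomm R (Fs j) φ =
      ε * ((1 / (m : ℝ)) * ∑ j, ∑ k, ‖Fs' j k (R φ)‖ ^ 2) -
        (1 / (m : ℝ)) * ∑ j, resCommSq ε R (Fs j) N (Fs' j) φ := by
    rw [Finset.sum_congr rfl fun j _ => hR.dcomm_resolvent hP hS (hF.mults j) φ,
      Finset.sum_sub_distrib, ← Finset.mul_sum]
    ring
  have h5 := hF.resCommSq_le hε.le R N φ
  have h6 : 0 ≤ ∑ k, ‖F' k (R φ)‖ ^ 2 := Finset.sum_nonneg fun _ _ => sq_nonneg _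
  rw [genForm, h1, h2, h3, h4]
  set a := (1 / (m : ℝ)) * ∑ j, ∑ k, ‖Fs' j k (R φ)‖ ^ 2
  set b := (1 / (m : ℝ)) * ∑ j, resCommSq ε R (Fs j) N (Fs' j) φ
  set s := ∑ k, (⟪F' k (R φ), N k φ⟫_ℂ).im
  -- The last bracket collects what may be dropped: the squared mean gradient and the Jensen gap
  -- divided by `ε`.
  have h7 : -(1 / ε) * (p * 0 + 2 * r * (ε * s) +
      n * (ε * ∑ k, ‖F' k (R φ)‖ ^ 2 - resCommSq ε R F N F' φ - (ε * a - b))) =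
      -2 * r * s + n * a - n * (∑ k, ‖F' k (R φ)‖ ^ 2 + (b - resCommSq ε R F N F' φ) / ε) := by
    field_simp
    ring
  rw [h7]
  have h8 : 0 ≤ (b - resCommSq ε R F N F' φ) / ε := div_nonneg (by linarith) hε.le
  have h9 := mul_nonneg hn (add_nonneg h6 h8)
  linarith

/-- The derivative of the Lyapunov function along a pure state. -/
theorem IsMultiplierFamily.lyapunov_deriv_le {M : ℝ}
    (hF : IsMultiplierFamily S P M F F' Fs Fs') (hR : IsResolvent P ε R N)
    (hP : IsLinearGraph P) (hS : IsSymmAlgebra S) (hV : IsVirial P Y) (hY : ∀ k, Y k ∈ S)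
    (hYb : ∀ k x, ‖Y k x‖ ≤ M * ‖x‖) {Q X : H →L[ℂ] H}
    (hQ : IsMultiplier S P Q (fun k => (2 : ℂ) • Y k)) (hQb : ∀ x, ‖Q x‖ ≤ M * ‖x‖)
    (hX : IsMultiplier S P X F') (hXb : ∀ x, ‖X x‖ ≤ M * ‖x‖)
    (hconv : ∀ x, (⟪x, X x⟫_ℂ).re ≤ (⟪x, (∑ k, Y k * F' k : H →L[ℂ] H) x⟫_ℂ).re)
    {L : ℝ} (hL : ∀ j x, ∑ k, ‖Fs' j k x‖ ^ 2 ≤ L * ‖x‖ ^ 2)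
    {b θ η : ℝ} (hb : 0 < b) (hθ : 0 < θ) (hη : 0 < η) (φ : H) :
    (1 / 2) * genForm (θ / b ^ 2) (b / θ) (η * b ^ 2 / θ ^ 2) (yosida ε R) F Fs (Q * R)
        (R * (Q * R)) φ +
      θ / (2 * b) * genForm (θ / b ^ 2) (b / θ) (η * b ^ 2 / θ ^ 2) (yosida ε R) F Fs
        (radOp Y R N) (R * radOp Y R N) φ +
      θ ^ 2 / (2 * b ^ 2) * (-(1 / ε) * genForm (θ / b ^ 2) (b / θ) (η * b ^ 2 / θ ^ 2)
        (yosida ε R) F Fs 1 R φ) +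
      b * genForm (θ / b ^ 2) (b / θ) (η * b ^ 2 / θ ^ 2) (yosida ε R) F Fs (X * R)
        (R * (X * R)) φ -
      θ / (2 * b ^ 2) * (⟪φ, (R * radOp Y R N) φ⟫_ℂ).re - θ ^ 2 / b ^ 3 * kin ε R φ +
      (⟪φ, (R * (X * R)) φ⟫_ℂ).re ≤
    η / 2 * L * ‖φ‖ ^ 2 + ((1 / 2 + b) * (b / θ + η * b ^ 2 / θ ^ 2) *
      (4 * d * M ^ 2 + 16 * d * M ^ 3) + θ / (2 * b) * (b / θ + η * b ^ 2 / θ ^ 2) * radBound d M) *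
        √ε * (‖φ‖ ^ 2 + kin ε R φ) := by
  have hp : 0 < θ / b ^ 2 := by positivity
  have hr : 0 < b / θ := by positivity
  have hn : 0 < η * b ^ 2 / θ ^ 2 := by positivity
  have t1 := (abs_le.1 (hF.abs_genForm_mul_sub_le hR hP hS hQ hQb (p := θ / b ^ 2) hr.le hn.le φ)).2
  have t2 := hF.genForm_rad_le hR hP hS hV hY hYb hp.le hr.le hn.le φ
  have t3 := hF.neg_genForm_resolvent_le hR hP hS (p := θ / b ^ 2) (r := b / θ) hn.le φ
  have t4 := (abs_le.1 (hF.abs_genForm_mul_sub_le hR hP hS hX hXb (p := θ / b ^ 2) hr.le hn.le φ)).2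
  have e1 : (⟪φ, (R * radOp Y R N) φ⟫_ℂ).re =
      ∑ k, (⟪((2 : ℂ) • Y k) (R φ), N k φ⟫_ℂ).im := by
    rw [mul_apply_eq_comp, ← hR.symm, radOp_apply, re_inner_neg_I_smul, rad, inner_add_right,
      inner_smul_right, inner_smul_right, Complex.add_im, inner_sum, inner_self_eq_ofReal]
    have e2 : ((d : ℂ) * ((‖R φ‖ ^ 2 : ℝ) : ℂ)).im = 0 := by
      rw [← Complex.ofReal_natCast, ← Complex.ofReal_mul, Complex.ofReal_im]
    rw [e2, add_zero, Finset.mul_sum, Complex.im_sum]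
    refine Finset.sum_congr rfl fun k _ => ?_
    rw [smul_apply, inner_smul_left, hS.symm _ (hY k)]
    simp
  have e2 : (⟪φ, (R * (X * R)) φ⟫_ℂ).re = (⟪R φ, X (R φ)⟫_ℂ).re := by
    rw [mul_apply_eq_comp, mul_apply_eq_comp, ← hR.symm]
  have hc := hconv (R φ)
  have hk := hR.gradSq_le_kin φ
  have hm' : (0 : ℝ) < m := by exact_mod_cast hF.pos
  have hL2 : (1 / (m : ℝ)) * ∑ j, ∑ k, ‖Fs' j k (R φ)‖ ^ 2 ≤ L * ‖φ‖ ^ 2 := by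
    rw [div_mul_eq_mul_div, one_mul, div_le_iff₀ hm']
    have hL0 : ∀ j, ∑ k, ‖Fs' j k (R φ)‖ ^ 2 ≤ L * ‖φ‖ ^ 2 := by
      intro j
      -- The sign of `L` is not given. It follows from `hL` at a nonzero vector, and for `R φ = 0`
      -- the left side vanishes.
      by_cases hφ : ‖R φ‖ = 0
      · have : ∑ k, ‖Fs' j k (R φ)‖ ^ 2 = 0 := by
          rw [norm_eq_zero.1 hφ]; simp
        rw [this]
        by_cases h0 : ‖φ‖ = 0
        · simp [h0]
        · have := (Finset.sum_nonneg fun k _ => sq_nonneg ‖Fs' j k φ‖).trans (hL j φ)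
          exact this
      · refine (hL j (R φ)).trans ?_
        have h1 := (Finset.sum_nonneg fun k _ => sq_nonneg ‖Fs' j k (R φ)‖).trans (hL j (R φ))
        have h2 : 0 < ‖R φ‖ ^ 2 := by positivity
        have h3 : 0 ≤ L := by
          by_contra h
          nlinarith [mul_pos (neg_pos.2 (not_le.1 h)) h2]
        exact mul_le_mul_of_nonneg_left
          (pow_le_pow_left₀ (norm_nonneg _) (hR.norm_le φ) 2) h3
    refine (Finset.sum_le_sum fun j _ => hL0 j).trans (le_of_eq ?_)
    simp; ring
  rw [e1, e2]
  set A := ∑ k, (⟪((2 : ℂ) • Y k) (R φ), N k φ⟫_ℂ).im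
  set s := ∑ k, (⟪F' k (R φ), N k φ⟫_ℂ).im
  set x1 := genForm (θ / b ^ 2) (b / θ) (η * b ^ 2 / θ ^ 2) (yosida ε R) F Fs (Q * R)
        (R * (Q * R)) φ
  set x2 := genForm (θ / b ^ 2) (b / θ) (η * b ^ 2 / θ ^ 2) (yosida ε R) F Fs
        (radOp Y R N) (R * radOp Y R N) φ
  set x3 := -(1 / ε) * genForm (θ / b ^ 2) (b / θ) (η * b ^ 2 / θ ^ 2) (yosida ε R) F Fs 1 R φ
  set x4 := genForm (θ / b ^ 2) (b / θ) (η * b ^ 2 / θ ^ 2) (yosida ε R) F Fs (X * R)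
        (R * (X * R)) φ
  set v := (⟪R φ, (∑ k, Y k * F' k : H →L[ℂ] H) (R φ)⟫_ℂ).re
  set ξ := (⟪R φ, X (R φ)⟫_ℂ).re
  set q := gradSq N φ
  set κ := kin ε R φ
  set a := (1 / (m : ℝ)) * ∑ j, ∑ k, ‖Fs' j k (R φ)‖ ^ 2
  have u1 : 1 / 2 * x1 ≤ 1 / 2 * (θ / b ^ 2 * A + (b / θ + η * b ^ 2 / θ ^ 2) *
      (4 * d * M ^ 2 + 16 * d * M ^ 3) * √ε * (‖φ‖ ^ 2 + κ)) := by
    apply mul_le_mul_of_nonneg_left _ (by norm_num); linarith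
  have u2 : θ / (2 * b) * x2 ≤ θ / (2 * b) * (2 * (θ / b ^ 2) * q - 2 * (b / θ) * v +
      (b / θ + η * b ^ 2 / θ ^ 2) * radBound d M * √ε * (‖φ‖ ^ 2 + κ)) :=
    mul_le_mul_of_nonneg_left t2 (by positivity)
  have u3 : θ ^ 2 / (2 * b ^ 2) * x3 ≤ θ ^ 2 / (2 * b ^ 2) *
      (-2 * (b / θ) * s + η * b ^ 2 / θ ^ 2 * (L * ‖φ‖ ^ 2)) :=
    mul_le_mul_of_nonneg_left (t3.trans (add_le_add le_rfl
      (mul_le_mul_of_nonneg_left hL2 hn.le))) (by positivity)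
  have u4 : b * x4 ≤ b * (θ / b ^ 2 * s + (b / θ + η * b ^ 2 / θ ^ 2) *
      (4 * d * M ^ 2 + 16 * d * M ^ 3) * √ε * (‖φ‖ ^ 2 + κ)) := by
    apply mul_le_mul_of_nonneg_left _ hb.le; linarith
  -- The cancellations: `v1` against the derivative of `θ²/(2b²)`, `v3` against `v5`, and `v6`
  -- against the derivative of `θ/(2b)`. By `v2` the force leaves `-⟨y·∇f⟩`, which beats the `⟨X⟩`
  -- coming from `b' = 1`; `v4` is the only growth that stays as `ε → 0`.
  have v1 : θ / (2 * b) * (2 * (θ / b ^ 2) * q) = θ ^ 2 / b ^ 3 * q := by field_simp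
  have v2 : θ / (2 * b) * (2 * (b / θ) * v) = v := by field_simp
  have v3 : θ ^ 2 / (2 * b ^ 2) * (-2 * (b / θ) * s) = -(θ / b) * s := by field_simp
  have v4 : θ ^ 2 / (2 * b ^ 2) * (η * b ^ 2 / θ ^ 2 * (L * ‖φ‖ ^ 2)) = η / 2 * L * ‖φ‖ ^ 2 := by
    field_simp
  have v5 : b * (θ / b ^ 2 * s) = θ / b * s := by field_simp
  have v6 : 1 / 2 * (θ / b ^ 2 * A) = θ / (2 * b ^ 2) * A := by field_simp
  have v7 : θ ^ 2 / b ^ 3 * q ≤ θ ^ 2 / b ^ 3 * κ := mul_le_mul_of_nonneg_left hk (by positivity)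
  rw [mul_add, v6] at u1
  rw [mul_add, mul_sub, v1, v2] at u2
  rw [mul_add, v3, v4] at u3
  rw [mul_add, v5] at u4
  linarith

/-- The kinetic energy is controlled by the Lyapunov function. -/
theorem IsResolvent.kin_le_lyapunov (hR : IsResolvent P ε R N) (hS : IsSymmAlgebra S)
    (hY : ∀ k, Y k ∈ S) {Q : H →L[ℂ] H} (hQ : Q = ∑ k, Y k * Y k) {M : ℝ}
    (hQb : ∀ x, ‖Q x‖ ≤ M * ‖x‖) (hM : 0 ≤ M) (c : ℝ) (φ : H) :
    c ^ 2 * kin ε R φ ≤ 2 * M * ‖φ‖ ^ 2 +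
        4 * (1 / 2 * (⟪φ, (R * (Q * R)) φ⟫_ℂ).re + c / 2 * (⟪φ, (R * radOp Y R N) φ⟫_ℂ).re +
        c ^ 2 / 2 * kin ε R φ) ∧
    0 ≤ 1 / 2 * (⟪φ, (R * (Q * R)) φ⟫_ℂ).re + c / 2 * (⟪φ, (R * radOp Y R N) φ⟫_ℂ).re +
        c ^ 2 / 2 * kin ε R φ ∧
    |(⟪φ, (R * (Q * R)) φ⟫_ℂ).re| ≤ M * ‖φ‖ ^ 2 ∧
    |(⟪φ, (R * radOp Y R N) φ⟫_ℂ).re| ≤ M * ‖φ‖ ^ 2 + kin ε R φ := by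
  have e1 : (⟪φ, (R * (Q * R)) φ⟫_ℂ).re = ∑ k, ‖Y k (R φ)‖ ^ 2 := by
    rw [mul_apply_eq_comp, mul_apply_eq_comp, ← hR.symm, hQ, sum_apply, inner_sum, Complex.re_sum]
    refine Finset.sum_congr rfl fun k _ => ?_
    rw [mul_apply_eq_comp, ← hS.symm _ (hY k), inner_self_eq_ofReal, Complex.ofReal_re]
  have e2 : (⟪φ, (R * radOp Y R N) φ⟫_ℂ).re = ∑ k, 2 * (⟪Y k (R φ), N k φ⟫_ℂ).im := by
    rw [mul_apply_eq_comp, ← hR.symm, radOp_apply, re_inner_neg_I_smul, rad, inner_add_right,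
      inner_smul_right, inner_smul_right, Complex.add_im, inner_sum, inner_self_eq_ofReal]
    have e2 : ((d : ℂ) * ((‖R φ‖ ^ 2 : ℝ) : ℂ)).im = 0 := by
      rw [← Complex.ofReal_natCast, ← Complex.ofReal_mul, Complex.ofReal_im]
    rw [e2, add_zero, Finset.mul_sum, Complex.im_sum]
    refine Finset.sum_congr rfl fun k _ => ?_
    rw [hS.symm _ (hY k)]
    simp
  have hk := hR.gradSq_le_kin φ
  have hq : gradSq N φ = ∑ k, ‖N k φ‖ ^ 2 := rfl
  have hQφ : |(⟪φ, (R * (Q * R)) φ⟫_ℂ).re| ≤ M * ‖φ‖ ^ 2 := by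
    rw [mul_apply_eq_comp, mul_apply_eq_comp, ← hR.symm]
    refine (abs_re_inner_le _ _).trans ?_
    calc ‖R φ‖ * ‖Q (R φ)‖ ≤ ‖φ‖ * (M * ‖φ‖) :=
          mul_le_mul (hR.norm_le φ) ((hQb _).trans (mul_le_mul_of_nonneg_left (hR.norm_le φ) hM))
            (norm_nonneg _) (norm_nonneg _)
      _ = _ := by ring
  have hab : ∀ k, |2 * (⟪Y k (R φ), N k φ⟫_ℂ).im| ≤ 2 * (‖Y k (R φ)‖ * ‖N k φ‖) := fun k => by
    rw [abs_mul, abs_two]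
    exact mul_le_mul_of_nonneg_left (abs_im_inner_le _ _) (by norm_num)
  have h1 : |∑ k, 2 * (⟪Y k (R φ), N k φ⟫_ℂ).im| ≤ ∑ k, ‖Y k (R φ)‖ ^ 2 + ∑ k, ‖N k φ‖ ^ 2 := by
    rw [← Finset.sum_add_distrib]
    refine (Finset.abs_sum_le_sum_abs _ _).trans (Finset.sum_le_sum fun k _ => (hab k).trans ?_)
    nlinarith [sq_nonneg (‖Y k (R φ)‖ - ‖N k φ‖)]
  have k1 : |c * ∑ k, 2 * (⟪Y k (R φ), N k φ⟫_ℂ).im| ≤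
      ∑ k, ‖Y k (R φ)‖ ^ 2 + c ^ 2 * ∑ k, ‖N k φ‖ ^ 2 := by
    rw [Finset.mul_sum, Finset.mul_sum, ← Finset.sum_add_distrib]
    refine (Finset.abs_sum_le_sum_abs _ _).trans (Finset.sum_le_sum fun k _ => ?_)
    rw [abs_mul]
    have h2 := mul_le_mul_of_nonneg_left (hab k) (abs_nonneg c)
    have h3 := sq_nonneg (‖Y k (R φ)‖ - |c| * ‖N k φ‖)
    have h4 : |c| ^ 2 = c ^ 2 := sq_abs c
    nlinarith
  -- While `k1` gives `|y + cp|² ≥ 0`, this weighting amounts to `c²|p|² ≤ 2|y + cp|² + 2|y|²`.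
  have k2 : 2 * |c * ∑ k, 2 * (⟪Y k (R φ), N k φ⟫_ℂ).im| ≤
      4 * ∑ k, ‖Y k (R φ)‖ ^ 2 + c ^ 2 * ∑ k, ‖N k φ‖ ^ 2 := by
    rw [Finset.mul_sum, Finset.mul_sum, Finset.mul_sum, ← Finset.sum_add_distrib]
    refine (mul_le_mul_of_nonneg_left (Finset.abs_sum_le_sum_abs _ _) zero_le_two).trans ?_
    rw [Finset.mul_sum]
    refine Finset.sum_le_sum fun k _ => ?_
    rw [abs_mul]
    have h2 := mul_le_mul_of_nonneg_left (hab k) (abs_nonneg c)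
    have h3 := sq_nonneg (2 * ‖Y k (R φ)‖ - |c| * ‖N k φ‖)
    have h4 : |c| ^ 2 = c ^ 2 := sq_abs c
    nlinarith
  have l1 := neg_abs_le (c * ∑ k, 2 * (⟪Y k (R φ), N k φ⟫_ℂ).im)
  have l2 := mul_le_mul_of_nonneg_left hk (sq_nonneg c)
  rw [e1] at hQφ
  have hQ1 := (le_abs_self _).trans hQφ
  rw [e1, e2]
  rw [hq] at l2 hk
  refine ⟨by nlinarith, by nlinarith, hQφ, h1.trans (by linarith)⟩

end PureStateEvolution

/-! ### Multiplication operators, `H¹₀` and the resolvent on the cube. -/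

section Concrete

open scoped InnerProductSpace

variable {d : ℕ}

/-! ### The cube -/

theorem cube_eq_preimage : cube d = (EuclideanSpace.equiv (Fin d) ℝ) ⁻¹'
    (Set.univ.pi fun _ => Icc (-1 : ℝ) 1) := by
  ext x
  simp only [cube, Set.mem_ofPred_eq, mem_preimage, Set.mem_pi, mem_univ, true_imp_iff]
  rfl

theorem isCompact_cube : IsCompact (cube d) := by
  rw [cube_eq_preimage]
  exact (EuclideanSpace.equiv (Fin d) ℝ).toHomeomorph.isCompact_preimage.2
    (isCompact_univ_pi fun _ => isCompact_Icc)

theorem measurableSet_cube : MeasurableSet (cube d) := isCompact_cube.isClosed.measurableSet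

theorem convex_cube : Convex ℝ (cube d) := by
  intro x hx y hy a b ha hb hab j
  have := convex_Icc (-1 : ℝ) 1 (hx j) (hy j) ha hb hab
  simpa using this

instance : IsFiniteMeasure (cubeMeasure d) :=
  ⟨by rw [Measure.restrict_apply_univ]; exact isCompact_cube.measure_lt_top⟩

theorem ae_mem_cube : ∀ᵐ x ∂(cubeMeasure d), x ∈ cube d := ae_restrict_mem measurableSet_cube

/-! ### Multiplication operators -/

theorem memLp_top_of_continuousOn {g : E d → ℝ} (hg : ContinuousOn g (cube d)) :
    MemLp (fun x => (g x : ℂ)) ⊤ (cubeMeasure d) := by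
  obtain ⟨C, hC⟩ := isCompact_cube.exists_bound_of_continuousOn hg
  refine memLp_top_of_bound ?_ C ?_
  · exact (Complex.continuous_ofReal.comp_continuousOn hg).aestronglyMeasurable measurableSet_cube
  · filter_upwards [ae_mem_cube] with x hx
    simpa using hC x hx

theorem mulOp_ae {g : E d → ℝ} (hg : ContinuousOn g (cube d)) (φ : Hilb d) :
    mulOp g φ =ᵐ[cubeMeasure d] fun x => (g x : ℂ) * φ x :=
  mulOp_apply_ae (memLp_top_of_continuousOn hg) φ

theorem mulOp_mul {g h : E d → ℝ} (hg : ContinuousOn g (cube d)) (hh : ContinuousOn h (cube d)) :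
    mulOp g * mulOp h = mulOp (fun x => g x * h x) := by
  ext1 φ
  refine Lp.ext ?_
  filter_upwards [mulOp_ae hg (mulOp h φ), mulOp_ae hh φ,
    mulOp_ae (g := fun x => g x * h x) (hg.mul hh) φ] with x h1 h2 h3
  rw [mul_apply_eq_comp, h1, h2, h3]
  push_cast
  ring

theorem mulOp_add {g h : E d → ℝ} (hg : ContinuousOn g (cube d)) (hh : ContinuousOn h (cube d)) :
    mulOp g + mulOp h = mulOp (fun x => g x + h x) := by
  ext1 φ
  refine Lp.ext ?_
  filter_upwards [mulOp_ae hg φ, mulOp_ae hh φ,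
    mulOp_ae (g := fun x => g x + h x) (hg.add hh) φ, Lp.coeFn_add (mulOp g φ) (mulOp h φ)] with x h1 h2 h3 h4
  rw [add_apply, h4, Pi.add_apply, h1, h2, h3]
  push_cast
  ring

theorem mulOp_smul {g : E d → ℝ} (hg : ContinuousOn g (cube d)) (c : ℝ) :
    (c : ℂ) • mulOp g = mulOp (fun x => c * g x) := by
  ext1 φ
  refine Lp.ext ?_
  filter_upwards [mulOp_ae hg φ, mulOp_ae (g := fun x => c * g x)
    (continuousOn_const.mul hg) φ, Lp.coeFn_smul (c : ℂ) (mulOp g φ)] with x h1 h2 h3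
  rw [smul_apply, h3, h2, Pi.smul_apply, h1]
  push_cast
  rw [smul_eq_mul, mul_assoc]

theorem mulOp_zero : mulOp (fun _ : E d => (0 : ℝ)) = 0 := by
  have := mulOp_smul (g := fun _ : E d => (0 : ℝ)) continuousOn_const 0
  rw [Complex.ofReal_zero, zero_smul] at this
  simpa using this.symm

theorem mulOp_const (c : ℝ) : mulOp (fun _ : E d => c) = (c : ℂ) • 1 := by
  ext1 φ
  refine Lp.ext ?_
  filter_upwards [mulOp_ae (g := fun _ : E d => c) continuousOn_const φ,
    Lp.coeFn_smul (c : ℂ) φ] with x h1 h2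
  rw [h1]
  refine Eq.trans ?_ h2.symm
  simp

theorem mulOp_sum {ι : Type*} (s : Finset ι) {g : ι → E d → ℝ}
    (hg : ∀ i, ContinuousOn (g i) (cube d)) :
    ∑ i ∈ s, mulOp (g i) = mulOp (fun x => ∑ i ∈ s, g i x) := by
  classical
  induction s using Finset.induction_on with
  | empty => simp [mulOp_zero]
  | insert a s ha ih =>
    rw [Finset.sum_insert ha, ih, mulOp_add (hg a) (continuousOn_finsetSum s fun i _ => hg i)]
    simp only [Finset.sum_insert ha]

theorem norm_mulOp_le {g : E d → ℝ} (hg : ContinuousOn g (cube d)) {C : ℝ}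
    (hC : ∀ x ∈ cube d, |g x| ≤ C) (φ : Hilb d) : ‖mulOp g φ‖ ≤ C * ‖φ‖ := by
  refine Lp.norm_le_mul_norm_of_ae_le_mul ?_
  filter_upwards [mulOp_ae hg φ, ae_mem_cube] with x h1 hx
  rw [h1, norm_mul, Complex.norm_real]
  exact mul_le_mul_of_nonneg_right (hC x hx) (norm_nonneg _)

theorem inner_mulOp {g : E d → ℝ} (hg : ContinuousOn g (cube d)) (φ ψ : Hilb d) :
    ⟪mulOp g φ, ψ⟫_ℂ = ⟪φ, mulOp g ψ⟫_ℂ := by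
  rw [L2.inner_def, L2.inner_def]
  refine integral_congr_ae ?_
  filter_upwards [mulOp_ae hg φ, mulOp_ae hg ψ] with x h1 h2
  rw [h1, h2]
  simp only [RCLike.inner_apply, map_mul, Complex.conj_ofReal]
  ring

theorem re_inner_mulOp_le {g h : E d → ℝ} (hg : ContinuousOn g (cube d))
    (hh : ContinuousOn h (cube d)) (hgh : ∀ x ∈ cube d, g x ≤ h x) (φ : Hilb d) :
    (⟪φ, mulOp g φ⟫_ℂ).re ≤ (⟪φ, mulOp h φ⟫_ℂ).re := by
  have e : ∀ k : E d → ℝ, ContinuousOn k (cube d) → (⟪φ, mulOp k φ⟫_ℂ).re =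
      ∫ x in cube d, (⟪φ x, mulOp k φ x⟫_ℂ).re := by
    intro k hk
    rw [L2.inner_def]
    exact (integral_re (L2.integrable_inner (𝕜 := ℂ) φ (mulOp k φ))).symm
  rw [e g hg, e h hh]
  refine integral_mono_ae (L2.integrable_inner (𝕜 := ℂ) φ (mulOp g φ)).re
    (L2.integrable_inner (𝕜 := ℂ) φ (mulOp h φ)).re ?_
  filter_upwards [mulOp_ae hg φ, mulOp_ae hh φ, ae_mem_cube] with x h1 h2 hx
  have h3 : ∀ c : ℝ, (⟪φ x, (c : ℂ) * φ x⟫_ℂ).re = c * ‖φ x‖ ^ 2 := by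
    intro c
    rw [RCLike.inner_apply, mul_assoc, Complex.mul_conj, Complex.normSq_eq_norm_sq,
      ← Complex.ofReal_mul, Complex.ofReal_re]
  change (⟪φ x, mulOp g φ x⟫_ℂ).re ≤ (⟪φ x, mulOp h φ x⟫_ℂ).re
  rw [h1, h2, h3, h3]
  exact mul_le_mul_of_nonneg_right (hgh x hx) (sq_nonneg _)

variable (d) in
/-- The multiplication operators with continuous functions. -/
def mulOps : Set (Hilb d →L[ℂ] Hilb d) := {A | ∃ g, ContinuousOn g (cube d) ∧ A = mulOp g}

theorem isSymmAlgebra_mulOps : IsSymmAlgebra (mulOps d) where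
  symm := by
    rintro _ ⟨g, hg, rfl⟩ x y
    exact inner_mulOp hg x y
  comm := by
    rintro _ ⟨g, hg, rfl⟩ _ ⟨h, hh, rfl⟩ x
    rw [← mul_apply_eq_comp, ← mul_apply_eq_comp, mulOp_mul hg hh, mulOp_mul hh hg]
    simp only [mul_comm]
  add := by
    rintro _ ⟨g, hg, rfl⟩ _ ⟨h, hh, rfl⟩
    exact ⟨_, hg.add hh, mulOp_add hg hh⟩
  mul := by
    rintro _ ⟨g, hg, rfl⟩ _ ⟨h, hh, rfl⟩
    exact ⟨_, hg.mul hh, mulOp_mul hg hh⟩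
  zero := ⟨_, continuousOn_const, mulOp_zero.symm⟩

/-! ### Test functions and the graph of the gradient -/

theorem IsTest.memLp {η : E d → ℂ} (h : IsTest η) : MemLp η 2 (cubeMeasure d) :=
  h.smooth.continuous.memLp_of_hasCompactSupport h.compact

theorem IsTest.continuous_testPd {η : E d → ℂ} (h : IsTest η) (j : Fin d) :
    Continuous (testPd j η) :=
  (h.smooth.continuous_fderiv (by simp)).clm_apply continuous_const

theorem IsTest.hasCompactSupport_testPd {η : E d → ℂ} (h : IsTest η) (j : Fin d) :
    HasCompactSupport (testPd j η) :=
  h.compact.fderiv_apply (𝕜 := ℝ) (unitVec j)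

theorem IsTest.memLp_testPd {η : E d → ℂ} (h : IsTest η) (j : Fin d) :
    MemLp (testPd j η) 2 (cubeMeasure d) :=
  (h.continuous_testPd j).memLp_of_hasCompactSupport (h.hasCompactSupport_testPd j)

variable (d) in
/-- The test functions with their gradients, as elements of `L²`. -/
def testPairs : Set (Hilb d × (Fin d → Hilb d)) :=
  {p | ∃ η, IsTest η ∧ p.1 =ᵐ[cubeMeasure d] η ∧ ∀ j, p.2 j =ᵐ[cubeMeasure d] testPd j η}

theorem IsTest.mem_testPairs {η : E d → ℂ} (h : IsTest η) :
    (h.memLp.toLp η, fun j => (h.memLp_testPd j).toLp (testPd j η)) ∈ testPairs d :=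
  ⟨η, h, h.memLp.coeFn_toLp, fun j => (h.memLp_testPd j).coeFn_toLp⟩

theorem tendsto_iff_eLpNorm_of_ae_eq {f : ℕ → Hilb d} {F : ℕ → E d → ℂ} {g : Hilb d}
    (h : ∀ n, f n =ᵐ[cubeMeasure d] F n) :
    Tendsto f atTop (𝓝 g) ↔
      Tendsto (fun n => eLpNorm (fun x => F n x - g x) 2 (cubeMeasure d)) atTop (𝓝 0) := by
  rw [Lp.tendsto_Lp_iff_tendsto_eLpNorm']
  refine tendsto_congr fun n => eLpNorm_congr_ae ?_
  filter_upwards [h n] with x hx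
  rw [Pi.sub_apply, hx]

/-- As a closure in `L² × (L²)^d`, the graph of the gradient inherits linearity and the product rule
from test functions by continuity. -/
theorem hasGradH10_iff {φ : Hilb d} {G : Fin d → Hilb d} :
    HasGradH10 φ G ↔ (φ, G) ∈ closure (testPairs d) := by
  rw [mem_closure_iff_seq_limit]
  constructor
  · rintro ⟨η, hη, h1, h2⟩
    refine ⟨fun n => _, fun n => (hη n).mem_testPairs, ?_⟩
    rw [Prod.tendsto_iff, tendsto_pi_nhds]
    exact ⟨(tendsto_iff_eLpNorm_of_ae_eq fun n => (hη n).memLp.coeFn_toLp).2 h1,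
      fun j => (tendsto_iff_eLpNorm_of_ae_eq fun n => ((hη n).memLp_testPd j).coeFn_toLp).2 (h2 j)⟩
  · rintro ⟨p, hp, hlim⟩
    rw [Prod.tendsto_iff, tendsto_pi_nhds] at hlim
    choose η hη h1 h2 using hp
    exact ⟨η, hη, (tendsto_iff_eLpNorm_of_ae_eq h1).1 hlim.1,
      fun j => (tendsto_iff_eLpNorm_of_ae_eq fun n => h2 n j).1 (hlim.2 j)⟩

theorem IsTest.add {η ζ : E d → ℂ} (h : IsTest η) (h' : IsTest ζ) : IsTest (η + ζ) where
  smooth := h.smooth.add h'.smooth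
  compact := h.compact.add h'.compact
  support := (tsupport_add η ζ).trans (union_subset h.support h'.support)

theorem IsTest.const_smul {η : E d → ℂ} (h : IsTest η) (c : ℂ) : IsTest (c • η) where
  smooth := contDiff_const.smul h.smooth
  compact := h.compact.smul_left (f := fun _ => c)
  support := (tsupport_smul_subset_right (fun _ => c) η).trans h.support

theorem IsTest.differentiableAt {η : E d → ℂ} (h : IsTest η) (x : E d) :
    DifferentiableAt ℝ η x := (h.smooth.differentiable (by simp)).differentiableAt

theorem isLinearGraph_hasGradH10 : IsLinearGraph (H := Hilb d) HasGradH10 where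
  add := by
    intro v W v' W' h h'
    rw [hasGradH10_iff] at *
    have := map_mem_closure₂ (f := fun p q : Hilb d × (Fin d → Hilb d) => p + q)
      (u := testPairs d) continuous_add h h' ?_
    · exact this
    rintro p ⟨η, hη, h1, h2⟩ q ⟨ζ, hζ, h3, h4⟩
    refine ⟨η + ζ, hη.add hζ, (Lp.coeFn_add p.1 q.1).trans (h1.add h3), fun j =>
      ((Lp.coeFn_add (p.2 j) (q.2 j)).trans ((h2 j).add (h4 j))).trans ?_⟩
    refine Eventually.of_forall fun x => ?_
    simp only [testPd, Pi.add_apply]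
    rw [fderiv_add (hη.differentiableAt x) (hζ.differentiableAt x)]
    rfl
  smul := by
    intro c v W h
    rw [hasGradH10_iff] at *
    have := map_mem_closure (f := fun p : Hilb d × (Fin d → Hilb d) => c • p)
      (t := testPairs d) (continuous_const_smul c) h ?_
    · exact this
    rintro p ⟨η, hη, h1, h2⟩
    refine ⟨c • η, hη.const_smul c, (Lp.coeFn_smul c p.1).trans (h1.const_smul c), fun j =>
      ((Lp.coeFn_smul c (p.2 j)).trans ((h2 j).const_smul c)).trans ?_⟩
    refine Eventually.of_forall fun x => ?_
    simp only [testPd, Pi.smul_apply]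
    rw [fderiv_const_smul (hη.differentiableAt x)]
    rfl

theorem hasGradH10_zero : HasGradH10 (0 : Hilb d) (fun _ => 0) := by
  have h : IsTest (fun _ : E d => (0 : ℂ)) :=
    ⟨contDiff_const, HasCompactSupport.zero, by
      rw [show (fun _ : E d => (0 : ℂ)) = 0 from rfl, tsupport_zero]; exact empty_subset _⟩
  have h1 := hasGradH10_iff.2 (subset_closure h.mem_testPairs)
  have := isLinearGraph_hasGradH10.smul 0 _ _ h1
  simpa only [zero_smul] using this

/-! ### The resolvent -/

/-- The graph of `√ε ∇` on `H¹₀`. -/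
def scaledGraph (d : ℕ) (ε : ℝ) : Submodule ℂ (PiLp 2 fun _ : Option (Fin d) => Hilb d) where
  carrier := {x | HasGradH10 (x none) (fun k => (((√ε)⁻¹ : ℝ) : ℂ) • x (some k))}
  add_mem' := by
    intro x y hx hy
    have := isLinearGraph_hasGradH10.add _ _ _ _ hx hy
    simpa only [Set.mem_ofPred_eq, PiLp.add_apply, smul_add] using this
  zero_mem' := by
    simpa only [Set.mem_ofPred_eq, PiLp.zero_apply, smul_zero] using hasGradH10_zero
  smul_mem' := by
    intro c x hx
    have := isLinearGraph_hasGradH10.smul c _ _ hx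
    simpa only [Set.mem_ofPred_eq, PiLp.smul_apply, smul_comm c] using this

theorem isClosed_scaledGraph (d : ℕ) (ε : ℝ) :
    IsClosed (scaledGraph d ε : Set (PiLp 2 fun _ : Option (Fin d) => Hilb d)) := by
  have hc : Continuous fun x : PiLp 2 fun _ : Option (Fin d) => Hilb d =>
      (x none, fun k : Fin d => (((√ε)⁻¹ : ℝ) : ℂ) • x (some k)) := by
    have h : ∀ i, Continuous fun x : PiLp 2 fun _ : Option (Fin d) => Hilb d => x i :=
      fun i => (PiLp.proj 2 (𝕜 := ℂ) (fun _ : Option (Fin d) => Hilb d) i).continuous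
    exact (h none).prodMk (continuous_pi fun k =>
      (continuous_const_smul (((√ε)⁻¹ : ℝ) : ℂ)).comp (h (some k)))
  have := (isClosed_closure (s := testPairs d)).preimage hc
  convert this using 1
  ext x
  exact hasGradH10_iff

/-- The orthogonal projection of `(φ, 0)` onto the closed graph of `√ε ∇` is `(Rφ, √ε ∇Rφ)`, and the
orthogonality of the remainder to the graph is the weak resolvent equation. -/
theorem exists_isResolvent (d : ℕ) {ε : ℝ} (hε : 0 < ε) :
    ∃ (R : Hilb d →L[ℂ] Hilb d) (N : Fin d → Hilb d →L[ℂ] Hilb d),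
      IsResolvent (H := Hilb d) HasGradH10 ε R N := by
  set K := scaledGraph d ε
  have : CompleteSpace K := (isClosed_scaledGraph d ε).completeSpace_coe
  let π := fun i => PiLp.proj 2 (𝕜 := ℂ) (fun _ : Option (Fin d) => Hilb d) i
  have hs : √ε ≠ 0 := (Real.sqrt_pos.2 hε).ne'
  have hss : (√ε : ℂ) * √ε = ε := by
    rw [← Complex.ofReal_mul, Real.mul_self_sqrt hε.le]
  let U := K.starProjection ∘L (ContinuousLinearMap.adjoint (π none))
  refine ⟨π none ∘L U, fun k => (((√ε)⁻¹ : ℝ) : ℂ) • (π (some k) ∘L U), hε, fun φ => ?_,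
    fun φ v W h => ?_⟩
  · exact K.starProjection_apply_mem (ContinuousLinearMap.adjoint (π none) φ)
  · let x : PiLp 2 fun _ : Option (Fin d) => Hilb d :=
      WithLp.toLp 2 (fun i => i.elim v fun k => (√ε : ℂ) • W k)
    have hx : x ∈ K := by
      change HasGradH10 v (fun k => (((√ε)⁻¹ : ℝ) : ℂ) • ((√ε : ℂ) • W k))
      have e : (fun k => (((√ε)⁻¹ : ℝ) : ℂ) • ((√ε : ℂ) • W k)) = W := by
        funext k
        rw [smul_smul, ← Complex.ofReal_mul, inv_mul_cancel₀ hs, Complex.ofReal_one, one_smul]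
      rwa [e]
    have h1 : ⟪x, ContinuousLinearMap.adjoint (π none) φ⟫_ℂ = ⟪v, φ⟫_ℂ :=
      ContinuousLinearMap.adjoint_inner_right _ _ _
    have h2 := K.starProjection_inner_eq_zero (ContinuousLinearMap.adjoint (π none) φ) x hx
    rw [inner_sub_left, sub_eq_zero, ← inner_conj_symm, h1,
      ← inner_conj_symm (K.starProjection _)] at h2
    have h3 := star_injective h2
    change ⟪v, φ⟫_ℂ = ⟪x, U φ⟫_ℂ at h3
    rw [h3, PiLp.inner_apply, Fintype.sum_option]
    refine congrArg₂ (· + ·) rfl ?_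
    rw [Finset.mul_sum]
    refine Finset.sum_congr rfl fun k _ => ?_
    change ⟪(√ε : ℂ) • W k, (U φ) (some k)⟫_ℂ =
      ε * ⟪W k, (((√ε)⁻¹ : ℝ) : ℂ) • (U φ) (some k)⟫_ℂ
    rw [inner_smul_left, inner_smul_right, Complex.conj_ofReal, ← mul_assoc, ← hss]
    congr 1
    rw [mul_assoc, ← Complex.ofReal_mul, mul_inv_cancel₀ hs, Complex.ofReal_one, mul_one]

/-! ### Consequences of the weak form of the Laplacian -/

theorem IsTest.conj {η : E d → ℂ} (h : IsTest η) : IsTest (fun x => starRingEnd ℂ (η x)) where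
  smooth := Complex.conjCLE.contDiff.comp h.smooth
  compact := h.compact.comp_left (g := starRingEnd ℂ) (map_zero _)
  support := (tsupport_comp_subset (g := starRingEnd ℂ) (map_zero _) η).trans h.support

theorem IsTest.testPd_conj {η : E d → ℂ} (h : IsTest η) (j : Fin d) (x : E d) :
    testPd j (fun x => starRingEnd ℂ (η x)) x = starRingEnd ℂ (testPd j η x) := by
  have h1 := (Complex.conjCLE.hasFDerivAt (x := η x)).comp x (h.differentiableAt x).hasFDerivAt
  have h2 : fderiv ℝ (fun x => starRingEnd ℂ (η x)) x = _ := h1.fderiv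
  rw [testPd, h2]
  rfl

theorem inner_eq_integral_of_ae_eq {p φ : Hilb d} {η : E d → ℂ} (h : p =ᵐ[cubeMeasure d] η) :
    ⟪p, φ⟫_ℂ = ∫ x in cube d, φ x * starRingEnd ℂ (η x) := by
  rw [L2.inner_def]
  refine integral_congr_ae ?_
  filter_upwards [h] with x hx
  rw [hx, RCLike.inner_apply]

/-- By density the weak equation extends to all of `H¹₀`. It is applied to conjugated test functions
because it is bilinear, while the inner product is conjugate linear on the left. -/
theorem inner_eq_neg_of_weak {G : Fin d → Hilb d} {χ : Hilb d}
    (h : ∀ η : E d → ℂ, IsTest η →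
      ∑ j, ∫ x in cube d, G j x * testPd j η x = -∫ x in cube d, χ x * η x)
    {v : Hilb d} {W : Fin d → Hilb d} (hv : HasGradH10 v W) :
    ∑ k, ⟪W k, G k⟫_ℂ = -⟪v, χ⟫_ℂ := by
  rw [hasGradH10_iff] at hv
  have hcl : IsClosed {p : Hilb d × (Fin d → Hilb d) | ∑ k, ⟪p.2 k, G k⟫_ℂ = -⟪p.1, χ⟫_ℂ} :=
    isClosed_eq (continuous_finsetSum _ fun k _ =>
      ((continuous_apply k).comp continuous_snd).inner continuous_const)
      (continuous_fst.inner continuous_const).neg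
  refine closure_minimal ?_ hcl hv
  rintro p ⟨η, hη, h1, h2⟩
  have := h _ hη.conj
  simp only [hη.testPd_conj] at this
  simp only [Set.mem_ofPred_eq, inner_eq_integral_of_ae_eq h1, inner_eq_integral_of_ae_eq (h2 _)]
  exact this

/-- Uniqueness: the difference of two weak solutions, tested against itself, has zero energy. -/
theorem IsResolvent.eq_of_weak {ε : ℝ} {R : Hilb d →L[ℂ] Hilb d} {N : Fin d → Hilb d →L[ℂ] Hilb d}
    (hR : IsResolvent (H := Hilb d) HasGradH10 ε R N) {g φ : Hilb d} {G : Fin d → Hilb d}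
    (hg : HasGradH10 g G)
    (h : ∀ v W, HasGradH10 v W → ⟪v, φ⟫_ℂ = ⟪v, g⟫_ℂ + (ε : ℂ) * ∑ k, ⟪W k, G k⟫_ℂ) :
    R φ = g := by
  have h1 := isLinearGraph_hasGradH10.add _ _ _ _ (hR.mem φ)
    (isLinearGraph_hasGradH10.smul (-1) _ _ hg)
  have h2 := h _ _ h1
  rw [hR.weak _ _ _ h1] at h2
  simp only [neg_smul, one_smul, ← sub_eq_add_neg] at h2
  have h3 : ⟪R φ - g, R φ - g⟫_ℂ + (ε : ℂ) * ∑ k, ⟪N k φ - G k, N k φ - G k⟫_ℂ = 0 := by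
    have e1 : ⟪R φ - g, R φ - g⟫_ℂ = ⟪R φ - g, R φ⟫_ℂ - ⟪R φ - g, g⟫_ℂ := inner_sub_right _ _ _
    have e2 : ∑ k, ⟪N k φ - G k, N k φ - G k⟫_ℂ =
        ∑ k, ⟪N k φ - G k, N k φ⟫_ℂ - ∑ k, ⟪N k φ - G k, G k⟫_ℂ := by
      rw [← Finset.sum_sub_distrib]
      exact Finset.sum_congr rfl fun k _ => inner_sub_right _ _ _
    rw [e1, e2]
    linear_combination h2
  have h4 := congrArg Complex.re h3
  simp only [inner_self_eq_ofReal, ← Complex.ofReal_sum, ← Complex.ofReal_mul,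
    ← Complex.ofReal_add, Complex.ofReal_re, Complex.zero_re] at h4
  have h5 : 0 ≤ ε * ∑ k, ‖N k φ - G k‖ ^ 2 :=
    mul_nonneg hR.pos.le (Finset.sum_nonneg fun _ _ => sq_nonneg _)
  have h6 : ‖R φ - g‖ ^ 2 = 0 := le_antisymm (by linarith) (sq_nonneg _)
  exact sub_eq_zero.1 (norm_eq_zero.1 (pow_eq_zero_iff two_ne_zero |>.1 h6))

/-- `R Δφ = (R φ - φ) / ε`. -/
theorem IsResolvent.apply_laplacian {ε : ℝ} {R : Hilb d →L[ℂ] Hilb d}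
    {N : Fin d → Hilb d →L[ℂ] Hilb d}
    (hR : IsResolvent (H := Hilb d) HasGradH10 ε R N) {φ χ : Hilb d} (h : HasLaplacian φ χ) :
    R χ = -yosida ε R φ := by
  obtain ⟨G, hG, hw⟩ := h
  have h1 : R (φ - (ε : ℂ) • χ) = φ := by
    refine hR.eq_of_weak hG fun v W hv => ?_
    rw [inner_sub_right, inner_smul_right, inner_eq_neg_of_weak hw hv]
    ring
  rw [map_sub, map_smul] at h1
  rw [yosida_apply, ← h1]
  have hε : (ε : ℂ) ≠ 0 := Complex.ofReal_ne_zero.2 hR.pos.ne'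
  have h2 : (ε : ℂ) • R χ = R φ - φ := by
    nth_rewrite 2 [← h1]; abel
  rw [h1, ← smul_neg, neg_sub, ← h2, smul_smul, Complex.ofReal_inv, inv_mul_cancel₀ hε, one_smul]

/-- `R φ` lies in the domain of the Laplacian. -/
theorem IsResolvent.hasLaplacian {ε : ℝ} {R : Hilb d →L[ℂ] Hilb d}
    {N : Fin d → Hilb d →L[ℂ] Hilb d}
    (hR : IsResolvent (H := Hilb d) HasGradH10 ε R N) (φ : Hilb d) :
    HasLaplacian (R φ) (-yosida ε R φ) := by
  refine ⟨_, hR.mem φ, fun η hη => ?_⟩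
  have h1 := hR.inner_yosida φ _ _ (hasGradH10_iff.2 (subset_closure hη.conj.mem_testPairs))
  rw [inner_eq_integral_of_ae_eq hη.conj.memLp.coeFn_toLp,
    Finset.sum_congr rfl fun k _ =>
      inner_eq_integral_of_ae_eq (φ := N k φ) (hη.conj.memLp_testPd k).coeFn_toLp] at h1
  simp only [hη.testPd_conj, Complex.conj_conj] at h1
  rw [← h1, ← integral_neg]
  refine integral_congr_ae ?_
  filter_upwards [Lp.coeFn_neg (yosida ε R φ)] with x hx
  rw [hx, Pi.neg_apply, neg_mul, neg_neg]

end Concrete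

/-! ### Approximation of compactly supported `C¹` functions by test functions. -/

section Regularity

open scoped InnerProductSpace

variable {d : ℕ}

theorem norm_le_of_ae_le {v : Hilb d} {c : ℝ} (hc : 0 ≤ c)
    (h : ∀ᵐ x ∂(cubeMeasure d), ‖v x‖ ≤ c) :
    ‖v‖ ≤ (measureUnivNNReal (cubeMeasure d) ^ (2 : ℝ≥0∞).toReal⁻¹ : NNReal) * c := by
  exact_mod_cast Lp.norm_le_of_ae_bound hc h

/-- A continuously differentiable function with compact support is uniformly close to test
functions, together with its first derivatives. -/
theorem exists_isTest_close {η : E d → ℂ} (h1 : ContDiff ℝ 1 η) (hc : HasCompactSupport η)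
    (hs : tsupport η ⊆ interior (cube d)) {r : ℝ} (hr : 0 < r) :
    ∃ ζ, IsTest ζ ∧ (∀ x, ‖ζ x - η x‖ ≤ r) ∧ ∀ j x, ‖testPd j ζ x - testPd j η x‖ ≤ r := by
  have hcd : ∀ j, HasCompactSupport (testPd j η) := fun j => hc.fderiv_apply (𝕜 := ℝ) (unitVec j)
  have hcont : ∀ j, Continuous (testPd j η) := fun j =>
    (h1.continuous_fderiv one_ne_zero).clm_apply continuous_const
  obtain ⟨δ₀, hδ₀, hthick⟩ := IsCompact.exists_cthickening_subset_open hc isOpen_interior hs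
  have huc : ∀ g : E d → ℂ, HasCompactSupport g → Continuous g →
      ∃ δ > 0, ∀ x y, dist x y < δ → dist (g x) (g y) ≤ r := by
    intro g hg hg'
    obtain ⟨δ, hδ, h⟩ := Metric.uniformContinuous_iff.1
      (hg.uniformContinuous_of_continuous hg') r hr
    exact ⟨δ, hδ, fun x y hxy => (h hxy).le⟩
  obtain ⟨δ₁, hδ₁, hu₁⟩ := huc η hc h1.continuous
  choose δ₂ hδ₂ hu₂ using fun j => huc _ (hcd j) (hcont j)
  obtain ⟨δ₃, hδ₃, hle⟩ : ∃ δ₃ > 0, ∀ j, δ₃ ≤ δ₂ j := by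
    rcases isEmpty_or_nonempty (Fin d) with h | h
    · exact ⟨1, one_pos, fun j => h.elim j⟩
    · obtain ⟨j₀, hj₀⟩ := Finite.exists_min δ₂
      exact ⟨δ₂ j₀, hδ₂ j₀, hj₀⟩
  set δ := min δ₀ (min δ₁ δ₃)
  have hδ : 0 < δ := lt_min hδ₀ (lt_min hδ₁ hδ₃)
  let φ : ContDiffBump (0 : E d) := ⟨δ / 2, δ, half_pos hδ, half_lt_self hδ⟩
  -- Mollification at scale `δ`: at most `δ₀`, to keep the support inside the open cube, and small
  -- enough for the uniform continuity of `η` and its partial derivatives.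
  let ζ : E d → ℂ := MeasureTheory.convolution (φ.normed volume) η
    (ContinuousLinearMap.lsmul ℝ ℝ) volume
  have hnc : HasCompactSupport (φ.normed (volume : Measure (E d))) := φ.hasCompactSupport_normed
  have hloc : LocallyIntegrable (φ.normed (volume : Measure (E d))) volume :=
    φ.continuous_normed.locallyIntegrable
  have hsm : ContDiff ℝ ((⊤ : ℕ∞) : WithTop ℕ∞) ζ :=
    hnc.contDiff_convolution_left _ φ.contDiff_normed h1.continuous.locallyIntegrable
  have hsub : tsupport ζ ⊆ Metric.cthickening δ₀ (tsupport η) := by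
    refine closure_minimal ?_ Metric.isClosed_cthickening
    refine (support_convolution_subset _).trans ?_
    rintro _ ⟨a, ha, b, hb, rfl⟩
    rw [φ.support_normed_eq] at ha
    refine Metric.mem_cthickening_of_dist_le _ b _ _ (subset_tsupport η hb) ?_
    rw [mem_ball_zero_iff] at ha
    simp only [dist_eq_norm, add_sub_cancel_right]
    exact ha.le.trans (min_le_left _ _)
  refine ⟨ζ, ⟨hsm, ?_, hsub.trans hthick⟩, fun x => ?_, fun j x => ?_⟩
  · exact hnc.convolution _ hc
  · rw [← dist_eq_norm]
    refine φ.dist_normed_convolution_le h1.continuous.aestronglyMeasurable fun y hy => hu₁ _ _ ?_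
    exact (Metric.mem_ball.1 hy).trans_le ((min_le_right _ _).trans (min_le_left _ _))
  · rw [← dist_eq_norm]
    have e : testPd j ζ x = MeasureTheory.convolution (φ.normed volume) (testPd j η)
        (ContinuousLinearMap.lsmul ℝ ℝ) volume x := by
      rw [testPd, (hc.hasFDerivAt_convolution_right _ hloc h1 x).fderiv,
        convolution_precompR_apply _ hloc (hc.fderiv ℝ) (h1.continuous_fderiv one_ne_zero)]
      rfl
    rw [e]
    refine φ.dist_normed_convolution_le (hcont j).aestronglyMeasurable fun y hy => hu₂ j _ _ ?_
    exact (Metric.mem_ball.1 hy).trans_le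
      (((min_le_right _ _).trans (min_le_right _ _)).trans (hle j))

/-- A test function times an objective is only `C¹`, hence in general not a test function; this puts
the product into `H¹₀`. -/
theorem hasGradH10_of_contDiff {η : E d → ℂ} (h1 : ContDiff ℝ 1 η) (hc : HasCompactSupport η)
    (hs : tsupport η ⊆ interior (cube d)) {v : Hilb d} {W : Fin d → Hilb d}
    (hv : v =ᵐ[cubeMeasure d] η) (hW : ∀ j, W j =ᵐ[cubeMeasure d] testPd j η) :
    HasGradH10 v W := by
  rw [hasGradH10_iff, Metric.mem_closure_iff]
  intro r hr
  set V : ℝ := ((measureUnivNNReal (cubeMeasure d) ^ (2 : ℝ≥0∞).toReal⁻¹ : NNReal) : ℝ)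
  have hV : 0 ≤ V := NNReal.coe_nonneg _
  have hV1 : 0 < V + 1 := by linarith
  obtain ⟨ζ, hζ, hζ0, hζ1⟩ := exists_isTest_close h1 hc hs (div_pos hr hV1)
  have hlt : V * (r / (V + 1)) < r := by
    rw [mul_div_assoc', div_lt_iff₀ hV1]
    nlinarith
  have key : ∀ (w : Hilb d) (g g' : E d → ℂ) (hg : MemLp g' 2 (cubeMeasure d)),
      w =ᵐ[cubeMeasure d] g → (∀ x, ‖g' x - g x‖ ≤ r / (V + 1)) → dist w (hg.toLp g') < r := by
    intro w g g' hg hw hgg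
    rw [dist_comm, dist_eq_norm]
    refine (norm_le_of_ae_le (div_pos hr hV1).le ?_).trans_lt hlt
    filter_upwards [hw, hg.coeFn_toLp, Lp.coeFn_sub (hg.toLp g') w] with x e1 e2 e3
    rw [e3, Pi.sub_apply, e1, e2]
    exact hgg x
  refine ⟨_, hζ.mem_testPairs, ?_⟩
  rw [Prod.dist_eq, max_lt_iff, dist_pi_lt_iff hr]
  exact ⟨key _ _ _ hζ.memLp hv hζ0, fun j => key _ _ _ (hζ.memLp_testPd j) (hW j) (hζ1 j)⟩

end Regularity

/-! ### Functions with bounded second partial derivatives as multipliers of `H¹₀`. -/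

section Taylor

open scoped InnerProductSpace

variable {d : ℕ}

/-- `g` has the continuous gradient `p` on the cube, with a uniform quadratic bound for the error of
the first order Taylor approximation. -/
structure HasTaylor (g : E d → ℝ) (p : Fin d → E d → ℝ) : Prop where
  cont : ∀ k, ContinuousOn (p k) (cube d)
  taylor : ∃ C, ∀ x ∈ cube d, ∀ y ∈ cube d,
    |g y - g x - ∑ k, p k x * (y k - x k)| ≤ C * ‖y - x‖ ^ 2

theorem continuous_coord (k : Fin d) : Continuous fun x : E d => x k :=
  (EuclideanSpace.proj (𝕜 := ℝ) k).continuous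

theorem HasTaylor.continuousOn {g : E d → ℝ} {p : Fin d → E d → ℝ} (h : HasTaylor g p) :
    ContinuousOn g (cube d) := by
  obtain ⟨C, hC⟩ := h.taylor
  intro x hx
  have h1 : Tendsto (fun y => g y - g x - ∑ k, p k x * (y k - x k)) (𝓝[cube d] x) (𝓝 0) := by
    refine squeeze_zero_norm' (a := fun y => C * ‖y - x‖ ^ 2) ?_ ?_
    · filter_upwards [self_mem_nhdsWithin] with y hy using hC x hx y hy
    · have : Continuous fun y : E d => C * ‖y - x‖ ^ 2 := by fun_prop
      have h2 := (this.tendsto x).mono_left (nhdsWithin_le_nhds (s := cube d))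
      simpa using h2
  have h2 : Tendsto (fun y : E d => g x + ∑ k, p k x * (y k - x k)) (𝓝[cube d] x) (𝓝 (g x)) := by
    have : Continuous fun y : E d => g x + ∑ k, p k x * (y k - x k) :=
      continuous_const.add (continuous_finsetSum _ fun k _ =>
        continuous_const.mul ((continuous_coord k).sub continuous_const))
    have h3 := (this.tendsto x).mono_left (nhdsWithin_le_nhds (s := cube d))
    simpa using h3
  have h3 := h1.add h2
  rw [zero_add] at h3
  refine h3.congr fun y => ?_
  ring

/-- The linear functional with coefficients `c`. -/
def linFunctional (c : Fin d → ℝ) : E d →L[ℝ] ℝ :=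
  ∑ k, c k • EuclideanSpace.proj (𝕜 := ℝ) k

theorem linFunctional_apply (c : Fin d → ℝ) (v : E d) : linFunctional c v = ∑ k, c k * v k := by
  simp [linFunctional, sum_apply, smul_apply]

theorem linFunctional_unitVec (c : Fin d → ℝ) (j : Fin d) :
    linFunctional c (unitVec j) = c j := by
  simp [linFunctional_apply, unitVec]

theorem HasTaylor.hasFDerivAt {g : E d → ℝ} {p : Fin d → E d → ℝ} (h : HasTaylor g p) {x : E d}
    (hx : x ∈ interior (cube d)) : HasFDerivAt g (linFunctional fun k => p k x) x := by
  obtain ⟨C, hC⟩ := h.taylor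
  have h1 : HasFDerivAt (fun y => g y - g x - linFunctional (fun k => p k x) (y - x))
      (0 : E d →L[ℝ] ℝ) x := by
    refine Asymptotics.IsBigO.hasFDerivAt (n := 2) ?_ one_lt_two
    refine Asymptotics.IsBigO.of_bound C ?_
    filter_upwards [mem_interior_iff_mem_nhds.1 hx] with y hy
    rw [linFunctional_apply, Real.norm_of_nonneg (sq_nonneg ‖y - x‖)]
    exact hC x (interior_subset hx) y hy
  have h2 := (h1.add ((linFunctional fun k => p k x).hasFDerivAt.comp x
    ((hasFDerivAt_id x).sub_const x))).add_const (g x)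
  refine (h2.congr_fderiv ?_).congr_of_eventuallyEq (Eventually.of_forall fun y => ?_)
  · ext v; simp
  · simp

theorem HasTaylor.contDiffOn {g : E d → ℝ} {p : Fin d → E d → ℝ} (h : HasTaylor g p) :
    ContDiffOn ℝ 1 g (interior (cube d)) := by
  have h1 : (1 : WithTop ℕ∞) = 0 + 1 := by simp
  rw [h1, contDiffOn_succ_iff_fderiv_of_isOpen isOpen_interior]
  refine ⟨fun x hx => (h.hasFDerivAt hx).differentiableAt.differentiableWithinAt, by simp, ?_⟩
  rw [contDiffOn_zero]
  have h2 : ContinuousOn (fun x => linFunctional fun k => p k x) (interior (cube d)) :=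
    continuousOn_finsetSum _ fun k _ => ((h.cont k).mono interior_subset).smul continuousOn_const
  exact h2.congr fun x hx => (h.hasFDerivAt hx).fderiv

/-- The product rule in `H¹₀`. -/
theorem HasTaylor.isMultiplier {g : E d → ℝ} {p : Fin d → E d → ℝ} (h : HasTaylor g p) :
    IsMultiplier (H := Hilb d) (mulOps d) HasGradH10 (mulOp g) (fun k => mulOp (p k)) where
  mem := ⟨g, h.continuousOn, rfl⟩
  mem' k := ⟨p k, h.cont k, rfl⟩
  map v W hv := by
    rw [hasGradH10_iff] at hv
    rw [hasGradH10_iff, ← closure_closure]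
    refine map_mem_closure (f := fun q : Hilb d × (Fin d → Hilb d) =>
      (mulOp g q.1, fun k => mulOp g (q.2 k) + mulOp (p k) q.1)) ?_ hv ?_
    · refine ((mulOp g).continuous.comp continuous_fst).prodMk (continuous_pi fun k => ?_)
      exact ((mulOp g).continuous.comp ((continuous_apply k).comp continuous_snd)).add
        ((mulOp (p k)).continuous.comp continuous_fst)
    -- On a test function `η` the product `gη` is `C¹` with compact support in the open cube, so the
    -- behaviour of `g` at the boundary plays no role.
    rintro ⟨w, Z⟩ ⟨η, hη, hw, hZ⟩
    rw [← hasGradH10_iff]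
    have hzero : ∀ x, x ∉ tsupport η → (fun y => (g y : ℂ) * η y) =ᶠ[𝓝 x] fun _ => 0 := by
      intro x hx
      filter_upwards [(isClosed_tsupport η).isOpen_compl.mem_nhds hx] with y hy
      rw [image_eq_zero_of_notMem_tsupport hy, mul_zero]
    have hdiff : ContDiff ℝ 1 fun x => (g x : ℂ) * η x := by
      rw [contDiff_iff_contDiffAt]
      intro x
      by_cases hx : x ∈ tsupport η
      · have h1 : ContDiffAt ℝ 1 g x :=
          h.contDiffOn.contDiffAt (isOpen_interior.mem_nhds (hη.support hx))
        exact (Complex.ofRealCLM.contDiff.contDiffAt.comp x h1).mul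
          (hη.smooth.of_le (by exact_mod_cast le_top)).contDiffAt
      · exact contDiffAt_const.congr_of_eventuallyEq (hzero x hx)
    have hsub : tsupport (fun x => (g x : ℂ) * η x) ⊆ tsupport η :=
      tsupport_mul_subset_right (f := fun x => (g x : ℂ))
    refine hasGradH10_of_contDiff hdiff (hη.compact.mul_left (f := fun x => (g x : ℂ)))
      (hsub.trans hη.support) ?_ fun k => ?_
    · filter_upwards [hw, mulOp_ae h.continuousOn w] with x h1 h2
      rw [h2, h1]
    · filter_upwards [hw, hZ k, mulOp_ae h.continuousOn (Z k), mulOp_ae (h.cont k) w,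
        Lp.coeFn_add (mulOp g (Z k)) (mulOp (p k) w)] with x h1 h2 h3 h4 h5
      rw [h5, Pi.add_apply, h3, h4, h1, h2]
      by_cases hx : x ∈ tsupport η
      · have h6 := Complex.ofRealCLM.hasFDerivAt.comp x (h.hasFDerivAt (hη.support hx))
        have h7 := h6.mul (hη.differentiableAt x).hasFDerivAt
        have h8 : testPd k (fun y => (g y : ℂ) * η y) x = _ :=
          congrArg (fun T : E d →L[ℝ] ℂ => T (unitVec k)) h7.fderiv
        rw [h8]
        simp only [add_apply, smul_apply, Function.comp_apply, smul_eq_mul,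
          ContinuousLinearMap.comp_apply, linFunctional_unitVec, Complex.ofRealCLM_apply, testPd]
        ring
      · have h6 : η x = 0 := image_eq_zero_of_notMem_tsupport hx
        have h7 : testPd k η x = 0 := by
          have : η =ᶠ[𝓝 x] fun _ => 0 := notMem_tsupport_iff_eventuallyEq.1 hx
          rw [testPd, this.fderiv_eq]
          simp
        have h8 : testPd k (fun y => (g y : ℂ) * η y) x = 0 := by
          rw [testPd, (hzero x hx).fderiv_eq]
          simp
        rw [h6, h7, h8]
        simp

/-- The gradient inequality for convex functions. -/
theorem HasTaylor.add_le_of_convexOn {g : E d → ℝ} {p : Fin d → E d → ℝ} (h : HasTaylor g p)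
    (hg : ConvexOn ℝ (cube d) g) {x y : E d} (hx : x ∈ cube d) (hy : y ∈ cube d) :
    g x + ∑ k, p k x * (y k - x k) ≤ g y := by
  obtain ⟨C, hC⟩ := h.taylor
  set l := ∑ k, p k x * (y k - x k) with hl
  -- Convexity and the Taylor bound are compared at `(1 - t)x + ty` and divided by `t`; the error is
  -- then linear in `t`.
  have key : ∀ t ∈ Ioc (0 : ℝ) 1, l - (g y - g x) ≤ C * ‖y - x‖ ^ 2 * t := by
    rintro t ⟨ht0, ht1⟩
    have hz : (1 - t) • x + t • y ∈ cube d :=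
      convex_cube hx hy (by linarith) ht0.le (by ring)
    have h1 := hg.2 hx hy (by linarith : (0 : ℝ) ≤ 1 - t) ht0.le (by ring)
    have h2 := (abs_le.1 (hC x hx _ hz)).1
    have h3 : (1 - t) • x + t • y - x = t • (y - x) := by module
    have h4 : ∑ k, p k x * (((1 - t) • x + t • y) k - x k) = t * l := by
      rw [hl, Finset.mul_sum]
      refine Finset.sum_congr rfl fun k _ => ?_
      simp only [PiLp.add_apply, PiLp.smul_apply, smul_eq_mul]
      ring
    rw [h3, h4, norm_smul, mul_pow, Real.norm_eq_abs, sq_abs] at h2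
    simp only [smul_eq_mul] at h1
    have h5 : t * (l - (g y - g x)) ≤ t * (C * ‖y - x‖ ^ 2 * t) := by nlinarith
    exact le_of_mul_le_mul_left h5 ht0
  have hlim : Tendsto (fun t : ℝ => C * ‖y - x‖ ^ 2 * t) (𝓝[>] 0) (𝓝 0) := by
    have : Continuous fun t : ℝ => C * ‖y - x‖ ^ 2 * t := by fun_prop
    simpa using (this.tendsto 0).mono_left (nhdsWithin_le_nhds (s := Ioi 0))
  have := ge_of_tendsto hlim (b := l - (g y - g x)) (by
    filter_upwards [Ioc_mem_nhdsGT (zero_lt_one' ℝ)] with t ht using key t ht)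
  linarith

theorem hasTaylor_coord (k : Fin d) (c : ℝ) :
    HasTaylor (fun x : E d => x k - c) (fun j _ => if j = k then 1 else 0) where
  cont _ := continuousOn_const
  taylor := ⟨0, fun x _ y _ => by simp⟩

theorem hasTaylor_sum_sq (z : E d) :
    HasTaylor (fun x : E d => ∑ k, (x k - z k) * (x k - z k)) (fun k x => 2 * (x k - z k)) where
  cont k := (continuous_const.mul ((continuous_coord k).sub continuous_const)).continuousOn
  taylor := ⟨1, fun x _ y _ => by
    rw [← Finset.sum_sub_distrib, ← Finset.sum_sub_distrib, EuclideanSpace.norm_sq_eq, one_mul]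
    rw [abs_of_nonneg]
    · refine Finset.sum_le_sum fun k _ => le_of_eq ?_
      rw [PiLp.sub_apply, Real.norm_eq_abs, sq_abs]
      ring
    · refine Finset.sum_nonneg fun k _ => ?_
      nlinarith [sq_nonneg (y k - x k)]⟩

theorem HasTaylor.avg {m : ℕ} {f : Fin m → E d → ℝ} {p : Fin m → Fin d → E d → ℝ}
    (h : ∀ j, HasTaylor (f j) (p j)) :
    HasTaylor (avg f) (fun k => SQHD.avg fun j => p j k) where
  cont k := continuousOn_const.mul (continuousOn_finsetSum _ fun j _ => (h j).cont k)
  taylor := by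
    choose C hC using fun j => (h j).taylor
    refine ⟨1 / m * ∑ j, C j, fun x hx y hy => ?_⟩
    have e : SQHD.avg f y - SQHD.avg f x - ∑ k, SQHD.avg (fun j => p j k) x * (y k - x k) =
        1 / m * ∑ j, (f j y - f j x - ∑ k, p j k x * (y k - x k)) := by
      have h1 : ∑ k, SQHD.avg (fun j => p j k) x * (y k - x k) =
          1 / m * ∑ j, ∑ k, p j k x * (y k - x k) := by
        rw [Finset.sum_comm, Finset.mul_sum]
        refine Finset.sum_congr rfl fun k _ => ?_
        rw [SQHD.avg, mul_assoc, Finset.sum_mul]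
      rw [h1]
      simp only [SQHD.avg, Finset.sum_sub_distrib]
      ring
    rw [e, abs_mul, abs_of_nonneg (by positivity : (0 : ℝ) ≤ 1 / m), mul_assoc]
    refine mul_le_mul_of_nonneg_left ?_ (by positivity)
    rw [Finset.sum_mul]
    exact (Finset.abs_sum_le_sum_abs _ _).trans (Finset.sum_le_sum fun j _ => hC j x hx y hy)

theorem HasTaylor.sub_const {g : E d → ℝ} {p : Fin d → E d → ℝ} (h : HasTaylor g p) (c : ℝ) :
    HasTaylor (fun x => g x - c) p where
  cont := h.cont
  taylor := by
    obtain ⟨C, hC⟩ := h.taylor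
    exact ⟨C, fun x hx y hy => by simpa using hC x hx y hy⟩

/-! ### Functions with bounded partial derivatives -/

/-- A function with partial derivatives bounded by `M` on the box spanned by `x` and `y`. -/
theorem abs_sub_le_of_hasDerivWithinAt {g : E d → ℝ} {q : Fin d → E d → ℝ} {x y : E d} {M : ℝ}
    (hx : x ∈ cube d) (hy : y ∈ cube d)
    (hg : ∀ k, ∀ z ∈ cube d,
      HasDerivWithinAt (fun s : ℝ => g (z + s • unitVec k)) (q k z) (slice k z) 0)
    (hq : ∀ k, ∀ z, (∀ j, z j ∈ uIcc (x j) (y j)) → |q k z| ≤ M) :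
    |g y - g x| ≤ M * ∑ k, |y k - x k| := by
  classical
  have hmem : ∀ z : E d, (∀ j, z j ∈ uIcc (x j) (y j)) → z ∈ cube d := fun z hz j =>
    (ordConnected_Icc.uIcc_subset (hx j) (hy j)) (hz j)
  -- The coordinates are changed from `x` to `y` one at a time, so each step is a one-dimensional
  -- mean value estimate inside the box spanned by the two points.
  let Z : Finset (Fin d) → E d := fun s => WithLp.toLp 2 fun j => if j ∈ s then y j else x j
  have key : ∀ s : Finset (Fin d), |g (Z s) - g x| ≤ M * ∑ k ∈ s, |y k - x k| := by
    intro s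
    induction s using Finset.induction_on with
    | empty =>
      have : Z ∅ = x := by ext j; simp [Z]
      simp [this]
    | insert a s ha ih =>
      rw [Finset.sum_insert ha, mul_add]
      have hc : ∀ (r : ℝ) (j : Fin d), (Z s + r • unitVec a) j =
          if j = a then x a + r else Z s j := by
        intro r j
        by_cases hj : j = a
        · subst hj; simp [Z, unitVec, ha]
        · simp [unitVec, hj]
      have hb : ∀ r ∈ uIcc 0 (y a - x a), ∀ j, (Z s + r • unitVec a) j ∈ uIcc (x j) (y j) := by
        intro r hr j
        rw [hc]
        split_ifs with hj
        · subst hj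
          rw [mem_uIcc] at hr ⊢
          rcases hr with hr | hr
          · left; constructor <;> linarith [hr.1, hr.2]
          · right; constructor <;> linarith [hr.1, hr.2]
        · by_cases hjs : j ∈ s <;> simp [Z, hjs]
      have h1 : ∀ r ∈ uIcc 0 (y a - x a), HasDerivWithinAt
          (fun s' : ℝ => g (Z s + s' • unitVec a)) (q a (Z s + r • unitVec a))
          (uIcc 0 (y a - x a)) r := by
        intro r hr
        have h2 := hg a _ (hmem _ (hb r hr))
        have h3 : HasDerivWithinAt (fun s' : ℝ => s' - r) 1 (uIcc 0 (y a - x a)) r :=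
          (hasDerivWithinAt_id r _).sub_const r
        have h4 := HasDerivWithinAt.comp (h₂ := fun s' : ℝ => g (Z s + r • unitVec a + s' • unitVec a))
          (h := fun s' : ℝ => s' - r) (s' := slice a (Z s + r • unitVec a)) r
          (by simpa using h2) h3 ?_
        · rw [mul_one] at h4
          refine h4.congr_of_mem (fun s' _ => ?_) hr
          simp only [Function.comp_apply]
          congr 1
          module
        · intro s' hs'
          change Z s + r • unitVec a + (s' - r) • unitVec a ∈ cube d
          have : Z s + r • unitVec a + (s' - r) • unitVec a = Z s + s' • unitVec a := by module
          rw [this]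
          exact hmem _ (hb s' hs')
      have h2 := Convex.norm_image_sub_le_of_norm_hasDerivWithin_le h1
        (fun r hr => hq a _ (hb r hr)) (convex_uIcc _ _) left_mem_uIcc right_mem_uIcc
      have h3 : Z s + (y a - x a) • unitVec a = Z (insert a s) := by
        ext j
        rw [hc]
        by_cases hj : j = a
        · subst hj; simp [Z]
        · simp [Z, hj]
      rw [h3, zero_smul, add_zero, sub_zero, Real.norm_eq_abs, Real.norm_eq_abs] at h2
      calc |g (Z (insert a s)) - g x| ≤ |g (Z (insert a s)) - g (Z s)| + |g (Z s) - g x| :=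
            abs_sub_le _ _ _
        _ ≤ _ := add_le_add h2 ih
  have := key Finset.univ
  have hZ : Z Finset.univ = y := by ext j; simp [Z]
  rwa [hZ] at this

theorem HasPd.hasDerivWithinAt {j : Fin d} {g : E d → ℝ} (h : HasPd j g) {x : E d}
    (hx : x ∈ cube d) :
    HasDerivWithinAt (fun s : ℝ => g (x + s • unitVec j)) (pd j g x) (slice j x) 0 :=
  (h x hx).hasDerivWithinAt

theorem sum_abs_le (v : E d) : ∑ k, |v k| ≤ d * ‖v‖ := by
  calc ∑ k, |v k| ≤ ∑ _k : Fin d, ‖v‖ := Finset.sum_le_sum fun k _ => PiLp.norm_apply_le v k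
    _ = d * ‖v‖ := by simp

/-- No continuity of the derivatives is assumed. Bounded second partial derivatives make each `∂ₖf`
Lipschitz; then `f` minus its linearization at `x` has small partial derivatives on the whole box
between `x` and `y`, which gives a quadratic error. -/
theorem SmoothUpTo.hasTaylor {L : ℝ} {f : E d → ℝ} (h : SmoothUpTo 2 L f) :
    HasTaylor f (fun k => pd k f) := by
  by_cases hne : (cube d).Nonempty
  swap
  · rw [not_nonempty_iff_eq_empty] at hne
    exact ⟨fun k => by rw [hne]; exact continuousOn_empty _, 0, fun x hx => by simp [hne] at hx⟩
  obtain ⟨x₀, hx₀⟩ := hne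
  have hL : 0 ≤ L := (abs_nonneg _).trans (h.2 [] (by simp) x₀ hx₀)
  have hlip : ∀ k, ∀ x ∈ cube d, ∀ y ∈ cube d,
      |pd k f y - pd k f x| ≤ L * ∑ i, |y i - x i| := by
    intro k x hx y hy
    refine abs_sub_le_of_hasDerivWithinAt (q := fun i => pd i (pd k f)) hx hy (fun i z hz =>
      (h.1 [k] (by simp) i).hasDerivWithinAt hz) fun i z hz => ?_
    refine h.2 [i, k] (by simp) z fun j => ?_
    exact (ordConnected_Icc.uIcc_subset (hx j) (hy j)) (hz j)
  constructor
  · intro k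
    refine LipschitzOnWith.continuousOn (K := (L * d).toNNReal) ?_
    refine LipschitzOnWith.of_dist_le_mul fun x hx y hy => ?_
    rw [dist_eq_norm, dist_eq_norm, Real.coe_toNNReal _ (by positivity), mul_assoc]
    refine (hlip k y hy x hx).trans (mul_le_mul_of_nonneg_left ?_ hL)
    exact sum_abs_le (x - y)
  · refine ⟨L * d * d, fun x hx y hy => ?_⟩
    have h1 := abs_sub_le_of_hasDerivWithinAt (g := fun z => f z - linFunctional (fun k => pd k f x) z)
      (q := fun k z => pd k f z - pd k f x) (M := L * ∑ i, |y i - x i|) hx hy ?_ ?_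
    · simp only [linFunctional_apply] at h1
      have e : f y - ∑ k, pd k f x * y k - (f x - ∑ k, pd k f x * x k) =
          f y - f x - ∑ k, pd k f x * (y k - x k) := by
        simp only [mul_sub, Finset.sum_sub_distrib]; ring
      rw [e] at h1
      refine h1.trans ?_
      have h2 : ∑ k, |y k - x k| ≤ d * ‖y - x‖ := sum_abs_le (y - x)
      have h3 : 0 ≤ ∑ k, |y k - x k| := Finset.sum_nonneg fun _ _ => abs_nonneg _
      calc L * (∑ i, |y i - x i|) * ∑ k, |y k - x k| ≤ L * (d * ‖y - x‖) * (d * ‖y - x‖) := by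
            gcongr
        _ = L * d * d * ‖y - x‖ ^ 2 := by ring
    · intro k z hz
      refine ((h.1 [] (by simp) k).hasDerivWithinAt hz).sub ?_
      have h3 : HasDerivAt (fun s : ℝ => linFunctional (fun k => pd k f x) (z + s • unitVec k))
          (pd k f x) 0 := by
        simp only [map_add, map_smul, linFunctional_unitVec, smul_eq_mul]
        simpa using ((hasDerivAt_id (0 : ℝ)).mul_const (pd k f x)).const_add
          (linFunctional (fun k => pd k f x) z)
      exact h3.hasDerivWithinAt
    · intro k z hz
      have hz' : z ∈ cube d := fun j => (ordConnected_Icc.uIcc_subset (hx j) (hy j)) (hz j)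
      refine (hlip k x hx z hz').trans (mul_le_mul_of_nonneg_left ?_ hL)
      exact Finset.sum_le_sum fun i _ => abs_sub_left_of_mem_uIcc (hz i)

end Taylor

/-! ### Integration by parts, and dilations of test functions about a point of the cube. -/

section Dilation

open scoped InnerProductSpace

variable {d : ℕ}

theorem memLp_of_continuous {η : E d → ℂ} (h : Continuous η) : MemLp η 2 (cubeMeasure d) := by
  obtain ⟨C, hC⟩ := isCompact_cube.exists_bound_of_continuousOn h.continuousOn
  refine MemLp.of_bound h.aestronglyMeasurable C ?_
  filter_upwards [ae_mem_cube] with x hx using hC x hx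

open Classical in
/-- The class in `L²` of a square integrable function. -/
def toHilb (η : E d → ℂ) : Hilb d :=
  if h : MemLp η 2 (cubeMeasure d) then h.toLp η else 0

theorem toHilb_ae {η : E d → ℂ} (h : Continuous η) : toHilb η =ᵐ[cubeMeasure d] η := by
  rw [toHilb, dif_pos (memLp_of_continuous h)]
  exact (memLp_of_continuous h).coeFn_toLp

theorem eq_toHilb {v : Hilb d} {η : E d → ℂ} (h : Continuous η) (hv : v =ᵐ[cubeMeasure d] η) :
    v = toHilb η := Lp.ext (hv.trans (toHilb_ae h).symm)

theorem toHilb_sub {η ζ : E d → ℂ} (h : Continuous η) (h' : Continuous ζ) :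
    toHilb (fun x => η x - ζ x) = toHilb η - toHilb ζ := by
  refine (eq_toHilb (η := fun x => η x - ζ x) (h.sub h') ?_).symm
  filter_upwards [toHilb_ae h, toHilb_ae h', Lp.coeFn_sub (toHilb η) (toHilb ζ)] with x h1 h2 h3
  rw [h3, Pi.sub_apply, h1, h2]

theorem toHilb_smul {η : E d → ℂ} (h : Continuous η) (c : ℂ) :
    toHilb (fun x => c * η x) = c • toHilb η := by
  refine (eq_toHilb (η := fun x => c * η x) (continuous_const.mul h) ?_).symm
  filter_upwards [toHilb_ae h, Lp.coeFn_smul c (toHilb η)] with x h1 h2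
  rw [h2, Pi.smul_apply, h1, smul_eq_mul]

theorem toHilb_sum {ι : Type*} (s : Finset ι) {η : ι → E d → ℂ} (h : ∀ i, Continuous (η i)) :
    toHilb (fun x => ∑ i ∈ s, η i x) = ∑ i ∈ s, toHilb (η i) := by
  classical
  induction s using Finset.induction_on with
  | empty =>
    have := toHilb_smul (η := fun _ : E d => (0 : ℂ)) continuous_const 0
    simpa using this
  | insert a s ha ih =>
    rw [Finset.sum_insert ha, ← ih]
    refine (eq_toHilb ?_ ?_).symm
    · exact continuous_finsetSum _ fun i _ => h i
    filter_upwards [toHilb_ae (h a), toHilb_ae (continuous_finsetSum s fun i _ => h i),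
      Lp.coeFn_add (toHilb (η a)) (toHilb fun x => ∑ i ∈ s, η i x)] with x h1 h2 h3
    rw [h3, Pi.add_apply, h1, h2, Finset.sum_insert ha]

theorem mulOp_toHilb {g : E d → ℝ} (hg : Continuous g) {η : E d → ℂ} (h : Continuous η) :
    mulOp g (toHilb η) = toHilb fun x => (g x : ℂ) * η x := by
  refine eq_toHilb ((Complex.continuous_ofReal.comp hg).mul h) ?_
  filter_upwards [toHilb_ae h, mulOp_ae hg.continuousOn (toHilb η)] with x h1 h2
  rw [h2, h1]

theorem norm_toHilb_le {η : E d → ℂ} (h : Continuous η) {c : ℝ} (hc : 0 ≤ c)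
    (hb : ∀ x ∈ cube d, ‖η x‖ ≤ c) :
    ‖toHilb η‖ ≤ (measureUnivNNReal (cubeMeasure d) ^ (2 : ℝ≥0∞).toReal⁻¹ : NNReal) * c := by
  refine norm_le_of_ae_le hc ?_
  filter_upwards [toHilb_ae h, ae_mem_cube] with x h1 hx
  rw [h1]
  exact hb x hx

theorem inner_toHilb {η ζ : E d → ℂ} (h : Continuous η) (h' : Continuous ζ)
    (hs : ∀ x, x ∉ cube d → η x = 0) :
    ⟪toHilb η, toHilb ζ⟫_ℂ = ∫ x, ζ x * starRingEnd ℂ (η x) := by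
  rw [inner_eq_integral_of_ae_eq (toHilb_ae h)]
  have : ∫ x in cube d, (toHilb ζ) x * starRingEnd ℂ (η x) =
      ∫ x in cube d, ζ x * starRingEnd ℂ (η x) := by
    refine integral_congr_ae ?_
    filter_upwards [toHilb_ae h'] with x hx
    rw [hx]
  rw [this]
  refine setIntegral_eq_integral_of_forall_compl_eq_zero fun x hx => ?_
  rw [hs x hx, map_zero, mul_zero]

theorem IsTest.continuous {η : E d → ℂ} (h : IsTest η) : Continuous η := h.smooth.continuous

theorem IsTest.eq_zero {η : E d → ℂ} (h : IsTest η) {x : E d} (hx : x ∉ cube d) : η x = 0 :=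
  image_eq_zero_of_notMem_tsupport fun h' => hx (interior_subset (h.support h'))

theorem IsTest.testPd_eq_zero {η : E d → ℂ} (h : IsTest η) (k : Fin d) {x : E d}
    (hx : x ∉ cube d) : testPd k η x = 0 := by
  have h1 : x ∉ tsupport η := fun h' => hx (interior_subset (h.support h'))
  have : η =ᶠ[𝓝 x] fun _ => 0 := notMem_tsupport_iff_eventuallyEq.1 h1
  rw [testPd, this.fderiv_eq]
  simp

theorem IsTest.hasGradH10 {η : E d → ℂ} (h : IsTest η) :
    HasGradH10 (toHilb η) (fun k => toHilb (testPd k η)) :=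
  hasGradH10_iff.2 (subset_closure
    ⟨η, h, toHilb_ae h.continuous, fun k => toHilb_ae (h.continuous_testPd k)⟩)

theorem IsTest.sub {η ζ : E d → ℂ} (h : IsTest η) (h' : IsTest ζ) :
    IsTest (fun x => η x - ζ x) := by
  have := h.add (h'.const_smul (-1))
  convert this using 1
  ext x
  simp [sub_eq_add_neg]

theorem IsTest.testPd_sub {η ζ : E d → ℂ} (h : IsTest η) (h' : IsTest ζ) (k : Fin d) :
    testPd k (fun x => η x - ζ x) = fun x => testPd k η x - testPd k ζ x := by
  funext x
  have := ((h.differentiableAt x).hasFDerivAt.sub (h'.differentiableAt x).hasFDerivAt).fderiv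
  exact congrArg (fun T : E d →L[ℝ] ℂ => T (unitVec k)) this

theorem HasGradH10.exists_seq {g : Hilb d} {G : Fin d → Hilb d} (h : HasGradH10 g G) :
    ∃ η : ℕ → E d → ℂ, (∀ n, IsTest (η n)) ∧ Tendsto (fun n => toHilb (η n)) atTop (𝓝 g) ∧
      ∀ k, Tendsto (fun n => toHilb (testPd k (η n))) atTop (𝓝 (G k)) := by
  obtain ⟨η, hη, h1, h2⟩ := h
  exact ⟨η, hη, (tendsto_iff_eLpNorm_of_ae_eq fun n => toHilb_ae (hη n).continuous).2 h1, fun k =>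
    (tendsto_iff_eLpNorm_of_ae_eq fun n => toHilb_ae ((hη n).continuous_testPd k)).2 (h2 k)⟩

/-! ### Integration by parts -/

theorem IsTest.inner_testPd {η ζ : E d → ℂ} (h : IsTest η) (h' : IsTest ζ) (k : Fin d) :
    ⟪toHilb η, toHilb (testPd k ζ)⟫_ℂ = -⟪toHilb (testPd k η), toHilb ζ⟫_ℂ := by
  rw [inner_toHilb h.continuous (h'.continuous_testPd k) fun x hx => h.eq_zero hx,
    inner_toHilb (h.continuous_testPd k) h'.continuous fun x hx => h.testPd_eq_zero k hx]
  have key := integral_mul_fderiv_eq_neg_fderiv_mul_of_integrable (μ := (volume : Measure (E d)))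
    (𝕜 := ℂ) (f := fun x => starRingEnd ℂ (η x)) (g := ζ) (v := unitVec k) ?_ ?_ ?_
    (fun x _ => h.conj.differentiableAt x) fun x _ => h'.differentiableAt x
  · have e : ∀ x, fderiv ℝ (fun x => starRingEnd ℂ (η x)) x (unitVec k) =
        starRingEnd ℂ (testPd k η x) := h.testPd_conj k
    simp only [e] at key
    simpa only [mul_comm, testPd] using key
  · exact ((h.conj.continuous_testPd k).mul h'.continuous).integrable_of_hasCompactSupport
      h'.compact.mul_left
  · exact (h.conj.continuous.mul (h'.continuous_testPd k)).integrable_of_hasCompactSupport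
      (h'.hasCompactSupport_testPd k).mul_left
  · exact (h.conj.continuous.mul h'.continuous).integrable_of_hasCompactSupport
      h'.compact.mul_left

theorem HasGradH10.inner_eq {v g : Hilb d} {W G : Fin d → Hilb d} (hv : HasGradH10 v W)
    (hg : HasGradH10 g G) (k : Fin d) : ⟪v, G k⟫_ℂ = -⟪W k, g⟫_ℂ := by
  obtain ⟨η, hη, h1, h2⟩ := hv.exists_seq
  obtain ⟨ζ, hζ, h3, h4⟩ := hg.exists_seq
  have h5 := h1.inner (𝕜 := ℂ) (h4 k)
  have h6 := ((h2 k).inner (𝕜 := ℂ) h3).neg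
  exact tendsto_nhds_unique h5 (h6.congr fun n => ((hη n).inner_testPd (hζ n) k).symm)

/-! ### Dilations -/

/-- The dilation `η(z + s (x - z))` of a function with respect to the point `z`. -/
def dilate (z : E d) (s : ℝ) (η : E d → ℂ) (x : E d) : ℂ := η (z + s • (x - z))

theorem continuous_dilate {η : E d → ℂ} (h : Continuous η) (z : E d) (s : ℝ) :
    Continuous (dilate z s η) := h.comp (by fun_prop)

theorem testPd_dilate {η : E d → ℂ} (h : IsTest η) (z : E d) (s : ℝ) (k : Fin d) :
    testPd k (dilate z s η) = fun x => (s : ℂ) * dilate z s (testPd k η) x := by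
  funext x
  have h1 : HasFDerivAt (fun x : E d => z + s • (x - z)) (s • ContinuousLinearMap.id ℝ (E d)) x :=
    (((hasFDerivAt_id x).sub_const z).const_smul s).const_add z
  have h2 := (h.differentiableAt (z + s • (x - z))).hasFDerivAt.comp x h1
  have h3 : fderiv ℝ (dilate z s η) x = _ := h2.fderiv
  rw [testPd, h3]
  simp [dilate, testPd]

/-- For `s ≥ 1` the support shrinks towards `z`. Convexity keeps it inside the open cube even if `z`
lies on the boundary, as the minimizer may. -/
theorem IsTest.dilate {η : E d → ℂ} (h : IsTest η) {z : E d} (hz : z ∈ cube d) {s : ℝ}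
    (hs : 1 ≤ s) : IsTest (dilate z s η) := by
  have hs0 : 0 < s := by linarith
  set K := (fun w : E d => (1 - s⁻¹) • z + s⁻¹ • w) '' tsupport η
  have hK : IsCompact K := IsCompact.image h.compact (by fun_prop)
  have hsub : Function.support (SQHD.dilate z s η) ⊆ K := by
    intro x hx
    refine ⟨z + s • (x - z), subset_tsupport η hx, ?_⟩
    simp only [smul_add, smul_sub, smul_smul, inv_mul_cancel₀ hs0.ne']
    module
  have hKi : K ⊆ interior (cube d) := by
    rintro _ ⟨w, hw, rfl⟩
    exact convex_cube.combo_self_interior_mem_interior hz (h.support hw)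
      (sub_nonneg.2 (inv_le_one_of_one_le₀ hs)) (inv_pos.2 hs0) (by ring)
  refine ⟨?_, HasCompactSupport.of_support_subset_isCompact hK hsub,
    (closure_minimal hsub hK.isClosed).trans hKi⟩
  exact h.smooth.comp (contDiff_const.add ((contDiff_id.sub contDiff_const).const_smul s))

theorem integral_dilate (g : E d → ℝ) (z : E d) {s : ℝ} (hs : 0 < s) :
    ∫ x, g (z + s • (x - z)) = (s ^ d)⁻¹ * ∫ x, g x := by
  have h1 := integral_sub_right_eq_self (μ := (volume : Measure (E d)))
    (fun x => g (z + s • x)) z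
  have h2 := Measure.integral_comp_smul (volume : Measure (E d)) (fun x => g (z + x)) s
  have h3 := integral_add_left_eq_self (μ := (volume : Measure (E d))) g z
  rw [h1, h2, h3, finrank_euclideanSpace_fin, abs_of_nonneg (by positivity), smul_eq_mul]

theorem norm_sq_toHilb {η : E d → ℂ} (h : Continuous η) (hs : ∀ x, x ∉ cube d → η x = 0) :
    ‖toHilb η‖ ^ 2 = ∫ x, ‖η x‖ ^ 2 := by
  have h1 := inner_toHilb h h hs
  rw [inner_self_eq_ofReal] at h1
  have h2 : ∫ x, η x * starRingEnd ℂ (η x) = ((∫ x, ‖η x‖ ^ 2 : ℝ) : ℂ) := by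
    rw [← integral_complex_ofReal]
    refine integral_congr_ae (Eventually.of_forall fun x => ?_)
    simp only [Complex.mul_conj, Complex.normSq_eq_norm_sq]
  rw [h2] at h1
  exact_mod_cast h1

/-- The factor `s²` comes from the chain rule and `s^{-d}` from the change of variables. -/
theorem IsTest.norm_sq_testPd_dilate {η : E d → ℂ} (h : IsTest η) {z : E d} (hz : z ∈ cube d)
    {s : ℝ} (hs : 1 ≤ s) (k : Fin d) :
    ‖toHilb (testPd k (SQHD.dilate z s η))‖ ^ 2 =
      s ^ 2 * (s ^ d)⁻¹ * ‖toHilb (testPd k η)‖ ^ 2 := by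
  have hd := h.dilate hz hs
  rw [norm_sq_toHilb (hd.continuous_testPd k) fun x hx => hd.testPd_eq_zero k hx,
    norm_sq_toHilb (h.continuous_testPd k) fun x hx => h.testPd_eq_zero k hx,
    testPd_dilate h, mul_assoc, ← integral_dilate _ z (by linarith : 0 < s),
    ← integral_const_mul]
  refine integral_congr_ae (Eventually.of_forall fun x => ?_)
  simp only [norm_mul, mul_pow, SQHD.dilate, Complex.norm_real, Real.norm_eq_abs, sq_abs]

theorem sum_smul_unitVec (v : E d) : ∑ k, v k • unitVec k = v := by
  ext j
  simp [unitVec, Pi.single_apply]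

theorem sum_mul_testPd (η : E d → ℂ) (w v : E d) :
    ∑ k, (v k : ℂ) * testPd k η w = fderiv ℝ η w v := by
  conv_rhs => rw [← sum_smul_unitVec v, map_sum]
  refine Finset.sum_congr rfl fun k _ => ?_
  rw [map_smul, testPd, Complex.real_smul]

theorem IsTest.exists_taylor_bound {η : E d → ℂ} (h : IsTest η) :
    ∃ K : ℝ, 0 ≤ K ∧ ∀ w w' : E d, ‖η w' - η w - fderiv ℝ η w (w' - w)‖ ≤ K * ‖w' - w‖ ^ 2 := by
  obtain ⟨K, hK⟩ := (h.smooth.fderiv_right (m := 1)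
    (WithTop.coe_le_coe.2 (le_top : (1 + 1 : ℕ∞) ≤ ⊤))).lipschitzWith_of_hasCompactSupport (h.compact.fderiv ℝ) one_ne_zero
  refine ⟨K, K.2, fun w w' => ?_⟩
  have h1 := Convex.norm_image_sub_le_of_norm_fderiv_le' (𝕜 := ℝ) (f := η) (φ := fderiv ℝ η w)
    (s := Metric.closedBall w ‖w' - w‖) (x := w) (y := w') (C := K * ‖w' - w‖)
    (fun x _ => h.differentiableAt x) (fun x hx => ?_) (convex_closedBall _ _)
    (Metric.mem_closedBall_self (norm_nonneg _)) (by simp [dist_eq_norm])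
  · rwa [mul_assoc, ← sq] at h1
  · rw [← dist_eq_norm]
    refine (hK.dist_le_mul x w).trans ?_
    gcongr
    exact Metric.mem_closedBall.1 hx

/-- The uniform Taylor bound for `η` and the boundedness of the cube give a remainder of order `|r -
s|²` in the supremum norm, hence in `L²`. -/
theorem IsTest.hasDerivAt_dilate {η : E d → ℂ} (h : IsTest η) (z : E d) (s : ℝ) :
    HasDerivAt (fun r : ℝ => toHilb (SQHD.dilate z r η))
      (∑ k, mulOp (fun x => x k - z k) (toHilb (SQHD.dilate z s (testPd k η)))) s := by
  obtain ⟨K, hK0, hK⟩ := h.exists_taylor_bound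
  obtain ⟨D, hD⟩ := isCompact_cube.exists_bound_of_continuousOn (s := cube d)
    (f := fun x : E d => x - z) (by fun_prop)
  set V : ℝ := ((measureUnivNNReal (cubeMeasure d) ^ (2 : ℝ≥0∞).toReal⁻¹ : NNReal) : ℝ)
  have hc : ∀ k, Continuous fun x : E d => x k - z k := fun k =>
    (continuous_coord k).sub continuous_const
  have hcd : ∀ k, Continuous (SQHD.dilate z s (testPd k η)) := fun k =>
    continuous_dilate (h.continuous_testPd k) z s
  have hcm : ∀ k, Continuous fun x : E d =>
      ((x k - z k : ℝ) : ℂ) * SQHD.dilate z s (testPd k η) x := fun k =>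
    (Complex.continuous_ofReal.comp (hc k)).mul (hcd k)
  have e : ∑ k, mulOp (fun x => x k - z k) (toHilb (SQHD.dilate z s (testPd k η))) =
      toHilb fun x => ∑ k, ((x k - z k : ℝ) : ℂ) * SQHD.dilate z s (testPd k η) x := by
    rw [toHilb_sum _ hcm]
    exact Finset.sum_congr rfl fun k _ => mulOp_toHilb (hc k) (hcd k)
  rw [e, hasDerivAt_iff_isLittleO]
  refine Asymptotics.IsBigO.trans_isLittleO (g := fun r : ℝ => ‖r - s‖ ^ 2) ?_
    (Asymptotics.isLittleO_pow_sub_sub s one_lt_two)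
  refine Asymptotics.IsBigO.of_bound (V * (K * D ^ 2)) (Eventually.of_forall fun r => ?_)
  have hcs : Continuous fun x => ∑ k, ((x k - z k : ℝ) : ℂ) * SQHD.dilate z s (testPd k η) x :=
    continuous_finsetSum _ fun k _ => hcm k
  have e2 : ∀ v : Hilb d, (r - s) • v = ((r - s : ℝ) : ℂ) • v := fun v => rfl
  have hcr : Continuous fun x => SQHD.dilate z r η x - SQHD.dilate z s η x :=
    (continuous_dilate h.continuous z r).sub (continuous_dilate h.continuous z s)
  have hcc : Continuous fun x => ((r - s : ℝ) : ℂ) *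
      ∑ k, ((x k - z k : ℝ) : ℂ) * SQHD.dilate z s (testPd k η) x := continuous_const.mul hcs
  rw [e2, ← toHilb_smul hcs, ← toHilb_sub (continuous_dilate h.continuous z r)
    (continuous_dilate h.continuous z s), ← toHilb_sub hcr hcc,
    Real.norm_of_nonneg (by positivity : 0 ≤ ‖r - s‖ ^ 2), mul_assoc]
  refine norm_toHilb_le (hcr.sub hcc) (by positivity) fun x hx => ?_
  have h1 := hK (z + s • (x - z)) (z + r • (x - z))
  have h2 : z + r • (x - z) - (z + s • (x - z)) = (r - s) • (x - z) := by module
  have h3 : ∑ k, ((x k - z k : ℝ) : ℂ) * SQHD.dilate z s (testPd k η) x =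
      fderiv ℝ η (z + s • (x - z)) (x - z) := sum_mul_testPd η (z + s • (x - z)) (x - z)
  rw [h2, map_smul, Complex.real_smul, ← h3] at h1
  refine h1.trans ?_
  rw [norm_smul, mul_pow, mul_assoc]
  refine mul_le_mul_of_nonneg_left ?_ hK0
  rw [mul_comm]
  have := hD x hx
  gcongr

theorem norm_mulOp_coord_le {z : E d} (hz : z ∈ cube d) (k : Fin d) (φ : Hilb d) :
    ‖mulOp (fun x => x k - z k) φ‖ ≤ 2 * ‖φ‖ := by
  refine norm_mulOp_le (hasTaylor_coord k (z k)).continuousOn (fun x hx => ?_) φ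
  rw [abs_le]
  constructor <;> linarith [(hx k).1, (hx k).2, (hz k).1, (hz k).2]

/-- The derivative in `r` is `y·∇η` evaluated at the dilated point; on the cube `|yₖ| ≤ 2`, and
dilation with `r ≥ 1` does not increase the `L²` norm. The bound involves only gradient norms, so it
is stable under limits in `H¹₀`. -/
theorem IsTest.norm_dilate_sub_le {η : E d → ℂ} (h : IsTest η) {z : E d} (hz : z ∈ cube d)
    {s : ℝ} (hs : 1 ≤ s) :
    ‖toHilb (SQHD.dilate z s η) - toHilb η‖ ≤
      (2 * ∑ k, ‖toHilb (testPd k η)‖) * (s - 1) := by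
  have h1 := norm_image_sub_le_of_norm_deriv_le_segment' (a := 1) (b := s)
    (C := 2 * ∑ k, ‖toHilb (testPd k η)‖)
    (fun r _ => (h.hasDerivAt_dilate z r).hasDerivWithinAt) (fun r hr => ?_) s ⟨hs, le_rfl⟩
  · have e : SQHD.dilate z 1 η = η := by funext x; simp [SQHD.dilate]
    rwa [e] at h1
  · rw [Finset.mul_sum]
    refine (norm_sum_le _ _).trans (Finset.sum_le_sum fun k _ => ?_)
    refine (norm_mulOp_coord_le hz k _).trans (mul_le_mul_of_nonneg_left ?_ zero_le_two)
    have hr0 : 0 < r := by linarith [hr.1]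
    have h2 := h.norm_sq_testPd_dilate hz hr.1 k
    rw [testPd_dilate h, toHilb_smul (continuous_dilate (h.continuous_testPd k) z r), norm_smul,
      Complex.norm_real, Real.norm_of_nonneg hr0.le, mul_pow, mul_assoc] at h2
    have h3 := mul_left_cancel₀ (pow_pos hr0 2).ne' h2
    refine le_of_sq_le_sq ?_ (norm_nonneg _)
    rw [h3]
    exact mul_le_of_le_one_left (sq_nonneg _) (inv_le_one_of_one_le₀ (one_le_pow₀ hr.1))

end Dilation

/-! ### The virial inequality on a star-shaped domain. -/

section Virial

open scoped InnerProductSpace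

variable {d : ℕ}

theorem two_mul_re_inner_le (x y : Hilb d) : 2 * (⟪x, y⟫_ℂ).re ≤ ‖x‖ ^ 2 + ‖y‖ ^ 2 := by
  have h1 : (⟪x, y⟫_ℂ).re ≤ ‖x‖ * ‖y‖ := (Complex.re_le_norm _).trans (norm_inner_le_norm x y)
  nlinarith [sq_nonneg (‖x‖ - ‖y‖)]

/-- The form inequality for the difference of a test function and its dilation. -/
theorem IsTest.re_inner_dilate_sub_le {η : E d → ℂ} (h : IsTest η) {z : E d} (hz : z ∈ cube d)
    {G : Fin d → Hilb d} {κ : Hilb d}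
    (hκ : ∀ v W, HasGradH10 v W → ⟪v, κ⟫_ℂ = ∑ k, ⟪W k, G k⟫_ℂ) {s : ℝ} (hs : 1 ≤ s) :
    (⟪toHilb (SQHD.dilate z s η) - toHilb η, κ⟫_ℂ).re ≤
      2⁻¹ * (s ^ 2 * (s ^ d)⁻¹ * ∑ k, ‖toHilb (testPd k η)‖ ^ 2 + ∑ k, ‖G k‖ ^ 2) -
        ∑ k, (⟪toHilb (testPd k η), G k⟫_ℂ).re := by
  rw [inner_sub_left, Complex.sub_re, hκ _ _ h.hasGradH10, hκ _ _ (h.dilate hz hs).hasGradH10,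
    Complex.re_sum, Complex.re_sum]
  refine sub_le_sub_right ?_ _
  rw [Finset.mul_sum, ← Finset.sum_add_distrib, Finset.mul_sum]
  refine Finset.sum_le_sum fun k _ => ?_
  rw [← h.norm_sq_testPd_dilate hz hs k]
  linarith [two_mul_re_inner_le (toHilb (testPd k (SQHD.dilate z s η))) (G k)]

/-- For test functions `η → g` the form inequality tends, at fixed `s`, to a bound with `(s^{2-d} -
1)/2`. Replacing `η` by the fixed `ζ` costs only a multiple of `s - 1`, small when `ζ` is close to
`g`, so the estimate survives differentiation at `s = 1`. -/
theorem re_inner_dilate_sub_le {g : Hilb d} {G : Fin d → Hilb d} {κ : Hilb d}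
    (hg : HasGradH10 g G)
    (hκ : ∀ v W, HasGradH10 v W → ⟪v, κ⟫_ℂ = ∑ k, ⟪W k, G k⟫_ℂ) {ζ : E d → ℂ} (hζ : IsTest ζ)
    {z : E d} (hz : z ∈ cube d) {s : ℝ} (hs : 1 ≤ s) :
    (⟪toHilb (dilate z s ζ) - toHilb ζ, κ⟫_ℂ).re ≤
      2⁻¹ * (s ^ 2 * (s ^ d)⁻¹ - 1) * ∑ k, ‖G k‖ ^ 2 +
        2 * (∑ k, ‖toHilb (testPd k ζ) - G k‖) * ‖κ‖ * (s - 1) := by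
  obtain ⟨η, hη, h1, h2⟩ := hg.exists_seq
  have hlim : Tendsto (fun n => 2⁻¹ * (s ^ 2 * (s ^ d)⁻¹ * ∑ k, ‖toHilb (testPd k (η n))‖ ^ 2 +
      ∑ k, ‖G k‖ ^ 2) - ∑ k, (⟪toHilb (testPd k (η n)), G k⟫_ℂ).re +
      (2 * ∑ k, ‖toHilb (testPd k ζ) - toHilb (testPd k (η n))‖) * (s - 1) * ‖κ‖) atTop
      (𝓝 (2⁻¹ * (s ^ 2 * (s ^ d)⁻¹ * ∑ k, ‖G k‖ ^ 2 + ∑ k, ‖G k‖ ^ 2) -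
        ∑ k, (⟪G k, G k⟫_ℂ).re + (2 * ∑ k, ‖toHilb (testPd k ζ) - G k‖) * (s - 1) * ‖κ‖)) := by
    refine Tendsto.add (Tendsto.sub ?_ ?_) ?_
    · exact ((((tendsto_finsetSum _ fun k _ => (h2 k).norm.pow 2).const_mul _).add_const _).const_mul
        _)
    · exact tendsto_finsetSum _ fun k _ =>
        (Complex.continuous_re.tendsto _).comp ((h2 k).inner tendsto_const_nhds)
    · exact ((((tendsto_finsetSum _ fun k _ => ((h2 k).const_sub _).norm).const_mul _).mul_const
        _).mul_const _)
  have hle : ∀ n, (⟪toHilb (dilate z s ζ) - toHilb ζ, κ⟫_ℂ).re ≤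
      2⁻¹ * (s ^ 2 * (s ^ d)⁻¹ * ∑ k, ‖toHilb (testPd k (η n))‖ ^ 2 +
      ∑ k, ‖G k‖ ^ 2) - ∑ k, (⟪toHilb (testPd k (η n)), G k⟫_ℂ).re +
      (2 * ∑ k, ‖toHilb (testPd k ζ) - toHilb (testPd k (η n))‖) * (s - 1) * ‖κ‖ := by
    intro n
    have h3 := (hη n).re_inner_dilate_sub_le hz hκ hs
    have h4 := (hζ.sub (hη n)).norm_dilate_sub_le hz hs
    have e1 : dilate z s (fun x => ζ x - η n x) = fun x => dilate z s ζ x - dilate z s (η n) x :=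
      rfl
    have e2 : ∀ k, toHilb (testPd k fun x => ζ x - η n x) =
        toHilb (testPd k ζ) - toHilb (testPd k (η n)) := fun k => by
      rw [hζ.testPd_sub (hη n), toHilb_sub (hζ.continuous_testPd k) ((hη n).continuous_testPd k)]
    rw [e1, toHilb_sub (continuous_dilate hζ.continuous z s)
      (continuous_dilate (hη n).continuous z s), toHilb_sub hζ.continuous (hη n).continuous] at h4
    simp only [e2] at h4
    have e3 : toHilb (dilate z s ζ) - toHilb ζ = toHilb (dilate z s (η n)) - toHilb (η n) +
        (toHilb (dilate z s ζ) - toHilb (dilate z s (η n)) - (toHilb ζ - toHilb (η n))) := by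
      abel
    rw [e3, inner_add_left, Complex.add_re]
    refine add_le_add h3 ?_
    exact (Complex.re_le_norm _).trans ((norm_inner_le_norm _ _).trans
      (mul_le_mul_of_nonneg_right h4 (norm_nonneg _)))
  have := ge_of_tendsto' hlim hle
  refine this.trans (le_of_eq ?_)
  simp only [inner_self_eq_ofReal, Complex.ofReal_re]
  ring

theorem le_of_hasDerivWithinAt_of_le {f g : ℝ → ℝ} {f' g' a : ℝ}
    (hf : HasDerivWithinAt f f' (Ici a) a) (hg : HasDerivWithinAt g g' (Ici a) a)
    (ha : f a = g a) (h : ∀ x, a ≤ x → f x ≤ g x) : f' ≤ g' := by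
  have h1 := (hasDerivWithinAt_iff_tendsto_slope' self_notMem_Ioi).1 hf.Ioi_of_Ici
  have h2 := (hasDerivWithinAt_iff_tendsto_slope' self_notMem_Ioi).1 hg.Ioi_of_Ici
  refine le_of_tendsto_of_tendsto h1 h2 ?_
  filter_upwards [self_mem_nhdsWithin] with x hx
  rw [mem_Ioi] at hx
  rw [slope_def_field, slope_def_field, ha]
  exact div_le_div_of_nonneg_right (sub_le_sub_right (h x hx.le) _) (sub_nonneg.2 hx.le)

theorem hasDerivAt_sq_mul_inv_pow (d : ℕ) :
    HasDerivAt (fun s : ℝ => s ^ 2 * (s ^ d)⁻¹) (2 - d) 1 := by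
  have h1 := (hasDerivAt_pow 2 (1 : ℝ)).mul ((hasDerivAt_pow d (1 : ℝ)).inv (by simp))
  refine h1.congr_deriv ?_
  simp
  ring

/-- Both sides of the previous inequality vanish at `s = 1`, so their right derivatives there are
ordered; `s^{2-d}` contributes `2 - d`. -/
theorem re_inner_radial_le {g : Hilb d} {G : Fin d → Hilb d} {κ : Hilb d}
    (hg : HasGradH10 g G)
    (hκ : ∀ v W, HasGradH10 v W → ⟪v, κ⟫_ℂ = ∑ k, ⟪W k, G k⟫_ℂ) {ζ : E d → ℂ} (hζ : IsTest ζ)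
    {z : E d} (hz : z ∈ cube d) :
    (⟪∑ k, mulOp (fun x => x k - z k) (toHilb (testPd k ζ)), κ⟫_ℂ).re ≤
      2⁻¹ * (2 - d) * ∑ k, ‖G k‖ ^ 2 + 2 * (∑ k, ‖toHilb (testPd k ζ) - G k‖) * ‖κ‖ := by
  have e : ∀ ξ, dilate z 1 ξ = ξ := fun ξ => by funext x; simp [dilate]
  have h1 := (hζ.hasDerivAt_dilate z 1).sub_const (toHilb ζ)
  simp only [e] at h1
  have h2 : HasDerivAt (fun s => (⟪toHilb (dilate z s ζ) - toHilb ζ, κ⟫_ℂ).re)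
      (⟪∑ k, mulOp (fun x => x k - z k) (toHilb (testPd k ζ)), κ⟫_ℂ).re 1 := by
    have h3 := h1.inner (𝕜 := ℂ) (hasDerivAt_const (1 : ℝ) κ)
    have h4 := (Complex.reCLM.hasFDerivAt.comp_hasDerivAt (1 : ℝ) h3)
    refine h4.congr_deriv ?_
    simp
  have h3 := ((((hasDerivAt_sq_mul_inv_pow d).sub_const 1).const_mul 2⁻¹).mul_const
    (∑ k, ‖G k‖ ^ 2)).add (((hasDerivAt_id (1 : ℝ)).sub_const 1).const_mul
      (2 * (∑ k, ‖toHilb (testPd k ζ) - G k‖) * ‖κ‖))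
  rw [mul_one] at h3
  refine le_of_hasDerivWithinAt_of_le h2.hasDerivWithinAt h3.hasDerivWithinAt ?_ fun s hs =>
    re_inner_dilate_sub_le hg hκ hζ hz hs
  simp [e]

/-- A Rellich–Pohozaev identity in which the boundary term is replaced by its sign: comparing `g`
with its dilations inside `H¹₀` avoids any regularity or trace at the boundary. The `d` of `rad`
compensates for the `-d` of the scaling and leaves the constant 2. -/
theorem isVirial_coord {z : E d} (hz : z ∈ cube d) :
    IsVirial (H := Hilb d) HasGradH10 (fun k : Fin d => mulOp fun x => x k - z k) where
  antisymm := by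
    intro v W g G hv hg
    have h1 : ∀ k, ⟪v, mulOp (fun x => x k - z k) (G k)⟫_ℂ + ⟪v, g⟫_ℂ =
        -⟪mulOp (fun x => x k - z k) (W k), g⟫_ℂ := by
      intro k
      have h2 := hv.inner_eq ((hasTaylor_coord k (z k)).isMultiplier.map _ _ hg) k
      -- The product rule for `yₖ g` contributes `g` once for each coordinate; the sum over `k`
      -- gives the `d` in `rad`.
      rw [inner_add_right] at h2
      have h3 : mulOp (fun _ : E d => if k = k then (1 : ℝ) else 0) g = g := by
        simp [mulOp_const]
      rw [h3] at h2
      rw [h2, inner_mulOp (hasTaylor_coord k (z k)).continuousOn]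
    have h2 : ∑ k, (⟪v, mulOp (fun x => x k - z k) (G k)⟫_ℂ + ⟪v, g⟫_ℂ) =
        ∑ k, -⟪mulOp (fun x => x k - z k) (W k), g⟫_ℂ := Finset.sum_congr rfl fun k _ => h1 k
    rw [Finset.sum_add_distrib, Finset.sum_neg_distrib, Finset.sum_const, Finset.card_univ,
      Fintype.card_fin, nsmul_eq_mul] at h2
    simp only [rad, inner_add_left, inner_add_right, inner_smul_left, inner_smul_right, sum_inner,
      inner_sum, map_ofNat, map_natCast]
    linear_combination 2 * h2
  virial := by
    intro g G κ hg hκ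
    obtain ⟨η, hη, h1, h2⟩ := hg.exists_seq
    have hlim1 : Tendsto (fun n =>
        (⟪∑ k, mulOp (fun x => x k - z k) (toHilb (testPd k (η n))), κ⟫_ℂ).re) atTop
        (𝓝 (⟪∑ k, mulOp (fun x => x k - z k) (G k), κ⟫_ℂ).re) :=
      (Complex.continuous_re.tendsto _).comp (Tendsto.inner (tendsto_finsetSum _ fun k _ =>
        ((mulOp fun x => x k - z k).continuous.tendsto _).comp (h2 k)) tendsto_const_nhds)
    have hlim2 : Tendsto (fun n => 2⁻¹ * (2 - d) * ∑ k, ‖G k‖ ^ 2 +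
        2 * (∑ k, ‖toHilb (testPd k (η n)) - G k‖) * ‖κ‖) atTop
        (𝓝 (2⁻¹ * (2 - d) * ∑ k, ‖G k‖ ^ 2 + 2 * (∑ k, ‖G k - G k‖) * ‖κ‖)) :=
      (((tendsto_finsetSum _ fun k _ => ((h2 k).sub_const _).norm).const_mul _).mul_const
        _).const_add _
    have h3 := le_of_tendsto_of_tendsto' hlim1 hlim2
      fun n => re_inner_radial_le hg hκ (hη n) hz
    simp only [sub_self, norm_zero, Finset.sum_const_zero, mul_zero, zero_mul, add_zero] at h3
    have h4 := congrArg Complex.re (hκ g G hg)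
    rw [Complex.re_sum] at h4
    simp only [inner_self_eq_ofReal, Complex.ofReal_re] at h4
    rw [rad, inner_add_left, inner_smul_left, inner_smul_left, map_ofNat, map_natCast,
      Complex.add_re, ← Complex.ofReal_ofNat, ← Complex.ofReal_natCast, Complex.re_ofReal_mul,
      Complex.re_ofReal_mul, h4]
    linarith

end Virial

/-! ### The time change and the coefficients that it produces. -/

section Schedule

variable {T S : ℝ} {α β γ ψ χ u τ : ℝ → ℝ}

/-- Up to the supremum of the times to which `u` is integrable, `u` is a continuous function of its
own primitive. Beyond it the integral takes its default value 0, so `τ = 0` and `u` is constant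
there, hence integrable after all. -/
theorem IsSchedule.integrableOn (hs : StrongIdealScaling T α β γ ψ χ)
    (h : IsSchedule T S α β u τ) (hS : 0 ≤ S) : IntegrableOn u (Icc 0 S) := by
  have hβ : ContinuousOn β (Icc 0 T) := fun s hs' => (hs.beta s hs').continuousWithinAt
  have hG : ContinuousOn (fun s => Real.exp (-(α s + β s))) (Icc 0 T) :=
    Real.continuous_exp.comp_continuousOn (hs.cont.add hβ).neg
  obtain ⟨C, hC⟩ := isCompact_Icc.exists_bound_of_continuousOn hG
  have hu : ∀ t ∈ Icc 0 S, ‖u t‖ ≤ C := fun t ht => by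
    rw [h.rate t ht]; exact hC _ (h.mem t ht)
  set J := {t | t ∈ Icc 0 S ∧ IntegrableOn u (Icc 0 t)}
  have h0 : (0 : ℝ) ∈ J := ⟨⟨le_rfl, hS⟩, by simp⟩
  have hbdd : BddAbove J := ⟨S, fun t ht => ht.1.2⟩
  have hcont : ContinuousOn u (Ioo 0 (sSup J)) := by
    intro x hx
    obtain ⟨t, ht, hxt⟩ := exists_lt_of_lt_csSup ⟨0, h0⟩ hx.2
    have h1 := intervalIntegral.continuousOn_primitive_interval (f := u) (μ := volume) (a := 0)
      (b := t) (by rw [uIcc_of_le ht.1.1]; exact ht.2)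
    rw [uIcc_of_le ht.1.1] at h1
    have hsub : ∀ y ∈ Icc 0 t, y ∈ Icc 0 S := fun y hy => ⟨hy.1, hy.2.trans ht.1.2⟩
    have h2 : ContinuousOn τ (Icc 0 t) := h1.congr fun y hy => h.time y (hsub y hy)
    have h3 : ContinuousOn u (Icc 0 t) := (hG.comp h2 fun y hy => h.mem y (hsub y hy)).congr
      fun y hy => h.rate y (hsub y hy)
    exact (h3.continuousAt (Icc_mem_nhds hx.1 hxt)).continuousWithinAt
  have hle : sSup J ≤ S := csSup_le ⟨0, h0⟩ fun t ht => ht.1.2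
  have hI1 : IntegrableOn u (Ioo 0 (sSup J)) := by
    refine ⟨hcont.aestronglyMeasurable measurableSet_Ioo, ?_⟩
    refine HasFiniteIntegral.restrict_of_bounded (C := C) measure_Ioo_lt_top ?_
    refine (ae_restrict_iff' measurableSet_Ioo).2 (Eventually.of_forall fun x hx => ?_)
    exact hu x ⟨hx.1.le, hx.2.le.trans hle⟩
  have hI2 : IntegrableOn u (Ioo (sSup J) S) := by
    refine (integrableOn_const (C := Real.exp (-(α 0 + β 0))) measure_Ioo_lt_top.ne).congr_fun ?_
      measurableSet_Ioo
    intro x hx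
    have hx0 : 0 ≤ x := (le_csSup hbdd h0).trans hx.1.le
    have hxm : x ∈ Icc 0 S := ⟨hx0, hx.2.le⟩
    have hnot : ¬ IntervalIntegrable u volume 0 x := fun hc =>
      absurd (le_csSup hbdd (show x ∈ J from
        ⟨hxm, (intervalIntegrable_iff_integrableOn_Icc_of_le hx0).1 hc⟩)) (not_le.2 hx.1)
    have h2 := h.time x hxm
    rw [intervalIntegral.integral_undef hnot] at h2
    simp only [h.rate x hxm, h2]
  have h3 : IntegrableOn u ({0, sSup J, S} : Set ℝ) :=
    IntegrableOn.of_measure_zero ((Set.toFinite _).measure_zero _)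
  refine ((hI1.union hI2).union h3).mono_set fun x hx => ?_
  simp only [mem_union, mem_Ioo, mem_insert_iff, mem_singleton_iff]
  rcases eq_or_lt_of_le hx.1 with h4 | h4
  · right; left; exact h4.symm
  rcases eq_or_lt_of_le hx.2 with h5 | h5
  · right; right; right; exact h5
  rcases lt_trichotomy x (sSup J) with h6 | h6 | h6
  · left; left; exact ⟨h4, h6⟩
  · right; right; left; exact h6
  · left; right; exact ⟨h6, h5⟩

theorem IsSchedule.hasDerivWithinAt (hs : StrongIdealScaling T α β γ ψ χ)
    (h : IsSchedule T S α β u τ) {t : ℝ} (ht : t ∈ Icc 0 S) :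
    HasDerivWithinAt τ (u t) (Icc 0 S) t := by
  have hS : 0 ≤ S := ht.1.trans ht.2
  have hI := h.integrableOn hs hS
  have hβ : ContinuousOn β (Icc 0 T) := fun s hs' => (hs.beta s hs').continuousWithinAt
  have hG : ContinuousOn (fun s => Real.exp (-(α s + β s))) (Icc 0 T) :=
    Real.continuous_exp.comp_continuousOn (hs.cont.add hβ).neg
  have h1 := intervalIntegral.continuousOn_primitive_interval (f := u) (μ := volume) (a := 0)
    (b := S) (by rwa [uIcc_of_le hS])
  rw [uIcc_of_le hS] at h1
  have h2 : ContinuousOn τ (Icc 0 S) := h1.congr fun y hy => h.time y hy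
  have h3 : ContinuousOn u (Icc 0 S) := (hG.comp h2 h.mem).congr h.rate
  have : Fact (t ∈ Icc 0 S) := ⟨ht⟩
  have h4 := intervalIntegral.integral_hasDerivWithinAt_right (f := u) (a := 0) (b := t)
    (s := Icc 0 S) (t := Icc 0 S)
    ((intervalIntegrable_iff_integrableOn_Icc_of_le ht.1).2
      (hI.mono_set (Icc_subset_Icc_right ht.2)))
    (h3.stronglyMeasurableAtFilter_nhdsWithin measurableSet_Icc t) (h3 t ht)
  exact h4.congr_of_mem (fun y hy => h.time y hy) ht

theorem eq_of_hasDerivWithinAt_eq_zero {g : ℝ → ℝ}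
    (h : ∀ t ∈ Icc 0 S, HasDerivWithinAt g 0 (Icc 0 S) t) {t : ℝ} (ht : t ∈ Icc 0 S) :
    g t = g 0 := by
  have h1 := Convex.norm_image_sub_le_of_norm_hasDerivWithin_le (C := 0) h
    (fun x _ => by simp) (convex_Icc 0 S) ⟨le_rfl, ht.1.trans ht.2⟩ ht
  rw [zero_mul, norm_le_zero_iff, sub_eq_zero] at h1
  exact h1

/-- Under strong ideal scaling, the schedule makes `e^β` grow with unit speed, and it determines
the coefficients of the Lindblad equation. -/
theorem IsSchedule.coefficients (hs : StrongIdealScaling T α β γ ψ χ)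
    (h : IsSchedule T S α β u τ) {t : ℝ} (ht : t ∈ Icc 0 S) :
    Real.exp (β (τ t)) = Real.exp (β 0) + t ∧
    u t * Real.exp (ψ (τ t)) = Real.exp (β 0 - γ 0) / (Real.exp (β 0) + t) ^ 2 ∧
    u t * Real.exp (χ (τ t)) = (Real.exp (β 0) + t) / Real.exp (β 0 - γ 0) := by
  have hτ0 : τ 0 = 0 := by
    rw [h.time 0 ⟨le_rfl, ht.1.trans ht.2⟩, intervalIntegral.integral_same]
  have hβτ : ∀ r ∈ Icc 0 S, HasDerivWithinAt (fun r => β (τ r)) (Real.exp (α (τ r)) * u r)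
      (Icc 0 S) r := fun r hr =>
    (hs.beta _ (h.mem r hr)).comp r (h.hasDerivWithinAt hs hr) h.mem
  have hγτ : ∀ r ∈ Icc 0 S, HasDerivWithinAt (fun r => γ (τ r)) (Real.exp (α (τ r)) * u r)
      (Icc 0 S) r := fun r hr =>
    (hs.gamma _ (h.mem r hr)).comp r (h.hasDerivWithinAt hs hr) h.mem
  -- Two conserved quantities determine everything: `γ - β`, because both have the derivative `e^α`,
  -- and `e^β - t`, because `e^β e^α u = 1`.
  have h1 := eq_of_hasDerivWithinAt_eq_zero (g := fun r => γ (τ r) - β (τ r))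
    (fun r hr => ((hγτ r hr).sub (hβτ r hr)).congr_deriv (sub_self _)) ht
  have h2 := eq_of_hasDerivWithinAt_eq_zero (g := fun r => Real.exp (β (τ r)) - r)
    (fun r hr => ((hβτ r hr).exp.sub (hasDerivWithinAt_id r _)).congr_deriv (by
      rw [h.rate r hr, ← Real.exp_add, ← Real.exp_add, sub_eq_zero, Real.exp_eq_one_iff]
      ring)) ht
  simp only [hτ0, sub_zero] at h1 h2
  have h3 : Real.exp (β (τ t)) = Real.exp (β 0) + t := by linarith
  have h4 : γ (τ t) = β (τ t) - (β 0 - γ 0) := by linarith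
  refine ⟨h3, ?_, ?_⟩
  · rw [← h3, h.rate t ht, hs.psi _ (h.mem t ht), h4, ← Real.exp_add, ← Real.exp_nat_mul,
      ← Real.exp_sub]
    congr 1
    push_cast
    ring
  · rw [← h3, h.rate t ht, hs.chi _ (h.mem t ht), h4, ← Real.exp_add, ← Real.exp_sub]
    congr 1
    ring

end Schedule

/-! ### The Heisenberg picture of the generator. -/

section Dual

open scoped InnerProductSpace

variable {H : Type*} [NormedAddCommGroup H] [InnerProductSpace ℂ H]

theorem comm_eq (A B : H →L[ℂ] H) : comm A B = A * B - B * A := rfl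

theorem re_inner_comm_comm {O F : H →L[ℂ] H} (hO : ∀ x y, ⟪O x, y⟫_ℂ = ⟪x, O y⟫_ℂ)
    (hF : ∀ x y, ⟪F x, y⟫_ℂ = ⟪x, F y⟫_ℂ) (φ : H) :
    (⟪φ, comm (comm O F) F φ⟫_ℂ).re = 2 * dcomm O F φ := by
  simp only [comm_eq, sub_mul, mul_sub, sub_apply, mul_apply_eq_comp, inner_sub_right,
    Complex.sub_re, dcomm]
  rw [← hO, ← hF φ (O (F φ)), ← hF φ (F (O φ)), ← hF (F φ), re_inner_comm (F (F φ))]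
  ring

variable [CompleteSpace H]

/-- The real part of the expectation `tr(X ρ)`. -/
def omega (ρ X : H →L[ℂ] H) : ℝ := (trace (X * ρ)).re

theorem omega_add {ρ : H →L[ℂ] H} (hρ : IsTraceClass ρ) (X Z : H →L[ℂ] H) :
    omega ρ (X + Z) = omega ρ X + omega ρ Z := by
  rw [omega, add_mul, trace_add (hρ.mul_left X) (hρ.mul_left Z), Complex.add_re]; rfl

theorem omega_sub {ρ : H →L[ℂ] H} (hρ : IsTraceClass ρ) (X Z : H →L[ℂ] H) :
    omega ρ (X - Z) = omega ρ X - omega ρ Z := by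
  rw [omega, sub_mul, trace_sub (hρ.mul_left X) (hρ.mul_left Z), Complex.sub_re]; rfl

theorem omega_smul (ρ : H →L[ℂ] H) (c : ℝ) (X : H →L[ℂ] H) :
    omega ρ ((c : ℂ) • X) = c * omega ρ X := by
  rw [omega, smul_mul_assoc, trace_smul, Complex.re_ofReal_mul]; rfl

theorem IsState.omega_one {ρ : H →L[ℂ] H} (hρ : IsState ρ) : omega ρ 1 = 1 := by
  rw [omega, one_mul, hρ.trace_one, Complex.one_re]

theorem IsState.omega_le {ρ : H →L[ℂ] H} (hρ : IsState ρ) {X Z : H →L[ℂ] H}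
    (h : ∀ φ, (⟪φ, X φ⟫_ℂ).re ≤ (⟪φ, Z φ⟫_ℂ).re) : omega ρ X ≤ omega ρ Z :=
  hρ.re_trace_mul_le h

theorem IsTraceClass.comm {ρ : H →L[ℂ] H} (hρ : IsTraceClass ρ) (F : H →L[ℂ] H) :
    IsTraceClass (comm F ρ) := (hρ.mul_left F).sub (hρ.mul_right F)

theorem trace_mul_comm_op {ρ : H →L[ℂ] H} (hρ : IsTraceClass ρ) (O F : H →L[ℂ] H) :
    trace (O * comm F ρ) = trace (comm O F * ρ) := by
  rw [comm_eq, comm_eq, mul_sub, sub_mul, ← mul_assoc, ← mul_assoc,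
    trace_sub (hρ.mul_left _) ((hρ.mul_left O).mul_right F),
    trace_sub (hρ.mul_left _) (hρ.mul_left _), ← (hρ.mul_left O).trace_mul_comm F, mul_assoc F]

variable {m : ℕ}

/-- The operator dual to `O = R M` under the Lindblad generator with kinetic coefficient `p`,
potential coefficient `r` and noise coefficient `n`. -/
def genDual (p r n : ℝ) (κ F : H →L[ℂ] H) (Fs : Fin m → H →L[ℂ] H) (M O : H →L[ℂ] H) :
    H →L[ℂ] H :=
  (((p / 2 : ℝ) : ℂ) * Complex.I) • (κ * M - star M * κ) +
    ((r : ℂ) * -Complex.I) • comm O F +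
    ((n / 2 : ℝ) : ℂ) • (comm (comm O F) F -
      ((1 / (m : ℝ) : ℝ) : ℂ) • ∑ j, comm (comm O (Fs j)) (Fs j))

theorem re_inner_genDual {p r n : ℝ} {κ F : H →L[ℂ] H} {Fs : Fin m → H →L[ℂ] H}
    {M O : H →L[ℂ] H} (hκ : ∀ x y, ⟪κ x, y⟫_ℂ = ⟪x, κ y⟫_ℂ)
    (hF : ∀ x y, ⟪F x, y⟫_ℂ = ⟪x, F y⟫_ℂ) (hFs : ∀ j x y, ⟪Fs j x, y⟫_ℂ = ⟪x, Fs j y⟫_ℂ)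
    (hO : ∀ x y, ⟪O x, y⟫_ℂ = ⟪x, O y⟫_ℂ) (φ : H) :
    (⟪φ, genDual p r n κ F Fs M O φ⟫_ℂ).re = genForm p r n κ F Fs M O φ := by
  have h1 : ∀ (c : ℝ) (x y : H), (((c : ℂ) * Complex.I) * (⟪y, x⟫_ℂ - ⟪x, y⟫_ℂ)).re =
      2 * c * (⟪x, y⟫_ℂ).im := by
    intro c x y
    simp only [Complex.mul_re, Complex.mul_im, Complex.ofReal_re, Complex.ofReal_im, Complex.I_re,
      Complex.I_im, Complex.sub_re, Complex.sub_im]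
    rw [im_inner_comm y x]
    ring
  have h2 : ⟪φ, (κ * M - star M * κ) φ⟫_ℂ = ⟪κ φ, M φ⟫_ℂ - ⟪M φ, κ φ⟫_ℂ := by
    rw [sub_apply, mul_apply_eq_comp, mul_apply_eq_comp, inner_sub_right, ← hκ,
      ContinuousLinearMap.star_eq_adjoint, ContinuousLinearMap.adjoint_inner_right]
  have h3 : ⟪φ, comm O F φ⟫_ℂ = ⟪O φ, F φ⟫_ℂ - ⟪F φ, O φ⟫_ℂ := by
    rw [comm_eq, sub_apply, mul_apply_eq_comp, mul_apply_eq_comp, inner_sub_right, ← hO, ← hF φ (O φ)]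
  have h4 : (r : ℂ) * -Complex.I * (⟪O φ, F φ⟫_ℂ - ⟪F φ, O φ⟫_ℂ) =
      (r : ℂ) * Complex.I * (⟪F φ, O φ⟫_ℂ - ⟪O φ, F φ⟫_ℂ) := by ring
  have h5 : genDual p r n κ F Fs M O φ = (((p / 2 : ℝ) : ℂ) * Complex.I) • (κ * M - star M * κ) φ +
      ((r : ℂ) * -Complex.I) • comm O F φ + ((n / 2 : ℝ) : ℂ) • (comm (comm O F) F φ -
        ((1 / (m : ℝ) : ℝ) : ℂ) • ∑ j, comm (comm O (Fs j)) (Fs j) φ) := by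
    rw [← sum_apply]; rfl
  rw [h5, inner_add_right, inner_add_right, inner_smul_right, inner_smul_right,
    inner_smul_right, inner_sub_right, inner_smul_right, inner_sum, h2, h3, h4, Complex.add_re,
    Complex.add_re, h1, h1, Complex.re_ofReal_mul, Complex.sub_re, Complex.re_ofReal_mul,
    Complex.re_sum, re_inner_comm_comm hO hF, Finset.sum_congr rfl fun j _ =>
      re_inner_comm_comm hO (hFs j) φ, ← Finset.mul_sum, genForm]
  ring

end Dual

/-! ### The evolution of regularized expectations along a solution. -/

section Evolution

open scoped InnerProductSpace

variable {d m : ℕ}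

/-- The trace of `R M [Δ, ρ]` for a resolvent `R` and symmetric `R M`. -/
theorem IsLaplacianComm.trace_mul {ρ D : Hilb d →L[ℂ] Hilb d} (hD : IsLaplacianComm ρ D)
    (hρ : IsTraceClass ρ) {ε : ℝ} {R : Hilb d →L[ℂ] Hilb d} {N : Fin d → Hilb d →L[ℂ] Hilb d}
    (hR : IsResolvent (H := Hilb d) HasGradH10 ε R N) {M O : Hilb d →L[ℂ] Hilb d}
    (hO : O = R * M) (hO' : O = star M * R) :
    trace (O * D) = trace ((yosida ε R * M - star M * yosida ε R) * ρ) := by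
  obtain ⟨A, B, hA, hB, h1, h2, rfl⟩ := hD
  -- The resolvent absorbs the Laplacian on either side of `ρ`, leaving the bounded operator `yosida
  -- ε R`.
  have e1 : R * A = -(yosida ε R * ρ) := by
    ext1 φ
    exact hR.apply_laplacian (h1 φ)
  have e2 : B * R = -(ρ * yosida ε R) := by
    ext1 φ
    have := h2 _ _ (hR.hasLaplacian φ)
    rw [map_neg] at this
    exact this
  -- For `Δρ` the factorization of `O` with `R` on the right is used; for `ρΔ` the one with `R` on
  -- the left, after moving `R` around the trace.
  have t1 : trace (O * A) = -trace (star M * yosida ε R * ρ) := by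
    rw [hO', mul_assoc, e1, mul_neg, trace_neg, mul_assoc]
  have t2 : trace (O * B) = -trace (yosida ε R * M * ρ) := by
    rw [hO, mul_assoc, (hB.mul_left M).trace_mul_comm R, mul_assoc, e2, mul_neg, trace_neg,
      ← mul_assoc, ← (hρ.mul_left M).trace_mul_comm, mul_assoc (yosida ε R)]
  rw [mul_sub, trace_sub (hA.mul_left O) (hB.mul_left O), t1, t2, sub_mul,
    trace_sub (hρ.mul_left _) (hρ.mul_left _)]
  ring

theorem trace_mul_generator {f : Fin m → E d → ℝ} {u η ψ χ : ℝ} {ρ D : Hilb d →L[ℂ] Hilb d}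
    (hD : IsLaplacianComm ρ D)
    (hρ : IsTraceClass ρ) {ε : ℝ} {R : Hilb d →L[ℂ] Hilb d} {N : Fin d → Hilb d →L[ℂ] Hilb d}
    (hR : IsResolvent (H := Hilb d) HasGradH10 ε R N) {M O : Hilb d →L[ℂ] Hilb d}
    (hO : O = R * M) (hO' : O = star M * R) :
    trace (O * (((u : ℝ) : ℂ) • genGD f ψ χ ρ D + ((u ^ 2 * η : ℝ) : ℂ) • genNoise f χ ρ)) =
      trace (genDual (u * Real.exp ψ) (u * Real.exp χ) (u ^ 2 * η * Real.exp (2 * χ)) (yosida ε R)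
        (mulOp (avg f)) (fun j => mulOp (f j)) M O * ρ) := by
  have hDt : IsTraceClass D := by
    obtain ⟨A, B, hA, hB, -, -, rfl⟩ := hD
    exact hA.sub hB
  have hc : ∀ F : Hilb d →L[ℂ] Hilb d, IsTraceClass (comm F (comm F ρ)) := fun F =>
    (hρ.comm F).comm F
  have hn : ∀ F : Hilb d →L[ℂ] Hilb d,
      trace (O * comm F (comm F ρ)) = trace (comm (comm O F) F * ρ) := fun F => by
    rw [trace_mul_comm_op (hρ.comm F), trace_mul_comm_op hρ]
  have hsum : IsTraceClass (∑ j, comm (mulOp (f j)) (comm (mulOp (f j)) ρ)) :=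
    IsTraceClass.sum _ fun j => hc _
  have hN : IsTraceClass (comm (mulOp (avg f)) (comm (mulOp (avg f)) ρ) -
      ((1 / (m : ℝ) : ℝ) : ℂ) • ∑ j, comm (mulOp (f j)) (comm (mulOp (f j)) ρ)) :=
    (hc _).sub (hsum.smul _)
  have hG : IsTraceClass (((Real.exp ψ * (-1 / 2) : ℝ) : ℂ) • D +
      ((Real.exp χ : ℝ) : ℂ) • comm (mulOp (avg f)) ρ) :=
    (hDt.smul _).add ((hρ.comm _).smul _)
  have l1 : trace (O * (((u : ℝ) : ℂ) • genGD f ψ χ ρ D + ((u ^ 2 * η : ℝ) : ℂ) • genNoise f χ ρ)) =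
      (u : ℂ) * (-Complex.I * (((Real.exp ψ * (-1 / 2) : ℝ) : ℂ) * trace (O * D) +
        ((Real.exp χ : ℝ) : ℂ) * trace (O * comm (mulOp (avg f)) ρ))) +
      ((u ^ 2 * η : ℝ) : ℂ) * (((Real.exp (2 * χ) / 2 : ℝ) : ℂ) *
        (trace (O * comm (mulOp (avg f)) (comm (mulOp (avg f)) ρ)) -
          ((1 / (m : ℝ) : ℝ) : ℂ) *
            ∑ j, trace (O * comm (mulOp (f j)) (comm (mulOp (f j)) ρ)))) := by
    rw [genGD, genNoise, mul_add, mul_smul_comm, mul_smul_comm, mul_smul_comm, mul_smul_comm,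
      trace_add ((((hG.mul_left O).smul _).smul _)) (((hN.mul_left O).smul _).smul _),
      trace_smul, trace_smul, trace_smul, trace_smul, mul_add, mul_sub, mul_smul_comm,
      mul_smul_comm, mul_smul_comm, trace_add ((hDt.mul_left O).smul _)
        (((hρ.comm _).mul_left O).smul _), trace_sub ((hc _).mul_left O)
        ((hsum.mul_left O).smul _), trace_smul, trace_smul, trace_smul, Finset.mul_sum,
      trace_sum _ fun j => (hc _).mul_left O]
  have l2 : trace (genDual (u * Real.exp ψ) (u * Real.exp χ) (u ^ 2 * η * Real.exp (2 * χ))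
        (yosida ε R) (mulOp (avg f)) (fun j => mulOp (f j)) M O * ρ) =
      (((u * Real.exp ψ / 2 : ℝ) : ℂ) * Complex.I) *
        trace ((yosida ε R * M - star M * yosida ε R) * ρ) +
      (((u * Real.exp χ : ℝ) : ℂ) * -Complex.I) * trace (comm O (mulOp (avg f)) * ρ) +
      ((u ^ 2 * η * Real.exp (2 * χ) / 2 : ℝ) : ℂ) *
        (trace (comm (comm O (mulOp (avg f))) (mulOp (avg f)) * ρ) -
        ((1 / (m : ℝ) : ℝ) : ℂ) *
          ∑ j, trace (comm (comm O (mulOp (f j))) (mulOp (f j)) * ρ)) := by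
    have e : ∀ X : Hilb d →L[ℂ] Hilb d, IsTraceClass (X * ρ) := hρ.mul_left
    rw [genDual, add_mul, add_mul, trace_add ?_ (e _), trace_add (e _) (e _), smul_mul_assoc,
      smul_mul_assoc, smul_mul_assoc, trace_smul, trace_smul, trace_smul, sub_mul (comm (comm O _) _) _ ρ,
      trace_sub (e _) (e _), smul_mul_assoc, trace_smul, Finset.sum_mul, trace_sum _ fun j => e _]
    rw [← add_mul]
    exact e _
  rw [l1, l2, hD.trace_mul hρ hR hO hO', trace_mul_comm_op hρ, hn]
  simp only [hn]
  push_cast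
  ring

/-- The Heisenberg equation for observables of the form `R M`. -/
theorem IsSolution.hasDerivWithinAt_omega {f : Fin m → E d → ℝ} {η S : ℝ} {ψ χ u τ : ℝ → ℝ}
    {ρ₀ : Hilb d →L[ℂ] Hilb d} {ρ : ℝ → Hilb d →L[ℂ] Hilb d}
    (h : IsSolution f η S ψ χ u τ ρ₀ ρ) (hS : 0 < S) {t : ℝ} (ht : t ∈ Icc 0 S) {ε : ℝ}
    {R : Hilb d →L[ℂ] Hilb d} {N : Fin d → Hilb d →L[ℂ] Hilb d}
    (hR : IsResolvent (H := Hilb d) HasGradH10 ε R N) {M O : Hilb d →L[ℂ] Hilb d}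
    (hO : O = R * M) (hO' : O = star M * R) :
    HasDerivWithinAt (fun s => omega (ρ s) O)
      (omega (ρ t) (genDual (u t * Real.exp (ψ (τ t))) (u t * Real.exp (χ (τ t)))
        (u t ^ 2 * η * Real.exp (2 * χ (τ t))) (yosida ε R)
        (mulOp (avg f)) (fun j => mulOp (f j)) M O)) (Icc 0 S) t := by
  obtain ⟨D, hD, hd⟩ := h.eqn t ht
  have h1 := hd.hasDerivWithinAt_trace (fun s hs => (h.state s hs).traceClass) hS ht O
  rw [trace_mul_generator hD (h.state t ht).traceClass hR hO hO'] at h1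
  exact h1

theorem IsResolvent.yosida_symm {ε : ℝ} {R : Hilb d →L[ℂ] Hilb d}
    {N : Fin d → Hilb d →L[ℂ] Hilb d} (hR : IsResolvent (H := Hilb d) HasGradH10 ε R N)
    (x y : Hilb d) : ⟪yosida ε R x, y⟫_ℂ = ⟪x, yosida ε R y⟫_ℂ := by
  rw [yosida_apply, yosida_apply, inner_smul_left, inner_smul_right, Complex.conj_ofReal,
    inner_sub_left, inner_sub_right, hR.symm]

theorem eq_star_mul_of_symm {R M : Hilb d →L[ℂ] Hilb d}
    (hR : ∀ x y, ⟪R x, y⟫_ℂ = ⟪x, R y⟫_ℂ)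
    (h : ∀ x y, ⟪(R * M) x, y⟫_ℂ = ⟪x, (R * M) y⟫_ℂ) : R * M = star M * R := by
  ext1 y
  refine ext_inner_left ℂ fun x => ?_
  rw [← h, mul_apply_eq_comp, mul_apply_eq_comp, ContinuousLinearMap.star_eq_adjoint,
    ContinuousLinearMap.adjoint_inner_right, hR]

theorem IsResolvent.mul_mul_symm {ε : ℝ} {R : Hilb d →L[ℂ] Hilb d}
    {N : Fin d → Hilb d →L[ℂ] Hilb d} (hR : IsResolvent (H := Hilb d) HasGradH10 ε R N)
    {Q : Hilb d →L[ℂ] Hilb d} (hQ : ∀ x y, ⟪Q x, y⟫_ℂ = ⟪x, Q y⟫_ℂ) (x y : Hilb d) :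
    ⟪(R * (Q * R)) x, y⟫_ℂ = ⟪x, (R * (Q * R)) y⟫_ℂ := by
  simp only [mul_apply_eq_comp]
  rw [hR.symm, hQ, hR.symm]

theorem IsResolvent.mul_radOp_symm {ε : ℝ} {R : Hilb d →L[ℂ] Hilb d}
    {N : Fin d → Hilb d →L[ℂ] Hilb d} (hR : IsResolvent (H := Hilb d) HasGradH10 ε R N)
    {Y : Fin d → Hilb d →L[ℂ] Hilb d} (hV : IsVirial (H := Hilb d) HasGradH10 Y) (x y : Hilb d) :
    ⟪(R * radOp Y R N) x, y⟫_ℂ = ⟪x, (R * radOp Y R N) y⟫_ℂ := by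
  simp only [mul_apply_eq_comp]
  have h1 := hV.antisymm _ _ _ _ (hR.mem x) (hR.mem y)
  rw [hR.symm, ← hR.symm x, radOp_apply, radOp_apply, inner_smul_left, inner_smul_right, h1]
  simp

end Evolution

/-! ### The Lyapunov function of mixed states. -/

section Lyapunov

open scoped InnerProductSpace

variable {d m : ℕ}

/-- The operators that enter the Lyapunov function: the objective `F` with partial derivatives `F'`
and its components `Fs`, the coordinates `Y` and the squared distance `Q` relative to the minimizer,
and the optimality gap `X`. -/
structure IsDescentSetup (M L : ℝ) (F : Hilb d →L[ℂ] Hilb d) (F' : Fin d → Hilb d →L[ℂ] Hilb d)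
    (Fs : Fin m → Hilb d →L[ℂ] Hilb d) (Fs' : Fin m → Fin d → Hilb d →L[ℂ] Hilb d)
    (Y : Fin d → Hilb d →L[ℂ] Hilb d) (Q X : Hilb d →L[ℂ] Hilb d) : Prop where
  fam : IsMultiplierFamily (H := Hilb d) (mulOps d) HasGradH10 M F F' Fs Fs'
  virial : IsVirial (H := Hilb d) HasGradH10 Y
  memY : ∀ k, Y k ∈ mulOps d
  boundY : ∀ k x, ‖Y k x‖ ≤ M * ‖x‖
  multQ : IsMultiplier (H := Hilb d) (mulOps d) HasGradH10 Q (fun k => (2 : ℂ) • Y k)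
  eqQ : Q = ∑ k, Y k * Y k
  boundQ : ∀ x, ‖Q x‖ ≤ M * ‖x‖
  multX : IsMultiplier (H := Hilb d) (mulOps d) HasGradH10 X F'
  boundX : ∀ x, ‖X x‖ ≤ M * ‖x‖
  conv : ∀ x, (⟪x, X x⟫_ℂ).re ≤ (⟪x, (∑ k, Y k * F' k : Hilb d →L[ℂ] Hilb d) x⟫_ℂ).re
  nonneg : ∀ x, 0 ≤ (⟪x, X x⟫_ℂ).re
  boundL : ∀ j x, ∑ k, ‖Fs' j k x‖ ^ 2 ≤ L * ‖x‖ ^ 2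

/-- The regularized Lyapunov function. -/
def lyapunov (b θ ε : ℝ) (Y : Fin d → Hilb d →L[ℂ] Hilb d) (Q X R : Hilb d →L[ℂ] Hilb d)
    (N : Fin d → Hilb d →L[ℂ] Hilb d) (ρ : Hilb d →L[ℂ] Hilb d) : ℝ :=
  1 / 2 * omega ρ (R * (Q * R)) + θ / (2 * b) * omega ρ (R * radOp Y R N) +
    θ ^ 2 / (2 * b ^ 2) * omega ρ (yosida ε R) + b * omega ρ (R * (X * R))

variable {M L : ℝ} {F : Hilb d →L[ℂ] Hilb d} {F' : Fin d → Hilb d →L[ℂ] Hilb d}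
  {Fs : Fin m → Hilb d →L[ℂ] Hilb d} {Fs' : Fin m → Fin d → Hilb d →L[ℂ] Hilb d}
  {Y : Fin d → Hilb d →L[ℂ] Hilb d} {Q X R : Hilb d →L[ℂ] Hilb d}
  {N : Fin d → Hilb d →L[ℂ] Hilb d} {ρ : Hilb d →L[ℂ] Hilb d} {b θ ε η : ℝ}

theorem re_inner_one (φ : Hilb d) : (⟪φ, (1 : Hilb d →L[ℂ] Hilb d) φ⟫_ℂ).re = ‖φ‖ ^ 2 := by
  rw [one_apply_eq_self, inner_self_eq_ofReal, Complex.ofReal_re]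

theorem re_inner_ofReal_smul (c : ℝ) (A : Hilb d →L[ℂ] Hilb d) (φ : Hilb d) :
    (⟪φ, ((c : ℂ) • A) φ⟫_ℂ).re = c * (⟪φ, A φ⟫_ℂ).re := by
  rw [smul_apply, inner_smul_right, Complex.re_ofReal_mul]

theorem re_inner_add_apply (A B : Hilb d →L[ℂ] Hilb d) (φ : Hilb d) :
    (⟪φ, (A + B) φ⟫_ℂ).re = (⟪φ, A φ⟫_ℂ).re + (⟪φ, B φ⟫_ℂ).re := by
  rw [add_apply, inner_add_right, Complex.add_re]

theorem re_inner_sub_apply (A B : Hilb d →L[ℂ] Hilb d) (φ : Hilb d) :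
    (⟪φ, (A - B) φ⟫_ℂ).re = (⟪φ, A φ⟫_ℂ).re - (⟪φ, B φ⟫_ℂ).re := by
  rw [sub_apply, inner_sub_right, Complex.sub_re]

theorem omega_zero (ρ : Hilb d →L[ℂ] Hilb d) : omega ρ 0 = 0 := by
  have := omega_smul ρ 0 0
  simpa using this

theorem IsResolvent.omega_yosida_nonneg (hR : IsResolvent (H := Hilb d) HasGradH10 ε R N)
    (hρ : IsState ρ) : 0 ≤ omega ρ (yosida ε R) := by
  rw [← omega_zero ρ]
  refine hρ.omega_le fun φ => ?_
  rw [zero_apply, inner_zero_right, Complex.zero_re]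
  exact hR.kin_nonneg φ

theorem IsDescentSetup.nonneg_re_mul (h : IsDescentSetup M L F F' Fs Fs' Y Q X)
    (hR : IsResolvent (H := Hilb d) HasGradH10 ε R N) (hρ : IsState ρ) :
    0 ≤ omega ρ (R * (X * R)) := by
  rw [← omega_zero ρ]
  refine hρ.omega_le fun φ => ?_
  rw [zero_apply, inner_zero_right, Complex.zero_re, mul_apply_eq_comp, ← hR.symm]
  exact h.nonneg (R φ)

theorem IsDescentSetup.kinetic_le (h : IsDescentSetup M L F F' Fs Fs' Y Q X)
    (hR : IsResolvent (H := Hilb d) HasGradH10 ε R N) (hρ : IsState ρ) (hb : 0 < b) :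
    (θ / b) ^ 2 * omega ρ (yosida ε R) ≤ 2 * M + 4 * lyapunov b θ ε Y Q X R N ρ ∧
    b * omega ρ (R * (X * R)) ≤ lyapunov b θ ε Y Q X R N ρ := by
  have hpt := fun φ => hR.kin_le_lyapunov isSymmAlgebra_mulOps h.memY h.eqQ h.boundQ h.fam.nonneg
    (θ / b) φ
  set J : Hilb d →L[ℂ] Hilb d := ((1 / 2 : ℝ) : ℂ) • (R * (Q * R)) +
    ((θ / b / 2 : ℝ) : ℂ) • (R * radOp Y R N) + (((θ / b) ^ 2 / 2 : ℝ) : ℂ) • yosida ε R with hJ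
  have hJφ : ∀ φ, (⟪φ, J φ⟫_ℂ).re = 1 / 2 * (⟪φ, (R * (Q * R)) φ⟫_ℂ).re +
      θ / b / 2 * (⟪φ, (R * radOp Y R N) φ⟫_ℂ).re + (θ / b) ^ 2 / 2 * kin ε R φ := by
    intro φ
    rw [hJ, re_inner_add_apply, re_inner_add_apply, re_inner_ofReal_smul, re_inner_ofReal_smul,
      re_inner_ofReal_smul, kin]
  have hJω : lyapunov b θ ε Y Q X R N ρ = omega ρ J + b * omega ρ (R * (X * R)) := by
    rw [lyapunov, hJ, omega_add hρ.traceClass, omega_add hρ.traceClass, omega_smul, omega_smul,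
      omega_smul]
    field_simp
  have h1 : omega ρ ((((θ / b) ^ 2 : ℝ) : ℂ) • yosida ε R) ≤
      omega ρ (((2 * M : ℝ) : ℂ) • 1 + ((4 : ℝ) : ℂ) • J) := by
    refine hρ.omega_le fun φ => ?_
    rw [re_inner_ofReal_smul, re_inner_add_apply, re_inner_ofReal_smul,
      re_inner_ofReal_smul, re_inner_one, hJφ]
    exact (hpt φ).1
  have h2 : 0 ≤ omega ρ J := by
    rw [← omega_zero ρ]
    refine hρ.omega_le fun φ => ?_
    rw [zero_apply, inner_zero_right, Complex.zero_re, hJφ]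
    exact (hpt φ).2.1
  rw [omega_smul, omega_add hρ.traceClass, omega_smul, omega_smul,
    hρ.omega_one] at h1
  have h3 := mul_nonneg hb.le (h.nonneg_re_mul hR hρ)
  rw [hJω]
  constructor <;> linarith

theorem IsDescentSetup.lyapunov_le (h : IsDescentSetup M L F F' Fs Fs' Y Q X)
    (hR : IsResolvent (H := Hilb d) HasGradH10 ε R N) (hρ : IsState ρ) (hb : 0 < b) (hθ : 0 < θ) :
    lyapunov b θ ε Y Q X R N ρ ≤ 1 / 2 * M + θ / (2 * b) * (M + omega ρ (yosida ε R)) +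
      θ ^ 2 / (2 * b ^ 2) * omega ρ (yosida ε R) + b * M := by
  have hpt := fun φ => hR.kin_le_lyapunov isSymmAlgebra_mulOps h.memY h.eqQ h.boundQ h.fam.nonneg
    (θ / b) φ
  have h1 : omega ρ (R * (Q * R)) ≤ M := by
    have : omega ρ (R * (Q * R)) ≤ omega ρ ((M : ℂ) • 1) := hρ.omega_le fun φ => by
      rw [re_inner_ofReal_smul, re_inner_one]
      exact (le_abs_self _).trans (hpt φ).2.2.1
    rwa [omega_smul, hρ.omega_one, mul_one] at this
  have h2 : omega ρ (R * radOp Y R N) ≤ M + omega ρ (yosida ε R) := by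
    have : omega ρ (R * radOp Y R N) ≤ omega ρ ((M : ℂ) • 1 + yosida ε R) :=
      hρ.omega_le fun φ => by
        rw [re_inner_add_apply, re_inner_ofReal_smul, re_inner_one]
        exact (le_abs_self _).trans (hpt φ).2.2.2
    rwa [omega_add hρ.traceClass, omega_smul, hρ.omega_one, mul_one] at this
  have h3 : omega ρ (R * (X * R)) ≤ M := by
    have : omega ρ (R * (X * R)) ≤ omega ρ ((M : ℂ) • 1) := hρ.omega_le fun φ => by
      rw [re_inner_ofReal_smul, re_inner_one, mul_apply_eq_comp, mul_apply_eq_comp, ← hR.symm]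
      refine (le_abs_self _).trans ((abs_re_inner_le _ _).trans ?_)
      have h4 := hR.norm_le φ
      have h5 := h.boundX (R φ)
      have h6 := h.fam.nonneg
      calc ‖R φ‖ * ‖X (R φ)‖ ≤ ‖R φ‖ * (M * ‖R φ‖) := by gcongr
        _ ≤ ‖φ‖ * (M * ‖φ‖) := by gcongr
        _ = M * ‖φ‖ ^ 2 := by ring
    rwa [omega_smul, hρ.omega_one, mul_one] at this
  rw [lyapunov]
  gcongr

/-- Removes the regularization of the gap: since `‖φ - Rφ‖² ≤ ε kin`, replacing `RXR` by `X` costs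
`√ε` times one plus the kinetic energy. -/
theorem IsDescentSetup.omega_gap_le (h : IsDescentSetup M L F F' Fs Fs' Y Q X)
    (hR : IsResolvent (H := Hilb d) HasGradH10 ε R N) (hρ : IsState ρ) :
    omega ρ X ≤ omega ρ (R * (X * R)) + M * √ε * (1 + omega ρ (yosida ε R)) := by
  have hM := h.fam.nonneg
  have : omega ρ X ≤ omega ρ (R * (X * R) + ((M * √ε : ℝ) : ℂ) • (1 + yosida ε R)) := by
    refine hρ.omega_le fun φ => ?_
    rw [re_inner_add_apply, re_inner_ofReal_smul, re_inner_add_apply, re_inner_one,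
      mul_apply_eq_comp, mul_apply_eq_comp, ← hR.symm]
    change _ ≤ _ + M * √ε * (‖φ‖ ^ 2 + kin ε R φ)
    have e : (⟪φ, X φ⟫_ℂ).re = (⟪R φ, X (R φ)⟫_ℂ).re + (⟪φ - R φ, X φ⟫_ℂ).re +
        (⟪R φ, X (φ - R φ)⟫_ℂ).re := by
      rw [map_sub, inner_sub_left, inner_sub_right, Complex.sub_re, Complex.sub_re]
      ring
    have h1 := (le_abs_self _).trans (abs_re_inner_le (φ - R φ) (X φ))
    have h2 := (le_abs_self _).trans (abs_re_inner_le (R φ) (X (φ - R φ)))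
    have h3 : ‖φ - R φ‖ * ‖X φ‖ ≤ M * (‖φ - R φ‖ * ‖φ‖) := by
      have := mul_le_mul_of_nonneg_left (h.boundX φ) (norm_nonneg (φ - R φ))
      linarith
    have h4 : ‖R φ‖ * ‖X (φ - R φ)‖ ≤ M * (‖φ - R φ‖ * ‖φ‖) := by
      have h5 := hR.norm_le φ
      calc ‖R φ‖ * ‖X (φ - R φ)‖ ≤ ‖φ‖ * (M * ‖φ - R φ‖) := by
            gcongr
            exact h.boundX _
        _ = _ := by ring
    have hk := hR.kin_nonneg φ
    have h6 : ‖φ - R φ‖ ≤ √ε * √(kin ε R φ) := by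
      rw [← Real.sqrt_mul hR.pos.le]
      exact Real.le_sqrt_of_sq_le (hR.norm_sub_sq_le φ)
    have h7 : 2 * (‖φ - R φ‖ * ‖φ‖) ≤ √ε * (‖φ‖ ^ 2 + kin ε R φ) := by
      have h8 := Real.sq_sqrt hk
      have h9 : 2 * (√(kin ε R φ) * ‖φ‖) ≤ ‖φ‖ ^ 2 + kin ε R φ := by
        nlinarith [sq_nonneg (√(kin ε R φ) - ‖φ‖)]
      calc 2 * (‖φ - R φ‖ * ‖φ‖) ≤ 2 * (√ε * √(kin ε R φ) * ‖φ‖) := by gcongr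
        _ = √ε * (2 * (√(kin ε R φ) * ‖φ‖)) := by ring
        _ ≤ _ := by gcongr
    have h10 := mul_le_mul_of_nonneg_left h7 hM
    rw [e]
    linarith
  rwa [omega_add hρ.traceClass, omega_smul, omega_add hρ.traceClass, hρ.omega_one] at this

/-- The constant of the regularization error in the evolution of the Lyapunov function. -/
def evolutionError (d : ℕ) (M b θ η : ℝ) : ℝ :=
  (1 / 2 + b) * (b / θ + η * b ^ 2 / θ ^ 2) * (4 * d * M ^ 2 + 16 * d * M ^ 3) +
    θ / (2 * b) * (b / θ + η * b ^ 2 / θ ^ 2) * radBound d M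

theorem IsDescentSetup.omega_deriv_le (h : IsDescentSetup M L F F' Fs Fs' Y Q X)
    (hR : IsResolvent (H := Hilb d) HasGradH10 ε R N) (hρ : IsState ρ) (hb : 0 < b) (hθ : 0 < θ)
    (hη : 0 < η) :
    1 / 2 * omega ρ (genDual (θ / b ^ 2) (b / θ) (η * b ^ 2 / θ ^ 2) (yosida ε R) F Fs (Q * R)
        (R * (Q * R))) +
      θ / (2 * b) * omega ρ (genDual (θ / b ^ 2) (b / θ) (η * b ^ 2 / θ ^ 2) (yosida ε R) F Fs
        (radOp Y R N) (R * radOp Y R N)) +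
      θ ^ 2 / (2 * b ^ 2) * (-(1 / ε) * omega ρ (genDual (θ / b ^ 2) (b / θ)
        (η * b ^ 2 / θ ^ 2) (yosida ε R) F Fs 1 R)) +
      b * omega ρ (genDual (θ / b ^ 2) (b / θ) (η * b ^ 2 / θ ^ 2) (yosida ε R) F Fs (X * R)
        (R * (X * R))) -
      θ / (2 * b ^ 2) * omega ρ (R * radOp Y R N) - θ ^ 2 / b ^ 3 * omega ρ (yosida ε R) +
      omega ρ (R * (X * R)) ≤
    η / 2 * L + evolutionError d M b θ η * √ε * (1 + omega ρ (yosida ε R)) := by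
  have hS := isSymmAlgebra_mulOps (d := d)
  have hFsymm := hS.symm F h.fam.mult.mem
  have hFssymm := fun j => hS.symm (Fs j) (h.fam.mults j).mem
  set Ω := fun M O => genDual (θ / b ^ 2) (b / θ) (η * b ^ 2 / θ ^ 2) (yosida ε R) F Fs M O with hΩ
  have hq : ∀ M O, (∀ x y, ⟪O x, y⟫_ℂ = ⟪x, O y⟫_ℂ) → ∀ φ, (⟪φ, Ω M O φ⟫_ℂ).re =
      genForm (θ / b ^ 2) (b / θ) (η * b ^ 2 / θ ^ 2) (yosida ε R) F Fs M O φ := fun M O hO φ =>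
    re_inner_genDual hR.yosida_symm hFsymm hFssymm hO φ
  have key : omega ρ (((1 / 2 : ℝ) : ℂ) • Ω (Q * R) (R * (Q * R)) +
      ((θ / (2 * b) : ℝ) : ℂ) • Ω (radOp Y R N) (R * radOp Y R N) +
      ((θ ^ 2 / (2 * b ^ 2) * -(1 / ε) : ℝ) : ℂ) • Ω 1 R +
      ((b : ℝ) : ℂ) • Ω (X * R) (R * (X * R)) -
      ((θ / (2 * b ^ 2) : ℝ) : ℂ) • (R * radOp Y R N) -
      ((θ ^ 2 / b ^ 3 : ℝ) : ℂ) • yosida ε R + R * (X * R)) ≤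
      omega ρ (((η / 2 * L : ℝ) : ℂ) • 1 +
        ((evolutionError d M b θ η * √ε : ℝ) : ℂ) • (1 + yosida ε R)) := by
    refine hρ.omega_le fun φ => ?_
    simp only [re_inner_add_apply, re_inner_sub_apply, re_inner_ofReal_smul, re_inner_one]
    rw [hq _ _ (hR.mul_mul_symm (hS.symm Q h.multQ.mem)), hq _ _ (hR.mul_radOp_symm h.virial),
      hq _ _ hR.symm, hq _ _ (hR.mul_mul_symm (hS.symm X h.multX.mem))]
    have := h.fam.lyapunov_deriv_le hR isLinearGraph_hasGradH10 hS h.virial h.memY h.boundY h.multQ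
      h.boundQ h.multX h.boundX h.conv h.boundL hb hθ hη φ
    rw [mul_assoc (θ ^ 2 / (2 * b ^ 2))]
    exact this
  have htr := hρ.traceClass
  simp only [omega_add htr, omega_sub htr, omega_smul, hρ.omega_one] at key
  rw [← mul_assoc (θ ^ 2 / (2 * b ^ 2))]
  linarith

end Lyapunov

/-! ### Linear growth of the Lyapunov function up to errors of order `√ε`. -/

section Growth

open scoped InnerProductSpace

variable {d m : ℕ} {M L : ℝ} {f : Fin m → E d → ℝ} {F' : Fin d → Hilb d →L[ℂ] Hilb d}
  {Fs' : Fin m → Fin d → Hilb d →L[ℂ] Hilb d}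
  {Y : Fin d → Hilb d →L[ℂ] Hilb d} {Q X R : Hilb d →L[ℂ] Hilb d}
  {N : Fin d → Hilb d →L[ℂ] Hilb d} {ε η S B θ : ℝ} {ψ χ u τ : ℝ → ℝ}
  {ρ₀ : Hilb d →L[ℂ] Hilb d} {ρ : ℝ → Hilb d →L[ℂ] Hilb d}

theorem IsState.omega_yosida {σ : Hilb d →L[ℂ] Hilb d} (hσ : IsState σ) :
    omega σ (yosida ε R) = ε⁻¹ * (1 - omega σ R) := by
  rw [yosida, omega_smul, omega_sub hσ.traceClass, hσ.omega_one]

theorem hasDerivAt_div_linear {t : ℝ} (hb : B + t ≠ 0) (θ : ℝ) :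
    HasDerivAt (fun s => θ / (2 * (B + s))) (-(θ / (2 * (B + t) ^ 2))) t := by
  have h := ((((hasDerivAt_id t).const_add B).const_mul 2).fun_inv
    (by simpa using hb)).const_mul θ
  refine h.congr_deriv ?_
  simp only [id]
  field_simp

theorem hasDerivAt_div_sq {t : ℝ} (hb : B + t ≠ 0) (θ : ℝ) :
    HasDerivAt (fun s => θ ^ 2 / (2 * (B + s) ^ 2)) (-(θ ^ 2 / (B + t) ^ 3)) t := by
  have h := (((((hasDerivAt_id t).const_add B).fun_pow 2).const_mul 2).fun_inv
    (by simpa using hb)).const_mul (θ ^ 2)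
  refine h.congr_deriv ?_
  simp only [id]
  field_simp
  norm_num

theorem IsDescentSetup.exists_hasDerivWithinAt_lyapunov
    (h : IsDescentSetup M L (mulOp (avg f)) F' (fun j => mulOp (f j)) Fs' Y Q X)
    (hR : IsResolvent (H := Hilb d) HasGradH10 ε R N)
    (hρ : IsSolution f η S ψ χ u τ ρ₀ ρ) (hB : 0 < B) (hθ : 0 < θ) (hη : 0 < η) (hS : 0 < S)
    {t : ℝ} (ht : t ∈ Icc 0 S)
    (h1 : u t * Real.exp (ψ (τ t)) = θ / (B + t) ^ 2)
    (h2 : u t * Real.exp (χ (τ t)) = (B + t) / θ) :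
    ∃ E', HasDerivWithinAt (fun s => lyapunov (B + s) θ ε Y Q X R N (ρ s)) E' (Icc 0 S) t ∧
      E' ≤ η / 2 * L + evolutionError d M (B + t) θ η * √ε * (1 + omega (ρ t) (yosida ε R)) := by
  have hb : 0 < B + t := by linarith [ht.1]
  have h3 : u t ^ 2 * η * Real.exp (2 * χ (τ t)) = η * (B + t) ^ 2 / θ ^ 2 := by
    have : Real.exp (2 * χ (τ t)) = Real.exp (χ (τ t)) ^ 2 := by
      rw [← Real.exp_nat_mul]; norm_num
    rw [this]
    calc u t ^ 2 * η * Real.exp (χ (τ t)) ^ 2 = η * (u t * Real.exp (χ (τ t))) ^ 2 := by ring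
      _ = _ := by rw [h2, div_pow]; ring
  have hderiv : ∀ M O, O = R * M → (∀ x y, ⟪O x, y⟫_ℂ = ⟪x, O y⟫_ℂ) →
      HasDerivWithinAt (fun s => omega (ρ s) O)
        (omega (ρ t) (genDual (θ / (B + t) ^ 2) ((B + t) / θ) (η * (B + t) ^ 2 / θ ^ 2)
          (yosida ε R) (mulOp (avg f)) (fun j => mulOp (f j)) M O)) (Icc 0 S) t := by
    intro M O hO hsymm
    have := hρ.hasDerivWithinAt_omega hS ht hR hO (by
      rw [hO]
      exact eq_star_mul_of_symm hR.symm (by rwa [← hO]))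
    rwa [h1, h2, h3] at this
  have hsym := isSymmAlgebra_mulOps (d := d)
  have d1 := hderiv _ _ rfl (hR.mul_mul_symm (hsym.symm Q h.multQ.mem))
  have d2 := hderiv _ _ rfl (hR.mul_radOp_symm h.virial)
  have d3 := hderiv 1 R (mul_one R).symm hR.symm
  have d4 := hderiv _ _ rfl (hR.mul_mul_symm (hsym.symm X h.multX.mem))
  have d3' : HasDerivWithinAt (fun s => omega (ρ s) (yosida ε R)) _ (Icc 0 S) t :=
    ((d3.const_sub 1).const_mul ε⁻¹).congr_of_mem (fun s hs => (hρ.state s hs).omega_yosida) ht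
  have hd := (((d1.const_mul (1 / 2)).add
    ((hasDerivAt_div_linear hb.ne' θ).hasDerivWithinAt.mul d2)).add
    ((hasDerivAt_div_sq hb.ne' θ).hasDerivWithinAt.mul d3')).add
    (((hasDerivAt_id t).const_add B).hasDerivWithinAt.mul d4)
  refine ⟨_, hd, ?_⟩
  refine le_trans (le_of_eq ?_) (h.omega_deriv_le hR (hρ.state t ht) hb hθ hη)
  simp only [id]
  ring

/-- A linear differential inequality. -/
theorem le_exp_mul_of_deriv_le {g : ℝ → ℝ} {δ c : ℝ} (hδ : 0 ≤ δ) (hc : 0 ≤ c)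
    (h : ∀ t ∈ Icc 0 S, ∃ g', HasDerivWithinAt g g' (Icc 0 S) t ∧ g' ≤ c + δ * g t) {t : ℝ}
    (ht : t ∈ Icc 0 S) : g t ≤ Real.exp (δ * t) * (g 0 + c * t) := by
  choose! g' hg hle using h
  have hS : 0 ≤ S := ht.1.trans ht.2
  have hd : ∀ s ∈ Icc 0 S, HasDerivWithinAt (fun s => Real.exp (-(δ * s)) * g s - c * s)
      (Real.exp (-(δ * s)) * (g' s - δ * g s) - c) (Icc 0 S) s := by
    intro s hs
    have h1 : HasDerivAt (fun s => Real.exp (-(δ * s))) (Real.exp (-(δ * s)) * -(δ * 1)) s :=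
      (((hasDerivAt_id s).const_mul δ).fun_neg).exp
    refine ((h1.hasDerivWithinAt.mul (hg s hs)).sub
      ((hasDerivAt_id s).const_mul c).hasDerivWithinAt).congr_deriv ?_
    ring
  -- The integrating factor turns the inequality into a derivative of at most `c e^{-δs} ≤ c`, so
  -- subtracting `c s` gives a decreasing function.
  have hanti : AntitoneOn (fun s => Real.exp (-(δ * s)) * g s - c * s) (Icc 0 S) := by
    refine antitoneOn_of_hasDerivWithinAt_nonpos (convex_Icc 0 S)
      (fun s hs => (hd s hs).continuousWithinAt)
      (fun s hs => (hd s (interior_subset hs)).mono interior_subset) fun s hs => ?_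
    have hs' := interior_subset hs
    have h1 : Real.exp (-(δ * s)) ≤ 1 := Real.exp_le_one_iff.2 (by
      have := mul_nonneg hδ hs'.1
      linarith)
    have h2 := hle s hs'
    have h3 : Real.exp (-(δ * s)) * (g' s - δ * g s) ≤ Real.exp (-(δ * s)) * c :=
      mul_le_mul_of_nonneg_left (by linarith) (Real.exp_pos _).le
    nlinarith
  have h1 := hanti ⟨le_rfl, hS⟩ ht ht.1
  simp only [mul_zero, neg_zero, Real.exp_zero, one_mul, sub_zero] at h1
  have h2 : g t = Real.exp (δ * t) * (Real.exp (-(δ * t)) * g t) := by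
    rw [← mul_assoc, ← Real.exp_add, add_neg_cancel, Real.exp_zero, one_mul]
  rw [h2]
  exact mul_le_mul_of_nonneg_left (by linarith) (Real.exp_pos _).le

theorem continuousOn_evolutionError (d : ℕ) (M : ℝ) (hB : 0 < B) (θ η S : ℝ) :
    ContinuousOn (fun t => evolutionError d M (B + t) θ η) (Icc 0 S) := by
  have hne : ∀ t ∈ Icc 0 S, 2 * (B + t) ≠ 0 := fun t ht => by
    have := ht.1
    positivity
  have hb : Continuous fun t : ℝ => B + t := by fun_prop
  have h1 : Continuous fun t : ℝ => (B + t) / θ + η * (B + t) ^ 2 / θ ^ 2 := by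
    fun_prop
  unfold evolutionError
  refine ContinuousOn.add ?_ ?_
  · fun_prop
  · exact ((continuousOn_const.div (by fun_prop) hne).mul h1.continuousOn).mul continuousOn_const

/-- The regularized Lyapunov function grows at most linearly, up to an error of order `√ε`. -/
theorem IsDescentSetup.exists_lyapunov_bound
    (h : IsDescentSetup M L (mulOp (avg f)) F' (fun j => mulOp (f j)) Fs' Y Q X) (hL : 0 ≤ L)
    (hρ : IsSolution f η S ψ χ u τ ρ₀ ρ) (hB : 0 < B) (hθ : 0 < θ) (hη : 0 < η)
    (h1 : ∀ t ∈ Icc 0 S, u t * Real.exp (ψ (τ t)) = θ / (B + t) ^ 2)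
    (h2 : ∀ t ∈ Icc 0 S, u t * Real.exp (χ (τ t)) = (B + t) / θ) :
    ∃ C, 0 ≤ C ∧ ∀ (ε : ℝ) (R : Hilb d →L[ℂ] Hilb d) (N : Fin d → Hilb d →L[ℂ] Hilb d),
      IsResolvent (H := Hilb d) HasGradH10 ε R N → ∀ t ∈ Icc 0 S,
      lyapunov (B + t) θ ε Y Q X R N (ρ t) ≤ Real.exp (C * √ε * t) *
        (lyapunov B θ ε Y Q X R N ρ₀ + (η / 2 * L + C * √ε) * t) ∧
      omega (ρ t) (yosida ε R) ≤ C * (1 + lyapunov (B + t) θ ε Y Q X R N (ρ t)) := by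
  obtain ⟨C₀, hC₀⟩ := isCompact_Icc.exists_bound_of_continuousOn
    (continuousOn_evolutionError d M hB θ η S)
  have hM := h.fam.nonneg
  rcases lt_or_ge S 0 with hneg | hS
  · exact ⟨0, le_rfl, fun ε R N _ t ht => absurd (ht.1.trans ht.2) (not_le.2 hneg)⟩
  have hC₀0 : 0 ≤ C₀ := (norm_nonneg _).trans (hC₀ 0 ⟨le_rfl, hS⟩)
  -- Solves the kinetic bound of `kinetic_le` for the kinetic energy, with `B + t ≤ B + S`.
  set c := ((B + S) / θ) ^ 2 * (2 * M + 4) with hc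
  have hc0 : 0 ≤ c := by positivity
  have hkin : ∀ (ε : ℝ) (R : Hilb d →L[ℂ] Hilb d) (N : Fin d → Hilb d →L[ℂ] Hilb d),
      IsResolvent (H := Hilb d) HasGradH10 ε R N → ∀ t ∈ Icc 0 S,
      0 ≤ lyapunov (B + t) θ ε Y Q X R N (ρ t) ∧
      omega (ρ t) (yosida ε R) ≤ c * (1 + lyapunov (B + t) θ ε Y Q X R N (ρ t)) := by
    intro ε R N hR t ht
    have hb : 0 < B + t := by linarith [ht.1]
    obtain ⟨k1, k2⟩ := h.kinetic_le (θ := θ) hR (hρ.state t ht) hb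
    have k3 := (mul_nonneg hb.le (h.nonneg_re_mul hR (hρ.state t ht))).trans k2
    refine ⟨k3, ?_⟩
    set l := lyapunov (B + t) θ ε Y Q X R N (ρ t)
    have k4 : omega (ρ t) (yosida ε R) ≤ ((B + t) / θ) ^ 2 * (2 * M + 4 * l) := by
      have e : ((B + t) / θ) ^ 2 * ((θ / (B + t)) ^ 2 * omega (ρ t) (yosida ε R)) =
          omega (ρ t) (yosida ε R) := by field_simp
      rw [← e]
      gcongr
    refine k4.trans ?_
    rw [hc, mul_assoc]
    have hle : B + t ≤ B + S := by linarith [ht.2]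
    have h5 : 2 * M + 4 * l ≤ (2 * M + 4) * (1 + l) := by nlinarith
    gcongr
  -- Dependence on `S`, `η` and the other data is harmless, because in the growth bound this
  -- constant always comes with `√ε`, which tends to zero.
  set C := c + C₀ * (1 + c) with hC
  have hC0 : 0 ≤ C := by positivity
  refine ⟨C, hC0, fun ε R N hR t ht => ⟨?_, ?_⟩⟩
  · rcases eq_or_lt_of_le hS with hS0 | hSpos
    · have ht0 : t = 0 := le_antisymm (hS0 ▸ ht.2) ht.1
      subst ht0
      rw [hρ.init]
      simp
    have hgrow := le_exp_mul_of_deriv_le (S := S) (δ := C * √ε) (c := η / 2 * L + C * √ε)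
      (g := fun s => lyapunov (B + s) θ ε Y Q X R N (ρ s)) (by positivity) (by positivity)
      (fun s hs => ?_) ht
    · simpa only [add_zero, hρ.init] using hgrow
    · obtain ⟨E', hE, hle⟩ := h.exists_hasDerivWithinAt_lyapunov hR hρ hB hθ hη hSpos hs
        (h1 s hs) (h2 s hs)
      refine ⟨E', hE, hle.trans ?_⟩
      obtain ⟨k1, k2⟩ := hkin ε R N hR s hs
      have k3 := (le_abs_self _).trans (hC₀ s hs)
      have k4 := hR.omega_yosida_nonneg (hρ.state s hs)
      set l := lyapunov (B + s) θ ε Y Q X R N (ρ s)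
      set k := omega (ρ s) (yosida ε R)
      have k5 : evolutionError d M (B + s) θ η * √ε * (1 + k) ≤
          C₀ * √ε * (1 + c * (1 + l)) := by gcongr
      have k6 : C₀ * (1 + c * (1 + l)) ≤ C * (1 + l) := by
        rw [hC]
        nlinarith [mul_nonneg hC₀0 k1, mul_nonneg hc0 k1]
      have k7 := mul_le_mul_of_nonneg_right k6 (Real.sqrt_nonneg ε)
      nlinarith
  · obtain ⟨k1, k2⟩ := hkin ε R N hR t ht
    refine k2.trans ?_
    have : c ≤ C := by rw [hC]; nlinarith
    gcongr

end Growth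

/-! ### The concrete data, the limit `ε → 0`, and the final bound. -/

section Conclusion

open scoped InnerProductSpace

variable {d m : ℕ}

theorem exists_norm_apply_le {s : Set (Hilb d →L[ℂ] Hilb d)} (hs : s.Finite) :
    ∃ M, 0 ≤ M ∧ ∀ A ∈ s, ∀ x, ‖A x‖ ≤ M * ‖x‖ := by
  obtain ⟨C, hC⟩ := (hs.image norm).bddAbove
  refine ⟨max C 0, le_max_right _ _, fun A hA x => (A.le_opNorm x).trans ?_⟩
  gcongr
  exact (hC (mem_image_of_mem _ hA)).trans (le_max_left _ _)

theorem convexOn_avg {f : Fin m → E d → ℝ} (hf : ∀ j, ConvexOn ℝ (cube d) (f j)) :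
    ConvexOn ℝ (cube d) (avg f) := by
  refine ⟨convex_cube, fun x hx y hy a b ha hb hab => ?_⟩
  simp only [avg, smul_eq_mul]
  have h1 : ∑ j, f j (a • x + b • y) ≤ ∑ j, (a * f j x + b * f j y) :=
    Finset.sum_le_sum fun j _ => (hf j).2 hx hy ha hb hab
  rw [Finset.sum_add_distrib, ← Finset.mul_sum, ← Finset.mul_sum] at h1
  have h2 : (0 : ℝ) ≤ 1 / m := by positivity
  have h3 := mul_le_mul_of_nonneg_left h1 h2
  linarith

theorem mulOp_avg {g : Fin m → E d → ℝ} (hg : ∀ j, ContinuousOn (g j) (cube d)) (x : Hilb d) :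
    mulOp (avg g) x = ((1 / (m : ℝ) : ℝ) : ℂ) • ∑ j, mulOp (g j) x := by
  have h1 : mulOp (avg g) = ((1 / (m : ℝ) : ℝ) : ℂ) • ∑ j, mulOp (g j) := by
    rw [mulOp_sum _ hg, mulOp_smul (continuousOn_finsetSum _ fun j _ => hg j)]
    rfl
  rw [h1, smul_apply, sum_apply]

/-- The objective and the geometry of the cube provide the data of the Lyapunov function. -/
theorem exists_isDescentSetup (hm : 0 < m) {f : Fin m → E d → ℝ} {L : Fin m → ℝ} {z : E d}
    (hf : ∀ j, ConvexOn ℝ (cube d) (f j)) (hL : ∀ j, SmoothUpTo 2 (L j) (f j)) (hz : z ∈ cube d)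
    (hmin : IsMinOn (avg f) (cube d) z) :
    ∃ M, IsDescentSetup M (d * (⨆ j, L j) ^ 2) (mulOp (avg f))
      (fun k => mulOp (avg fun j => pd k (f j))) (fun j => mulOp (f j))
      (fun j k => mulOp (pd k (f j))) (fun k => mulOp fun x => x k - z k)
      (mulOp fun x => ∑ k, (x k - z k) * (x k - z k)) (mulOp fun x => avg f x - avg f z) := by
  have hfj := fun j => (hL j).hasTaylor
  have hav := HasTaylor.avg hfj
  have hX := hav.sub_const (avg f z)
  have hY : ∀ k, HasTaylor (fun x : E d => x k - z k) fun j _ => if j = k then 1 else 0 :=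
    fun k => hasTaylor_coord k (z k)
  have hQ := hasTaylor_sum_sq z
  obtain ⟨M, hM, hb⟩ := exists_norm_apply_le (d := d)
    (s := {mulOp (avg f)} ∪ range (fun k => mulOp (avg fun j => pd k (f j))) ∪
      range (fun j => mulOp (f j)) ∪ range (fun p : Fin m × Fin d => mulOp (pd p.2 (f p.1))) ∪
      range (fun k : Fin d => mulOp fun x : E d => x k - z k) ∪
      {mulOp fun x => ∑ k, (x k - z k) * (x k - z k)} ∪ {mulOp fun x => avg f x - avg f z})
    (toFinite _)
  refine ⟨M, ⟨hm, hM, hav.isMultiplier, fun j => (hfj j).isMultiplier,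
    mulOp_avg fun j => (hfj j).continuousOn, fun k => mulOp_avg fun j => (hfj j).cont k,
    hb _ (by simp), fun k => hb _ (by simp), fun j => hb _ (by simp), fun j k => hb _ ?_⟩,
    isVirial_coord hz, fun k => ⟨_, (hY k).continuousOn, rfl⟩, fun k => hb _ (by simp), ?_, ?_,
    hb _ (by simp), hX.isMultiplier, hb _ (by simp), fun φ => ?_, fun φ => ?_, fun j φ => ?_⟩
  · have : mulOp (pd k (f j)) ∈ range (fun p : Fin m × Fin d => mulOp (pd p.2 (f p.1))) :=
      ⟨(j, k), rfl⟩
    simp only [mem_union]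
    tauto
  · have e : (fun k : Fin d => (2 : ℂ) • mulOp fun x : E d => x k - z k) =
        fun k => mulOp fun x : E d => 2 * (x k - z k) := by
      funext k
      rw [← mulOp_smul (hY k).continuousOn]
      norm_num
    rw [e]
    exact hQ.isMultiplier
  · have hsq : ∀ k, ContinuousOn (fun x : E d => (x k - z k) * (x k - z k)) (cube d) := fun k =>
      (hY k).continuousOn.mul (hY k).continuousOn
    rw [← mulOp_sum _ hsq]
    exact Finset.sum_congr rfl fun k _ => (mulOp_mul (hY k).continuousOn (hY k).continuousOn).symm
  · have hprod : ∀ k, ContinuousOn (fun x => (x k - z k) * avg (fun j => pd k (f j)) x) (cube d) :=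
      fun k => (hY k).continuousOn.mul (hav.cont k)
    have e : (∑ k, mulOp (fun x => x k - z k) * mulOp (avg fun j => pd k (f j)) :
        Hilb d →L[ℂ] Hilb d) = mulOp fun x => ∑ k, (x k - z k) * avg (fun j => pd k (f j)) x := by
      rw [← mulOp_sum _ hprod]
      exact Finset.sum_congr rfl fun k _ => mulOp_mul (hY k).continuousOn (hav.cont k)
    rw [e]
    refine re_inner_mulOp_le hX.continuousOn (continuousOn_finsetSum _ fun k _ => hprod k)
      (fun x hx => ?_) φ
    -- The gradient inequality is based at `x` and evaluated at the minimizer: `f(x) - f(z) ≤ (x -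
    -- z)·∇f(x)`.
    have h1 := hav.add_le_of_convexOn (convexOn_avg hf) hx hz
    have h2 : ∑ k, avg (fun j => pd k (f j)) x * (z k - x k) =
        -∑ k, (x k - z k) * avg (fun j => pd k (f j)) x := by
      rw [← Finset.sum_neg_distrib]
      exact Finset.sum_congr rfl fun k _ => by ring
    rw [h2] at h1
    linarith
  · have h1 := re_inner_mulOp_le (g := fun _ => (0 : ℝ)) continuousOn_const hX.continuousOn
      (fun x hx => sub_nonneg.2 (hmin hx)) φ
    rwa [mulOp_zero, zero_apply, inner_zero_right, Complex.zero_re] at h1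
  · have h1 : ∀ k, ‖mulOp (pd k (f j)) φ‖ ≤ (⨆ j, L j) * ‖φ‖ := fun k =>
      norm_mulOp_le ((hfj j).cont k) (fun x hx => ((hL j).2 [k] (by simp) x hx).trans
        (le_ciSup (Set.finite_range L).bddAbove j)) φ
    calc ∑ k, ‖mulOp (pd k (f j)) φ‖ ^ 2 ≤ ∑ _k : Fin d, ((⨆ j, L j) * ‖φ‖) ^ 2 :=
          Finset.sum_le_sum fun k _ => pow_le_pow_left₀ (norm_nonneg _) (h1 k) 2
      _ = d * (⨆ j, L j) ^ 2 * ‖φ‖ ^ 2 := by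
          rw [Finset.sum_const, Finset.card_univ, Fintype.card_fin, nsmul_eq_mul]
          ring

/-- The regularized kinetic energy of a state in the domain of the Laplacian. -/
theorem IsResolvent.omega_yosida_le {ε : ℝ} {R : Hilb d →L[ℂ] Hilb d}
    {N : Fin d → Hilb d →L[ℂ] Hilb d} (hR : IsResolvent (H := Hilb d) HasGradH10 ε R N)
    {σ A : Hilb d →L[ℂ] Hilb d} (hA : IsTraceClass A) (h : ∀ φ, HasLaplacian (σ φ) (A φ)) :
    omega σ (yosida ε R) ≤ 2 * (traceNorm A).toReal := by
  have e : yosida ε R * σ = -(R * A) := by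
    ext1 φ
    have := hR.apply_laplacian (h φ)
    rw [neg_apply, mul_apply_eq_comp, mul_apply_eq_comp, this, neg_neg]
  have h1 : omega σ (yosida ε R) ≤ ‖trace (R * A)‖ := by
    rw [omega, e, trace_neg, Complex.neg_re]
    exact (neg_le_abs _).trans (Complex.abs_re_le_norm _)
  have hn : ‖R‖ₑ ≤ 1 := by
    rw [← ofReal_norm]
    exact ENNReal.ofReal_le_one.2 <| R.opNorm_le_bound zero_le_one fun φ => by simpa using hR.norm_le φ
  have h2 : traceNorm (R * A) ≤ 2 * traceNorm A := by
    refine (traceNorm_mul_le R A).trans ?_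
    calc 2 * ‖R‖ₑ * traceNorm A ≤ 2 * 1 * traceNorm A := by gcongr
      _ = 2 * traceNorm A := by rw [mul_one]
  refine h1.trans ((norm_trace_le (hA.mul_left R)).trans ?_)
  have h3 := ENNReal.toReal_mono (ENNReal.mul_lt_top (by simp) hA).ne h2
  simpa using h3

/-- Convergence of the gap, in terms of a uniform bound for the initial Lyapunov function. -/
theorem IsDescentSetup.omega_gap_bound {M L : ℝ} {f : Fin m → E d → ℝ}
    {F' : Fin d → Hilb d →L[ℂ] Hilb d} {Fs' : Fin m → Fin d → Hilb d →L[ℂ] Hilb d}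
    {Y : Fin d → Hilb d →L[ℂ] Hilb d} {Q X : Hilb d →L[ℂ] Hilb d} {η S B θ K : ℝ}
    {ψ χ u τ : ℝ → ℝ} {ρ₀ : Hilb d →L[ℂ] Hilb d} {ρ : ℝ → Hilb d →L[ℂ] Hilb d}
    (h : IsDescentSetup M L (mulOp (SQHD.avg f)) F' (fun j => mulOp (f j)) Fs' Y Q X) (hL : 0 ≤ L)
    (hρ : IsSolution f η S ψ χ u τ ρ₀ ρ) (hB : 0 < B) (hθ : 0 < θ) (hη : 0 < η)
    (h1 : ∀ t ∈ Icc 0 S, u t * Real.exp (ψ (τ t)) = θ / (B + t) ^ 2)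
    (h2 : ∀ t ∈ Icc 0 S, u t * Real.exp (χ (τ t)) = (B + t) / θ)
    (hK : ∀ (ε : ℝ) (R : Hilb d →L[ℂ] Hilb d) (N : Fin d → Hilb d →L[ℂ] Hilb d),
      IsResolvent (H := Hilb d) HasGradH10 ε R N → lyapunov B θ ε Y Q X R N ρ₀ ≤ K)
    {t : ℝ} (ht : t ∈ Icc 0 S) : (B + t) * omega (ρ t) X ≤ K + η / 2 * L * t := by
  obtain ⟨C, hC, hbound⟩ := h.exists_lyapunov_bound hL hρ hB hθ hη h1 h2
  have hM := h.fam.nonneg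
  have hb : 0 < B + t := by linarith [ht.1]
  set U : ℝ → ℝ := fun s => Real.exp (C * s * t) * (K + (η / 2 * L + C * s) * t) with hU
  -- The regularization parameter is `ε = s²`, so that `√ε = s` and the bound is continuous at `s =
  -- 0`.
  have key : ∀ s > 0, (B + t) * omega (ρ t) X ≤ U s + (B + t) * (M * s * (1 + C * (1 + U s))) := by
    intro s hs
    obtain ⟨R, N, hR⟩ := exists_isResolvent d (pow_pos hs 2)
    obtain ⟨b1, b2⟩ := hbound _ R N hR t ht
    have b3 := (h.kinetic_le (θ := θ) hR (hρ.state t ht) hb).2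
    have b4 := h.omega_gap_le hR (hρ.state t ht)
    have b5 := hK _ R N hR
    rw [Real.sqrt_sq hs.le] at b1 b4
    have b6 : lyapunov (B + t) θ (s ^ 2) Y Q X R N (ρ t) ≤ U s := b1.trans (by
      simp only [hU]
      gcongr)
    have b7 : omega (ρ t) (yosida (s ^ 2) R) ≤ C * (1 + U s) := b2.trans (by gcongr)
    calc (B + t) * omega (ρ t) X ≤ (B + t) * (omega (ρ t) (R * (X * R)) +
          M * s * (1 + omega (ρ t) (yosida (s ^ 2) R))) := by gcongr
      _ = (B + t) * omega (ρ t) (R * (X * R)) +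
          (B + t) * (M * s * (1 + omega (ρ t) (yosida (s ^ 2) R))) := by ring
      _ ≤ _ := by
          refine add_le_add (b3.trans b6) ?_
          gcongr
  have hcont : Continuous fun s => U s + (B + t) * (M * s * (1 + C * (1 + U s))) := by
    fun_prop
  have hlim := (hcont.tendsto 0).mono_left (nhdsWithin_le_nhds (s := Ioi 0))
  have hU0 : U 0 = K + η / 2 * L * t := by simp [hU]
  rw [hU0, mul_zero, zero_mul, mul_zero, add_zero] at hlim
  exact ge_of_tendsto hlim (by filter_upwards [self_mem_nhdsWithin] with s hs using key s hs)

theorem gradNoise_nonneg (f : Fin m → E d → ℝ) (x : E d) : 0 ≤ gradNoise f x :=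
  mul_nonneg (by positivity) (Finset.sum_nonneg fun _ _ => Finset.sum_nonneg fun _ _ => sq_nonneg _)

/-- The convergence bound, for an initial state in the domain of the Laplacian. -/
theorem exists_bound_of_hasLaplacian (hm : 0 < m) {f : Fin m → E d → ℝ} {L : Fin m → ℝ} {z : E d}
    (hf : ∀ j, ConvexOn ℝ (cube d) (f j)) (hL : ∀ j, SmoothUpTo 2 (L j) (f j)) (hz : z ∈ cube d)
    (hmin : IsMinOn (avg f) (cube d) z) {ρ₀ A : Hilb d →L[ℂ] Hilb d} (hρ₀ : IsState ρ₀)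
    (hA : IsTraceClass A) (hlap : ∀ φ, HasLaplacian (ρ₀ φ) (A φ)) (b₀ g₀ : ℝ) :
    ∃ C₁ : ℝ, 0 < C₁ ∧
    ∀ (η T S : ℝ) (α β γ ψ χ u τ : ℝ → ℝ) (ρ : ℝ → Hilb d →L[ℂ] Hilb d),
      0 < η → β 0 = b₀ → γ 0 = g₀ → StrongIdealScaling T α β γ ψ χ → IsSchedule T S α β u τ →
      IsSolution f η S ψ χ u τ ρ₀ ρ → ∀ t ∈ Icc 0 S,
        expect (avg f) (ρ t) - (avg f) z ≤
          C₁ * Real.exp (-β (τ t)) + 1 / 2 * η * (gradNoise f z + d * (⨆ j, L j) ^ 2) := by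
  obtain ⟨M, hsetup⟩ := exists_isDescentSetup hm hf hL hz hmin
  set B := Real.exp b₀
  set θ := Real.exp (b₀ - g₀)
  have hB : 0 < B := Real.exp_pos _
  have hθ : 0 < θ := Real.exp_pos _
  have hM := hsetup.fam.nonneg
  set k₀ := 2 * (traceNorm A).toReal
  have hk₀ : 0 ≤ k₀ := by positivity
  set K := 1 / 2 * M + θ / (2 * B) * (M + k₀) + θ ^ 2 / (2 * B ^ 2) * k₀ + B * M
  have hK0 : 0 ≤ K := by positivity
  have hK : ∀ (ε : ℝ) (R : Hilb d →L[ℂ] Hilb d) (N : Fin d → Hilb d →L[ℂ] Hilb d),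
      IsResolvent (H := Hilb d) HasGradH10 ε R N →
      lyapunov B θ ε (fun k => mulOp fun x => x k - z k)
        (mulOp fun x => ∑ k, (x k - z k) * (x k - z k)) (mulOp fun x => avg f x - avg f z) R N ρ₀ ≤
        K := by
    intro ε R N hR
    have h1 := hR.omega_yosida_le hA hlap
    refine (hsetup.lyapunov_le hR hρ₀ hB hθ).trans ?_
    change _ ≤ 1 / 2 * M + θ / (2 * B) * (M + k₀) + θ ^ 2 / (2 * B ^ 2) * k₀ + B * M
    gcongr
  -- `K` bounds the initial Lyapunov function for every `ε`; the summand 1 only ensures strict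
  -- positivity.
  refine ⟨K + 1, by linarith, ?_⟩
  intro η T S α β γ ψ χ u τ ρ hη hβ hγ hs hsch hρ t ht
  have hco := fun s hs' => hsch.coefficients hs (t := s) hs'
  rw [hβ, hγ] at hco
  have hL0 : 0 ≤ (d : ℝ) * (⨆ j, L j) ^ 2 := by positivity
  have hgap := hsetup.omega_gap_bound hL0 hρ hB hθ hη (fun s hs' => (hco s hs').2.1)
    (fun s hs' => (hco s hs').2.2) hK ht
  have hcont : ContinuousOn (avg f) (cube d) :=
    (HasTaylor.avg fun j => (hL j).hasTaylor).continuousOn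
  have hX : omega (ρ t) (mulOp fun x => avg f x - avg f z) = expect (avg f) (ρ t) - avg f z := by
    have e : (mulOp fun x => avg f x - avg f z) = mulOp (avg f) - ((avg f z : ℝ) : ℂ) • 1 := by
      rw [← mulOp_const, sub_eq_add_neg, ← neg_one_smul ℂ]
      have h1 := mulOp_smul (g := fun _ : E d => avg f z) continuousOn_const (-1)
      rw [Complex.ofReal_neg, Complex.ofReal_one] at h1
      rw [h1, mulOp_add hcont continuousOn_const]
      congr 1
      funext x
      ring
    have hst := hρ.state t ht
    rw [e, omega_sub hst.traceClass, omega_smul, hst.omega_one, mul_one]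
    rfl
  rw [hX] at hgap
  have hb : 0 < B + t := by linarith [ht.1]
  have hexp : Real.exp (-β (τ t)) = (B + t)⁻¹ := by rw [Real.exp_neg, (hco t ht).1]
  have hσ := gradNoise_nonneg f z
  set G := expect (avg f) (ρ t) - avg f z
  set Λ := (d : ℝ) * (⨆ j, L j) ^ 2
  -- Bounding `t` by `B + t = e^β` makes the noise contribution constant after division by `e^β`.
  have h1 : η / 2 * Λ * t ≤ η / 2 * Λ * (B + t) :=
    mul_le_mul_of_nonneg_left (by linarith) (by positivity)
  have h2 : G ≤ (K + η / 2 * Λ * (B + t)) * (B + t)⁻¹ := by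
    rw [← div_eq_mul_inv, le_div_iff₀ hb]
    linarith
  have h3 : (K + η / 2 * Λ * (B + t)) * (B + t)⁻¹ = K * (B + t)⁻¹ + η / 2 * Λ := by
    field_simp
  have h4 : 0 ≤ η * gradNoise f z := by positivity
  have h5 : 0 < (B + t)⁻¹ := inv_pos.2 hb
  rw [hexp]
  linarith

end Conclusion

end SQHD

end

theorem theorem1 :
    ∃ C₂ : ℝ, 0 < C₂ ∧
    ∀ (d m : ℕ) (_hm : 0 < m) (f : Fin m → SQHD.E d → ℝ) (L : Fin m → ℝ) (xs : SQHD.E d)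
      (ρ₀ : SQHD.Hilb d →L[ℂ] SQHD.Hilb d) (b₀ g₀ : ℝ),
    (∀ j, ConvexOn ℝ (SQHD.cube d) (f j)) →
    (∀ j, SQHD.SmoothUpTo 2 (L j) (f j)) →
    xs ∈ SQHD.cube d →
    IsLocalMinOn (SQHD.avg f) (SQHD.cube d) xs →
    (∀ y ∈ SQHD.cube d, IsLocalMinOn (SQHD.avg f) (SQHD.cube d) y → y = xs) →
    SQHD.IsState ρ₀ →
    (∃ C : ℝ, SQHD.StateSmoothUpTo 2 C ρ₀) →
    ∃ C₁ : ℝ, 0 < C₁ ∧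
    ∀ (η T S : ℝ) (α β γ ψ χ u τ : ℝ → ℝ) (ρ : ℝ → SQHD.Hilb d →L[ℂ] SQHD.Hilb d),
      0 < η →
      β 0 = b₀ →
      γ 0 = g₀ →
      SQHD.StrongIdealScaling T α β γ ψ χ →
      SQHD.IsSchedule T S α β u τ →
      SQHD.IsSolution f η S ψ χ u τ ρ₀ ρ →
      ∀ t ∈ Icc 0 S,
        SQHD.expect (SQHD.avg f) (ρ t) - (SQHD.avg f) xs ≤
          C₁ * Real.exp (-β (τ t)) +
            C₂ * η * (SQHD.gradNoise f xs + d * (⨆ j, L j) ^ 2) := by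
  refine ⟨1 / 2, by norm_num, ?_⟩
  intro d m hm f L xs ρ₀ b₀ g₀ hf hL hxs hmin _ hρ₀ _
  have hglob : IsMinOn (SQHD.avg f) (SQHD.cube d) xs :=
    IsMinOn.of_isLocalMinOn_of_convexOn hxs hmin (SQHD.convexOn_avg hf)
  -- `C₁` has to be chosen before the solution. If `Δρ₀` is not trace class, the equation at time 0
  -- rules out every solution, so any constant will do.
  by_cases hA : ∃ A, SQHD.IsTraceClass A ∧ ∀ φ, SQHD.HasLaplacian (ρ₀ φ) (A φ)
  · obtain ⟨A, hA, hlap⟩ := hA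
    exact SQHD.exists_bound_of_hasLaplacian hm hf hL hxs hglob hρ₀ hA hlap b₀ g₀
  · refine ⟨1, one_pos, ?_⟩
    intro η T S α β γ ψ χ u τ ρ _ _ _ _ _ hρ t ht
    obtain ⟨D, ⟨A, B, hAt, -, hlap, -⟩, -⟩ := hρ.eqn 0 ⟨le_rfl, ht.1.trans ht.2⟩
    rw [hρ.init] at hlap
    exact absurd ⟨A, hAt, hlap⟩ hA
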